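/- Let $k$ be a field; dg algebras are dg $k$-algebras, $\otimes=\otimes_k$, and $D(A)$ is the derived category of right dg $A$-modules. $\mathrm{Perf}(A)\subset D(A)$ denotes the full thick triangulated subcategory generated by $A$. Two dg algebras $A,B$ are \emph{Morita equivalent} if there is $K\in D(A^{op}\otimes B)$ such that $M\mapsto M\otimes^{\mathbf L}_A K$ is an equivalence $D(A)\to D(B)$. For an object $E$ of a triangulated category let $[E]_0$ be the class of all objects isomorphic to finite direct sums of shifts of $E$, let $[E]_n=[E]_0\star\cdots\star[E]_0$ ($n+1$ factors), where $\mathcal X\star\mathcal Y$ is the class of all $F$ fitting in a distinguished triangle $X\to F\to Y\to X[1]$ with $X\in\mathcal X$, $Y\in\mathcal Y$, and let $\langle E\rangle_n$ be the class of direct summands of objects of $[E]_n$. The \emph{diagonal dimension} $\mathrm{Ddim}\,\mathrm{Perf}(A)\in\mathbb Z_{\ge 0}\cup\{\infty\}$ is the least $n\ge 0$ for which there are $F\in\mathrm{Perf}(A^{op})$ and $G\in\mathrm{Perf}(A)$ such that the diagonal dg $A^{op}\otimes A$-module $A$ belongs to $\langle F\boxtimes G\rangle_n\subset D(A^{op}\otimes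 A)$, where $F\boxtimes G=F\otimes_k G$; it is $\infty$ if there is no such $n$. \textbf{Proposition.} If the dg algebras $A$ and $B$ are Morita equivalent, then $$\mathrm{Ddim}\,\mathrm{Perf}(A)=\mathrm{Ddim}\,\mathrm{Perf}(B).$$ -/

import Mathlib

open CategoryTheory CategoryTheory.Limits DirectSum TensorProduct MulOpposite

universe u

noncomputable section

/-! ### Signs and internal gradings -/

/-- The scalar `(-1)^i` of `k`. -/
def ksign (k : Type u) [Field k] (i : ℤ) : k := ((i.negOnePow : ℤ) : k)

section Graded

variable {k : Type u} [Field k]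

lemma ksign_add (i j : ℤ) : ksign k (i + j) = ksign k i * ksign k j := by
  simp [ksign, Int.negOnePow_add]

lemma ksign_zero : ksign k 0 = 1 := by simp [ksign]

lemma ksign_one : ksign k 1 = -1 := by simp [ksign]

lemma ksign_mul_self (i : ℤ) : ksign k i * ksign k i = 1 := by
  rw [← ksign_add, ksign, Int.negOnePow_even _ (Even.add_self i)]; simp

lemma ksign_ne_zero (i : ℤ) : ksign k i ≠ 0 := by
  intro h; have := ksign_mul_self (k := k) i; simp [h] at this

variable {M : Type u} [AddCommGroup M] [Module k M]

/-- A family of submodules is a grading as soon as it spans and has projections. -/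
lemma isInternal_of_proj (ℳ : ℤ → Submodule k M) (p : ℤ → M →ₗ[k] M)
    (same : ∀ i, ∀ m ∈ ℳ i, p i m = m) (other : ∀ i j, i ≠ j → ∀ m ∈ ℳ i, p j m = 0)
    (span : ⨆ i, ℳ i = ⊤) : DirectSum.IsInternal ℳ := by
  refine DirectSum.isInternal_submodule_of_iSupIndep_of_iSup_eq_top ?_ span
  rw [iSupIndep_def]
  intro i
  rw [Submodule.disjoint_def]
  intro x hx hx'
  have : (⨆ (j) (_ : j ≠ i), ℳ j) ≤ LinearMap.ker (p i) :=
    iSup₂_le fun j hj m hm => other j i hj m hm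
  rw [← same i x hx]
  exact this hx'

variable (ℳ : ℤ → Submodule k M) [DirectSum.Decomposition ℳ]

/-- The projection onto the component of degree `i`. -/
def gproj (i : ℤ) : M →ₗ[k] M :=
  (ℳ i).subtype ∘ₗ DirectSum.component k ℤ (fun i => ℳ i) i ∘ₗ
    (DirectSum.decomposeLinearEquiv ℳ).toLinearMap

lemma gproj_same {i : ℤ} {m : M} (hm : m ∈ ℳ i) : gproj ℳ i m = m :=
  DirectSum.decompose_of_mem_same ℳ hm

lemma gproj_other {i j : ℤ} (h : i ≠ j) {m : M} (hm : m ∈ ℳ i) : gproj ℳ j m = 0 :=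
  DirectSum.decompose_of_mem_ne ℳ hm h

/-- The linear map which on the component of degree `i` is `f i`. -/
def gmap {N : Type u} [AddCommGroup N] [Module k N] (f : ℤ → M →ₗ[k] N) : M →ₗ[k] N :=
  DirectSum.toModule k ℤ N (fun i => f i ∘ₗ (ℳ i).subtype) ∘ₗ
    (DirectSum.decomposeLinearEquiv ℳ).toLinearMap

lemma gmap_of_mem {N : Type u} [AddCommGroup N] [Module k N] (f : ℤ → M →ₗ[k] N)
    {i : ℤ} {m : M} (hm : m ∈ ℳ i) : gmap ℳ f m = f i m := by
  change DirectSum.toModule k ℤ N _ (DirectSum.decompose ℳ m) = _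
  rw [DirectSum.decompose_of_mem ℳ hm, ← DirectSum.lof_eq_of k, DirectSum.toModule_lof]
  rfl

/-- The linear map `m ↦ (-1)^{n i} m` for `m` of degree `i`. -/
def twist (n : ℤ) : M →ₗ[k] M := gmap ℳ fun i => ksign k (n * i) • LinearMap.id

lemma twist_of_mem (n : ℤ) {i : ℤ} {m : M} (hm : m ∈ ℳ i) :
    twist ℳ n m = ksign k (n * i) • m := by
  simp [twist, gmap_of_mem ℳ _ hm]

lemma twist_zero (m : M) : twist ℳ 0 m = m := by
  induction m using DirectSum.Decomposition.inductionOn ℳ with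
  | zero => simp
  | homogeneous m => simp [twist_of_mem ℳ _ m.2, ksign_zero]
  | add x y hx hy => simp [hx, hy]

lemma twist_twist (n l : ℤ) (m : M) : twist ℳ n (twist ℳ l m) = twist ℳ (n + l) m := by
  induction m using DirectSum.Decomposition.inductionOn ℳ with
  | zero => simp
  | homogeneous m =>
    simp only [twist_of_mem ℳ _ m.2, map_smul, smul_smul, add_mul, ksign_add]
    rw [mul_comm]
  | add x y hx hy => simp [hx, hy]

/-- Linear maps which agree on homogeneous elements are equal. -/
lemma gext {N : Type*} [AddCommGroup N] [Module k N] {f g : M →ₗ[k] N}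
    (h : ∀ i, ∀ m ∈ ℳ i, f m = g m) : f = g := by
  ext m
  induction m using DirectSum.Decomposition.inductionOn ℳ with
  | zero => simp
  | homogeneous m => exact h _ _ m.2
  | add x y hx hy => simp [hx, hy]

end Graded

/-! ### Dg algebras and dg bimodules -/

/-- A dg algebra over the field `k` (cohomological grading, unital, associative). -/
structure DGAlg (k : Type u) [Field k] where
  carrier : Type u
  [ring : Ring carrier]
  [algebra : Algebra k carrier]
  grading : ℤ → Submodule k carrier
  [graded : GradedAlgebra grading]
  d : carrier →ₗ[k] carrier
  d_mem : ∀ {i : ℤ} {a : carrier}, a ∈ grading i → d a ∈ grading (i + 1)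
  d_d : ∀ a, d (d a) = 0
  leibniz : ∀ {i : ℤ} {a : carrier}, a ∈ grading i → ∀ b : carrier,
    d (a * b) = d a * b + ksign k i • (a * d b)

namespace DGAlg

instance (k : Type u) [Field k] : CoeSort (DGAlg k) (Type u) := ⟨DGAlg.carrier⟩

attribute [instance] ring algebra graded

variable {k : Type u} [Field k]

/-- The ground field as a dg algebra (in degree zero, with zero differential). -/
def ground (k : Type u) [Field k] : DGAlg k :=
  let gr : ℤ → Submodule k k := fun i => if i = 0 then ⊤ else ⊥
  have h : DirectSum.IsInternal gr := isInternal_of_proj gr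
    (fun i => if i = 0 then LinearMap.id else 0)
    (by intro i m hm; by_cases h : i = 0 <;> simp_all [gr])
    (by
      intro i j h m hm
      by_cases hi : i = 0
      · subst hi; simp [Ne.symm h]
      · have : m = 0 := by simpa [gr, hi] using hm
        simp [this])
    (by rw [eq_top_iff]; exact le_iSup_of_le 0 (by simp [gr]))
  have hm : SetLike.GradedMonoid gr :=
    { one_mem := by simp [gr]
      mul_mem := by
        intro i j a b ha hb
        by_cases hi : i = 0
        · by_cases hj : j = 0
          · simp [gr, hi, hj]
          · have : b = 0 := by simpa [gr, hj] using hb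
            simp [this]
        · have : a = 0 := by simpa [gr, hi] using ha
          simp [this] }
  { carrier := k
    grading := gr
    graded := { toGradedMonoid := hm, toDecomposition := h.chooseDecomposition }
    d := 0
    d_mem := by simp
    d_d := by simp
    leibniz := by simp }

variable (A : DGAlg k)

lemma d_one : A.d (1 : A) = 0 := by
  have := A.leibniz (SetLike.GradedOne.one_mem (A := A.grading)) (1 : A)
  simpa [ksign_zero] using this

/-- The sign automorphism `a ↦ (-1)^{n i} a`, `a` of degree `i`, is multiplicative. -/
def twistHom (n : ℤ) : A →+* A where
  toFun := twist A.grading n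
  map_zero' := map_zero _
  map_add' := map_add _
  map_one' := by
    rw [twist_of_mem _ _ (SetLike.GradedOne.one_mem (A := A.grading))]; simp [ksign_zero]
  map_mul' a b := by
    have : (LinearMap.mul k A).compr₂ (twist A.grading n) =
        (LinearMap.mul k A).compl₁₂ (twist A.grading n) (twist A.grading n) := by
      refine gext A.grading fun i a ha => gext A.grading fun j b hb => ?_
      simp only [LinearMap.compr₂_apply, LinearMap.mul_apply', LinearMap.compl₁₂_apply]
      rw [twist_of_mem _ _ ha, twist_of_mem _ _ hb,
        twist_of_mem _ _ (SetLike.GradedMul.mul_mem ha hb), mul_add, ksign_add]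
      simp [smul_smul, mul_comm]
    simpa using LinearMap.congr_fun₂ this a b

end DGAlg

/-- A dg `A`-`B`-bimodule over `k`: `A` acts on the left and `B` on the right.  This is the same
thing as a right dg module over `A^op ⊗ B`, via `a • m = (-1)^{|a||m|} m (a ⊗ 1)`; right dg
`B`-modules are the case `A = k`, and right dg `A^op`-modules (left dg `A`-modules) are the case
`B = k`. -/
structure DGBimod {k : Type u} [Field k] (A B : DGAlg k) where
  carrier : Type u
  [addCommGroup : AddCommGroup carrier]
  [module : Module k carrier]
  [left : Module A carrier]
  [right : Module Bᵐᵒᵖ carrier]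
  [tower_left : IsScalarTower k A carrier]
  [tower_right : IsScalarTower k Bᵐᵒᵖ carrier]
  [comm : SMulCommClass A Bᵐᵒᵖ carrier]
  grading : ℤ → Submodule k carrier
  isInternal : DirectSum.IsInternal grading
  smul_mem : ∀ {i j : ℤ} {a : A} {m : carrier}, a ∈ A.grading i → m ∈ grading j →
    a • m ∈ grading (i + j)
  rsmul_mem : ∀ {i j : ℤ} {m : carrier} {b : B}, m ∈ grading i → b ∈ B.grading j →
    op b • m ∈ grading (i + j)
  d : carrier →ₗ[k] carrier
  d_mem : ∀ {i : ℤ} {m : carrier}, m ∈ grading i → d m ∈ grading (i + 1)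
  d_d : ∀ m, d (d m) = 0
  d_smul : ∀ {i : ℤ} {a : A}, a ∈ A.grading i → ∀ m : carrier,
    d (a • m) = A.d a • m + ksign k i • (a • d m)
  d_rsmul : ∀ {i : ℤ} {m : carrier}, m ∈ grading i → ∀ b : B,
    d (op b • m) = op b • d m + ksign k i • (op (B.d b) • m)

namespace DGBimod

variable {k : Type u} [Field k] {A B C : DGAlg k}

instance : CoeSort (DGBimod A B) (Type u) := ⟨DGBimod.carrier⟩

attribute [instance] addCommGroup module left right tower_left tower_right comm

instance (M : DGBimod A B) : DirectSum.Decomposition M.grading :=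
  M.isInternal.chooseDecomposition

instance (M : DGBimod A B) : SMulCommClass k A M := IsScalarTower.to_smulCommClass

instance (M : DGBimod A B) : SMulCommClass k Bᵐᵒᵖ M := IsScalarTower.to_smulCommClass

/-- A morphism of dg bimodules: a closed morphism of degree `0`. -/
@[ext]
structure Hom (M N : DGBimod A B) where
  lin : M →ₗ[k] N
  map_smul : ∀ (a : A) (m : M), lin (a • m) = a • lin m
  map_rsmul : ∀ (b : B) (m : M), lin (op b • m) = op b • lin m
  map_mem : ∀ {i : ℤ} {m : M}, m ∈ M.grading i → lin m ∈ N.grading i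
  map_d : ∀ m : M, lin (M.d m) = N.d (lin m)

instance : Category (DGBimod A B) where
  Hom := Hom
  id M := ⟨LinearMap.id, by simp, by simp, by simp, by simp⟩
  comp f g := ⟨g.lin ∘ₗ f.lin, by simp [f.map_smul, g.map_smul],
    by simp [f.map_rsmul, g.map_rsmul], fun h => g.map_mem (f.map_mem h),
    by simp [f.map_d, g.map_d]⟩

/-- The underlying linear map of a morphism. -/
def lin {M N : DGBimod A B} (f : M ⟶ N) : M →ₗ[k] N := Hom.lin f

@[ext]
lemma hom_ext {M N : DGBimod A B} {f g : M ⟶ N} (h : ∀ m, lin f m = lin g m) : f = g :=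
  Hom.ext (LinearMap.ext h)

@[simp] lemma lin_id (M : DGBimod A B) (m : M) : lin (𝟙 M) m = m := rfl

@[simp] lemma lin_comp {M N P : DGBimod A B} (f : M ⟶ N) (g : N ⟶ P) (m : M) :
    lin (f ≫ g) m = lin g (lin f m) := rfl

/-! ### Shifts -/

/-- The underlying space of the shift `M[n]`. -/
def ShiftCarrier (M : DGBimod A B) (_n : ℤ) : Type u := M.carrier

section

variable (M : DGBimod A B) (n : ℤ)

instance : AddCommGroup (M.ShiftCarrier n) := inferInstanceAs (AddCommGroup M)

instance : Module k (M.ShiftCarrier n) := inferInstanceAs (Module k M)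

instance : Module Bᵐᵒᵖ (M.ShiftCarrier n) := inferInstanceAs (Module Bᵐᵒᵖ M)

instance : Module A (M.ShiftCarrier n) :=
  letI : Module A M := Module.compHom M (A.twistHom n)
  inferInstanceAs (Module A M)

/-- The identity map `M → M[n]` on underlying spaces. -/
def toS : M ≃ₗ[k] M.ShiftCarrier n := LinearEquiv.refl k M

lemma smul_toS (a : A) (m : M) : a • M.toS n m = M.toS n (twist A.grading n a • m) := rfl

lemma rsmul_toS (b : Bᵐᵒᵖ) (m : M) : b • M.toS n m = M.toS n (b • m) := rfl

/-- The bimodule `M[n]`, with `M[n]^i = M^{i+n}`, differential `(-1)^n d`, the same right action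
and the left action `a • m = (-1)^{n|a|} a m`. -/
def shiftObj : DGBimod A B where
  carrier := M.ShiftCarrier n
  tower_left := ⟨fun c a m => by
    obtain ⟨m, rfl⟩ := (M.toS n).surjective m
    rw [smul_toS, smul_toS, (twist A.grading n).map_smul, smul_assoc, (M.toS n).map_smul]⟩
  tower_right := ⟨fun c b m => by
    obtain ⟨m, rfl⟩ := (M.toS n).surjective m
    rw [rsmul_toS, rsmul_toS, smul_assoc, map_smul]⟩
  comm := ⟨fun a b m => by
    obtain ⟨m, rfl⟩ := (M.toS n).surjective m
    rw [rsmul_toS, smul_toS, smul_toS, rsmul_toS, smul_comm]⟩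
  grading := fun i => (M.grading (i + n)).map (M.toS n).toLinearMap
  isInternal := isInternal_of_proj _
    (fun i => (M.toS n).toLinearMap ∘ₗ gproj M.grading (i + n) ∘ₗ (M.toS n).symm.toLinearMap)
    (by rintro i _ ⟨m, hm, rfl⟩; simp [gproj_same _ hm])
    (by rintro i j h _ ⟨m, hm, rfl⟩; simp [gproj_other _ (show i + n ≠ j + n by omega) hm])
    (by
      rw [← Submodule.map_iSup, show ⨆ i, M.grading (i + n) = ⨆ i, M.grading i from
        (Equiv.addRight n).iSup_comp (g := M.grading), M.isInternal.submodule_iSup_eq_top]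
      simp)
  smul_mem := by
    rintro i j a _ ha ⟨m, hm, rfl⟩
    refine ⟨twist A.grading n a • m, ?_, rfl⟩
    rw [twist_of_mem _ _ ha, smul_assoc, add_assoc]
    exact Submodule.smul_mem _ _ (M.smul_mem ha hm)
  rsmul_mem := by
    rintro i j _ b ⟨m, hm, rfl⟩ hb
    refine ⟨op b • m, ?_, rfl⟩
    have := M.rsmul_mem hm hb
    rwa [show i + n + j = i + j + n by ring] at this
  d := ksign k n • ((M.toS n).toLinearMap ∘ₗ M.d ∘ₗ (M.toS n).symm.toLinearMap)
  d_mem := by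
    rintro i _ ⟨m, hm, rfl⟩
    have := M.d_mem hm
    rw [show i + n + 1 = i + 1 + n by ring] at this
    exact Submodule.smul_mem _ _ ⟨M.d m, this, by simp⟩
  d_d := fun m => by simp [M.d_d]
  d_smul := by
    intro i a ha m
    obtain ⟨m, rfl⟩ := (M.toS n).surjective m
    simp only [LinearMap.smul_apply, LinearMap.comp_apply, LinearEquiv.coe_coe, smul_toS,
      LinearEquiv.symm_apply_apply, ← map_smul]
    rw [← map_add]
    congr 1
    rw [twist_of_mem _ _ ha, twist_of_mem _ _ (A.d_mem ha)]
    rw [smul_assoc, smul_assoc, smul_assoc, M.d.map_smul, M.d.map_smul, M.d.map_smul,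
      M.d_smul ha, smul_comm a (ksign k n), mul_add, mul_one, ksign_add]
    generalize A.d a • m = x
    generalize a • M.d m = y
    module
  d_rsmul := by
    rintro i _ ⟨m, hm, rfl⟩ b
    simp only [LinearMap.smul_apply, LinearMap.comp_apply, LinearEquiv.coe_coe, rsmul_toS,
      LinearEquiv.symm_apply_apply, ← map_smul]
    rw [← map_add]
    congr 1
    rw [M.d.map_smul, M.d.map_smul, M.d_rsmul hm, smul_comm (op b) (ksign k n), smul_add,
      smul_smul (ksign k n), ksign_add, mul_left_comm, ksign_mul_self, mul_one]

end

/-- The identity map `M → M[n]`, of degree `-n`. -/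
def toShift (M : DGBimod A B) (n : ℤ) : M ≃ₗ[k] M.shiftObj n := M.toS n

section

variable (M : DGBimod A B) (n : ℤ)

lemma toShift_mem {i : ℤ} {m : M} :
    M.toShift n m ∈ (M.shiftObj n).grading i ↔ m ∈ M.grading (i + n) := by
  constructor
  · rintro ⟨m', hm', h⟩
    rwa [← (M.toS n).injective h]
  · exact fun h => ⟨m, h, rfl⟩

lemma smul_toShift (a : A) (m : M) :
    a • M.toShift n m = M.toShift n (twist A.grading n a • m) := rfl

lemma rsmul_toShift (b : Bᵐᵒᵖ) (m : M) : b • M.toShift n m = M.toShift n (b • m) := rfl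

lemma d_toShift (m : M) : (M.shiftObj n).d (M.toShift n m) = ksign k n • M.toShift n (M.d m) :=
  rfl

lemma toShift_surj : Function.Surjective (M.toShift n) := (M.toShift n).surjective

end

/-- The morphism `f[n]`. -/
def shiftMap {M N : DGBimod A B} (f : M ⟶ N) (n : ℤ) : M.shiftObj n ⟶ N.shiftObj n :=
  Hom.mk ((N.toShift n).toLinearMap ∘ₗ lin f ∘ₗ (M.toShift n).symm.toLinearMap)
    (fun a m => by
      obtain ⟨m, rfl⟩ := M.toShift_surj n m
      simp only [smul_toShift, LinearMap.comp_apply, LinearEquiv.coe_coe,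
        LinearEquiv.symm_apply_apply]
      rw [show ∀ a m, lin f (a • m) = a • lin f m from Hom.map_smul f])
    (fun b m => by
      obtain ⟨m, rfl⟩ := M.toShift_surj n m
      simp only [rsmul_toShift, LinearMap.comp_apply, LinearEquiv.coe_coe,
        LinearEquiv.symm_apply_apply]
      rw [show ∀ b m, lin f (op b • m) = op b • lin f m from Hom.map_rsmul f])
    (fun {i m} h => by
      obtain ⟨m, rfl⟩ := M.toShift_surj n m
      exact (N.toShift_mem n).2 (Hom.map_mem f ((M.toShift_mem n).1 h)))
    (fun m => by
      obtain ⟨m, rfl⟩ := M.toShift_surj n m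
      simp only [d_toShift, map_smul, LinearMap.comp_apply, LinearEquiv.coe_coe,
        LinearEquiv.symm_apply_apply]
      rw [show lin f (M.d m) = N.d (lin f m) from Hom.map_d f m])

@[simp] lemma lin_shiftMap {M N : DGBimod A B} (f : M ⟶ N) (n : ℤ) (m : M) :
    lin (shiftMap f n) (M.toShift n m) = N.toShift n (lin f m) := rfl

/-- The functor `M ↦ M[n]`. -/
def shiftFun (n : ℤ) : DGBimod A B ⥤ DGBimod A B where
  obj M := M.shiftObj n
  map f := shiftMap f n
  map_id _ := rfl
  map_comp _ _ := rfl

/-- An isomorphism from a bijective linear map which is compatible with all the structure. -/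
def mkIso {M N : DGBimod A B} (e : M ≃ₗ[k] N) (h₁ : ∀ (a : A) (m : M), e (a • m) = a • e m)
    (h₂ : ∀ (b : B) (m : M), e (op b • m) = op b • e m)
    (h₃ : ∀ (i : ℤ) (m : M), m ∈ M.grading i ↔ e m ∈ N.grading i)
    (h₄ : ∀ m : M, e (M.d m) = N.d (e m)) : M ≅ N where
  hom := Hom.mk e.toLinearMap h₁ h₂ (fun {i m} h => (h₃ i m).1 h) h₄
  inv := Hom.mk e.symm.toLinearMap (fun a m => e.injective (by simp [h₁]))
    (fun a m => e.injective (by simp [h₂])) (fun {i m} h => (h₃ i _).2 (by simpa using h))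
    (fun m => e.injective (by simp [h₄]))
  hom_inv_id := Hom.ext (by ext; exact e.symm_apply_apply _)
  inv_hom_id := Hom.ext (by ext; exact e.apply_symm_apply _)

/-- `M[0] = M`. -/
def shiftZeroIso (M : DGBimod A B) : M.shiftObj 0 ≅ M :=
  mkIso (M.toShift 0).symm
    (fun a m => by
      obtain ⟨m, rfl⟩ := M.toShift_surj 0 m
      simp [smul_toShift, twist_zero])
    (fun b m => by
      obtain ⟨m, rfl⟩ := M.toShift_surj 0 m
      simp [rsmul_toShift])
    (fun i m => by
      obtain ⟨m, rfl⟩ := M.toShift_surj 0 m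
      simp [toShift_mem])
    (fun m => by
      obtain ⟨m, rfl⟩ := M.toShift_surj 0 m
      simp [d_toShift, ksign_zero])

/-- `M[n + l] = M[n][l]`. -/
def shiftAddIso (M : DGBimod A B) (n l : ℤ) :
    M.shiftObj (n + l) ≅ (M.shiftObj n).shiftObj l :=
  mkIso ((M.toShift (n + l)).symm ≪≫ₗ M.toShift n ≪≫ₗ (M.shiftObj n).toShift l)
    (fun a m => by
      obtain ⟨m, rfl⟩ := M.toShift_surj _ m
      simp [smul_toShift, twist_twist])
    (fun b m => by
      obtain ⟨m, rfl⟩ := M.toShift_surj _ m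
      simp [rsmul_toShift])
    (fun i m => by
      obtain ⟨m, rfl⟩ := M.toShift_surj _ m
      simp [toShift_mem, add_assoc, add_comm n l])
    (fun m => by
      obtain ⟨m, rfl⟩ := M.toShift_surj _ m
      simp [d_toShift, ksign_add, smul_smul, mul_comm])

lemma lin_shiftZeroIso_inv (M : DGBimod A B) (m : M) :
    lin M.shiftZeroIso.inv m = M.toShift 0 m := rfl

lemma lin_shiftAddIso_hom (M : DGBimod A B) (n l : ℤ) (m : M) :
    lin (M.shiftAddIso n l).hom (M.toShift (n + l) m) =
      (M.shiftObj n).toShift l (M.toShift n m) := rfl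

lemma lin_eqToHom_shift (M : DGBimod A B) {n l : ℤ} (h : n = l)
    (h' : M.shiftObj n = M.shiftObj l) (m : M) :
    lin (eqToHom h') (M.toShift n m) = M.toShift l m := by
  subst h; rfl

lemma shift_assoc (M : DGBimod A B) (a b c : ℤ)
    (h : M.shiftObj (a + b + c) = M.shiftObj (a + (b + c))) :
    (M.shiftAddIso (a + b) c).hom ≫ shiftMap (M.shiftAddIso a b).hom c =
      eqToHom h ≫ (M.shiftAddIso a (b + c)).hom ≫ (shiftAddIso (M.shiftObj a) b c).hom := by
  refine hom_ext fun m => ?_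
  obtain ⟨m, rfl⟩ := M.toShift_surj _ m
  rw [lin_comp, lin_comp, lin_comp, lin_shiftAddIso_hom M (a + b) c m, lin_shiftMap,
    lin_eqToHom_shift M (add_assoc a b c) h m, lin_shiftAddIso_hom M a b m,
    lin_shiftAddIso_hom M a (b + c) m]
  exact (lin_shiftAddIso_hom (M.shiftObj a) b c (M.toShift a m)).symm

lemma shift_zero_add (M : DGBimod A B) (n : ℤ) (h : M.shiftObj (0 + n) = M.shiftObj n) :
    (M.shiftAddIso 0 n).hom = eqToHom h ≫ shiftMap M.shiftZeroIso.inv n := by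
  refine hom_ext fun m => ?_
  obtain ⟨m, rfl⟩ := M.toShift_surj _ m
  rw [lin_comp, lin_eqToHom_shift M (zero_add n) h m, lin_shiftMap, lin_shiftAddIso_hom M 0 n m,
    lin_shiftZeroIso_inv M m]

lemma shift_add_zero (M : DGBimod A B) (n : ℤ) (h : M.shiftObj (n + 0) = M.shiftObj n) :
    (M.shiftAddIso n 0).hom = eqToHom h ≫ (M.shiftObj n).shiftZeroIso.inv := by
  refine hom_ext fun m => ?_
  obtain ⟨m, rfl⟩ := M.toShift_surj _ m
  rw [lin_comp, lin_eqToHom_shift M (add_zero n) h m, lin_shiftAddIso_hom M n 0 m]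
  exact (lin_shiftZeroIso_inv (M.shiftObj n) (M.toShift n m)).symm

/-- `shiftFun 0` is the identity functor. -/
def shiftFunZero : shiftFun 0 ≅ 𝟭 (DGBimod A B) :=
  NatIso.ofComponents (fun M => shiftZeroIso M) fun _ => hom_ext fun _ => rfl

/-- `shiftFun` is additive. -/
def shiftFunAdd (n l : ℤ) : (shiftFun (n + l) : DGBimod A B ⥤ _) ≅ shiftFun n ⋙ shiftFun l :=
  NatIso.ofComponents (fun M => shiftAddIso M n l) fun _ => hom_ext fun _ => rfl

instance : HasShift (DGBimod A B) ℤ :=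
  hasShiftMk _ _
    { F := shiftFun
      zero := shiftFunZero
      add := shiftFunAdd
      assoc_hom_app := fun a b c M => shift_assoc M a b c _
      zero_add_hom_app := fun n M => shift_zero_add M n _
      add_zero_hom_app := fun n M => shift_add_zero M n _ }

lemma shiftFunctor_obj (M : DGBimod A B) (n : ℤ) : M⟦n⟧ = M.shiftObj n := rfl

lemma shiftFunctor_map {M N : DGBimod A B} (f : M ⟶ N) (n : ℤ) : f⟦n⟧' = shiftMap f n := rfl

/-! ### Tensor products -/

lemma lin_map_smul {M N : DGBimod A B} (f : M ⟶ N) (a : A) (m : M) :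
    lin f (a • m) = a • lin f m := Hom.map_smul f a m

lemma lin_map_rsmul {M N : DGBimod A B} (f : M ⟶ N) (b : Bᵐᵒᵖ) (m : M) :
    lin f (b • m) = b • lin f m := Hom.map_rsmul f (unop b) m

lemma lin_mem {M N : DGBimod A B} (f : M ⟶ N) {i : ℤ} {m : M} (h : m ∈ M.grading i) :
    lin f m ∈ N.grading i := Hom.map_mem f h

lemma lin_d {M N : DGBimod A B} (f : M ⟶ N) (m : M) : lin f (M.d m) = N.d (lin f m) :=
  Hom.map_d f m

section Tensor

/-- The left action of `A` on `M`, as a bilinear map. -/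
def lact (M : DGBimod A B) : A →ₗ[k] M →ₗ[k] M :=
  LinearMap.mk₂ k (fun a m => a • m) (fun a b m => add_smul a b m) (fun c a m => smul_assoc c a m)
    (fun a m n => smul_add a m n) (fun c a m => (smul_comm c a m).symm)

/-- The right action of `B` on `M`, as a bilinear map. -/
def ract (M : DGBimod A B) : B →ₗ[k] M →ₗ[k] M :=
  LinearMap.mk₂ k (fun b m => op b • m) (fun a b m => add_smul (op a) (op b) m)
    (fun c a m => smul_assoc c (op a) m)
    (fun a m n => smul_add (op a) m n) (fun c a m => (smul_comm c (op a) m).symm)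

@[simp] lemma lact_apply (M : DGBimod A B) (a : A) (m : M) : M.lact a m = a • m := rfl

@[simp] lemma ract_apply (M : DGBimod A B) (b : B) (m : M) : M.ract b m = op b • m := rfl

variable (M : DGBimod A B) (N : DGBimod B C)

/-- The relations `m b ⊗ n = m ⊗ b n`. -/
def tensorRel : Submodule k (M ⊗[k] N) :=
  Submodule.span k {x | ∃ (b : B) (m : M) (n : N), x = (op b • m) ⊗ₜ[k] n - m ⊗ₜ[k] (b • n)}

/-- The underlying space of `M ⊗_B N`. -/
def TensorCarrier : Type u := (M ⊗[k] N) ⧸ tensorRel M N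

instance : AddCommGroup (TensorCarrier M N) :=
  inferInstanceAs (AddCommGroup ((M ⊗[k] N) ⧸ tensorRel M N))

instance : Module k (TensorCarrier M N) :=
  inferInstanceAs (Module k ((M ⊗[k] N) ⧸ tensorRel M N))

/-- The universal balanced bilinear map `(m, n) ↦ m ⊗ n`. -/
def tmk : M →ₗ[k] N →ₗ[k] TensorCarrier M N :=
  (TensorProduct.mk k M N).compr₂ (tensorRel M N).mkQ

variable {M N}

lemma tmk_balanced (b : B) (m : M) (n : N) : tmk M N (op b • m) n = tmk M N m (b • n) :=
  (Submodule.Quotient.eq _).2 (Submodule.subset_span ⟨b, m, n, rfl⟩)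

section

variable {P : Type u} [AddCommGroup P] [Module k P]

/-- The linear map on `M ⊗_B N` induced by a balanced bilinear map. -/
def tlift (φ : M →ₗ[k] N →ₗ[k] P)
    (h : ∀ (b : B) (m : M) (n : N), φ (op b • m) n = φ m (b • n)) : TensorCarrier M N →ₗ[k] P :=
  (tensorRel M N).liftQ (TensorProduct.lift φ) (by
    rw [tensorRel, Submodule.span_le]
    rintro _ ⟨b, m, n, rfl⟩
    simp [h])

@[simp] lemma tlift_tmk (φ : M →ₗ[k] N →ₗ[k] P)
    (h : ∀ (b : B) (m : M) (n : N), φ (op b • m) n = φ m (b • n)) (m : M) (n : N) :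
    tlift φ h (tmk M N m n) = φ m n := rfl

lemma thom_ext {f g : TensorCarrier M N →ₗ[k] P} (h : ∀ m n, f (tmk M N m n) = g (tmk M N m n)) :
    f = g :=
  Submodule.linearMap_qext _ (TensorProduct.ext' h)

lemma thom_gext {f g : TensorCarrier M N →ₗ[k] P}
    (h : ∀ i, ∀ m ∈ M.grading i, ∀ j, ∀ n ∈ N.grading j, f (tmk M N m n) = g (tmk M N m n)) :
    f = g := by
  have : (tmk M N).compr₂ f = (tmk M N).compr₂ g :=
    gext M.grading fun i m hm => gext N.grading fun j n hn => h i m hm j n hn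
  exact thom_ext fun m n => LinearMap.congr_fun₂ this m n

end

variable (M N)

/-- The left action of `A` on `M ⊗_B N`. -/
def tleft (a : A) : TensorCarrier M N →ₗ[k] TensorCarrier M N :=
  tlift (tmk M N ∘ₗ M.lact a) (fun b m n => by
    simp only [LinearMap.comp_apply, lact_apply]
    rw [smul_comm, tmk_balanced])

/-- The right action of `C` on `M ⊗_B N`. -/
def tright (c : C) : TensorCarrier M N →ₗ[k] TensorCarrier M N :=
  tlift ((tmk M N).compl₂ (N.ract c)) (fun b m n => by
    simp only [LinearMap.compl₂_apply, ract_apply]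
    rw [tmk_balanced, smul_comm])

instance : SMul A (TensorCarrier M N) := ⟨fun a x => tleft M N a x⟩

instance : SMul Cᵐᵒᵖ (TensorCarrier M N) := ⟨fun c x => tright M N (unop c) x⟩

variable {M N}

lemma smul_tmk (a : A) (m : M) (n : N) : a • tmk M N m n = tmk M N (a • m) n := rfl

lemma rsmul_tmk (c : Cᵐᵒᵖ) (m : M) (n : N) : c • tmk M N m n = tmk M N m (c • n) := rfl

variable (M N)

instance : Module A (TensorCarrier M N) where
  one_smul x := by
    change tleft M N 1 x = (LinearMap.id : TensorCarrier M N →ₗ[k] TensorCarrier M N) x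
    congr 1
    exact thom_ext fun m n => by simp [tleft]
  mul_smul a b x := by
    change tleft M N (a * b) x = (tleft M N a ∘ₗ tleft M N b) x
    congr 1
    exact thom_ext fun m n => by simp [tleft, mul_smul]
  smul_zero a := map_zero (tleft M N a)
  smul_add a := map_add (tleft M N a)
  add_smul a b x := by
    change tleft M N (a + b) x = (tleft M N a + tleft M N b) x
    congr 1
    exact thom_ext fun m n => by simp [tleft]
  zero_smul x := by
    change tleft M N 0 x = (0 : TensorCarrier M N →ₗ[k] TensorCarrier M N) x
    congr 1
    exact thom_ext fun m n => by simp [tleft]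

instance : Module Cᵐᵒᵖ (TensorCarrier M N) where
  one_smul x := by
    change tright M N 1 x = (LinearMap.id : TensorCarrier M N →ₗ[k] TensorCarrier M N) x
    congr 1
    exact thom_ext fun m n => by simp [tright]
  mul_smul a b x := by
    change tright M N (unop b * unop a) x = (tright M N (unop a) ∘ₗ tright M N (unop b)) x
    congr 1
    exact thom_ext fun m n => by simp [tright, mul_smul]
  smul_zero a := map_zero (tright M N (unop a))
  smul_add a := map_add (tright M N (unop a))
  add_smul a b x := by
    change tright M N (unop a + unop b) x = (tright M N (unop a) + tright M N (unop b)) x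
    congr 1
    exact thom_ext fun m n => by simp [tright]
  zero_smul x := by
    change tright M N 0 x = (0 : TensorCarrier M N →ₗ[k] TensorCarrier M N) x
    congr 1
    exact thom_ext fun m n => by simp [tright]

lemma tleft_apply (a : A) (x : TensorCarrier M N) : tleft M N a x = a • x := rfl

lemma tright_apply (c : C) (x : TensorCarrier M N) : tright M N c x = op c • x := rfl

lemma tleft_tmk (a : A) (m : M) (n : N) : tleft M N a (tmk M N m n) = tmk M N (a • m) n := rfl

lemma tright_tmk (c : C) (m : M) (n : N) :
    tright M N c (tmk M N m n) = tmk M N m (op c • n) := rfl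

instance : IsScalarTower k A (TensorCarrier M N) := ⟨fun c a x => by
  change tleft M N (c • a) x = (c • tleft M N a) x
  congr 1
  exact thom_ext fun m n => by simp [tleft]⟩

instance : IsScalarTower k Cᵐᵒᵖ (TensorCarrier M N) := ⟨fun c a x => by
  change tright M N (c • unop a) x = (c • tright M N (unop a)) x
  congr 1
  exact thom_ext fun m n => by simp [tright]⟩

instance : SMulCommClass A Cᵐᵒᵖ (TensorCarrier M N) := ⟨fun a c x => by
  change (tleft M N a ∘ₗ tright M N (unop c)) x = (tright M N (unop c) ∘ₗ tleft M N a) x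
  congr 1
  exact thom_ext fun m n => by simp [tleft, tright]⟩

/-- The component of degree `l` of `M ⊗_B N`, spanned by the `m ⊗ n` with `|m| + |n| = l`. -/
def tgrading (l : ℤ) : Submodule k (TensorCarrier M N) :=
  Submodule.span k {x | ∃ i j, i + j = l ∧ ∃ m ∈ M.grading i, ∃ n ∈ N.grading j, x = tmk M N m n}

variable {M N}

lemma tmk_mem {i j l : ℤ} (h : i + j = l) {m : M} (hm : m ∈ M.grading i) {n : N}
    (hn : n ∈ N.grading j) : tmk M N m n ∈ tgrading M N l :=
  Submodule.subset_span ⟨i, j, h, m, hm, n, hn, rfl⟩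

/-- Two linear maps agreeing on the `m ⊗ n` of degree `l` agree in degree `l`. -/
lemma tgrading_ext {P : Type u} [AddCommGroup P] [Module k P] {f g : TensorCarrier M N →ₗ[k] P}
    {l : ℤ} (h : ∀ i j, i + j = l → ∀ m ∈ M.grading i, ∀ n ∈ N.grading j,
      f (tmk M N m n) = g (tmk M N m n)) {x : TensorCarrier M N} (hx : x ∈ tgrading M N l) :
    f x = g x := by
  have : tgrading M N l ≤ LinearMap.eqLocus f g := by
    rw [tgrading, Submodule.span_le]
    rintro _ ⟨i, j, hij, m, hm, n, hn, rfl⟩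
    exact h i j hij m hm n hn
  exact this hx

/-- A linear map sending the `m ⊗ n` of degree `l` to a submodule sends the component of degree
`l` to it. -/
lemma tgrading_map {P : Type u} [AddCommGroup P] [Module k P] {f : TensorCarrier M N →ₗ[k] P}
    {l : ℤ} {S : Submodule k P} (h : ∀ i j, i + j = l → ∀ m ∈ M.grading i, ∀ n ∈ N.grading j,
      f (tmk M N m n) ∈ S) {x : TensorCarrier M N} (hx : x ∈ tgrading M N l) : f x ∈ S := by
  have : tgrading M N l ≤ S.comap f := by
    rw [tgrading, Submodule.span_le]
    rintro _ ⟨i, j, hij, m, hm, n, hn, rfl⟩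
    exact h i j hij m hm n hn
  exact this hx

/-- Balancedness may be tested on homogeneous elements. -/
lemma balanced_of_homogeneous {P : Type u} [AddCommGroup P] [Module k P]
    (φ : M →ₗ[k] N →ₗ[k] P)
    (h : ∀ i, ∀ m ∈ M.grading i, ∀ j, ∀ b ∈ B.grading j, ∀ l, ∀ n ∈ N.grading l,
      φ (op b • m) n = φ m (b • n)) (b : B) (m : M) (n : N) : φ (op b • m) n = φ m (b • n) := by
  induction m using DirectSum.Decomposition.inductionOn M.grading with
  | zero => simp
  | add x y hx hy => simp [smul_add, hx, hy]
  | @homogeneous i m =>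
    induction n using DirectSum.Decomposition.inductionOn N.grading with
    | zero => simp
    | add x y hx hy => simp [smul_add, hx, hy]
    | @homogeneous l n =>
      induction b using DirectSum.Decomposition.inductionOn B.grading with
      | zero => simp
      | add x y hx hy => simp [add_smul, hx, hy]
      | @homogeneous j b => exact h i m m.2 j b b.2 l n n.2

variable (M N)

/-- The projection of `M ⊗_B N` onto its component of degree `l`. -/
def tproj (l : ℤ) : TensorCarrier M N →ₗ[k] TensorCarrier M N :=
  tlift (gmap M.grading fun i => (tmk M N).compl₂ (gproj N.grading (l - i)))
    (balanced_of_homogeneous _ fun i m hm j b hb p n hn => by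
      rw [gmap_of_mem _ _ (M.rsmul_mem hm hb), gmap_of_mem _ _ hm, LinearMap.compl₂_apply,
        LinearMap.compl₂_apply]
      by_cases h : i + j + p = l
      · obtain rfl : p = l - (i + j) := by omega
        have := N.smul_mem hb hn
        rw [show j + (l - (i + j)) = l - i by ring] at this
        rw [gproj_same _ hn, gproj_same _ this, tmk_balanced]
      · rw [gproj_other _ (show p ≠ l - (i + j) by omega) hn,
          gproj_other _ (show j + p ≠ l - i by omega) (N.smul_mem hb hn)]
        simp)

/-- The differential `d (m ⊗ n) = d m ⊗ n + (-1)^{|m|} m ⊗ d n`. -/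
def tdiff : TensorCarrier M N →ₗ[k] TensorCarrier M N :=
  tlift (tmk M N ∘ₗ M.d + (tmk M N ∘ₗ twist M.grading 1).compl₂ N.d)
    (balanced_of_homogeneous _ fun i m hm j b hb p n hn => by
      simp only [LinearMap.add_apply, LinearMap.compl₂_apply, LinearMap.comp_apply]
      rw [twist_of_mem _ _ (M.rsmul_mem hm hb), twist_of_mem _ _ hm, M.d_rsmul hm, N.d_smul hb]
      simp only [map_add, LinearMap.add_apply, map_smul, LinearMap.smul_apply, tmk_balanced,
        smul_smul, one_mul, ksign_add]
      rw [mul_comm (ksign k i)]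
      abel)

variable {M N}

lemma tdiff_tmk {i : ℤ} {m : M} (hm : m ∈ M.grading i) (n : N) :
    tdiff M N (tmk M N m n) = tmk M N (M.d m) n + ksign k i • tmk M N m (N.d n) := by
  rw [tdiff, tlift_tmk]
  simp [twist_of_mem _ _ hm]

variable (M N)

/-- The dg `A`-`C`-bimodule `M ⊗_B N`. -/
def tensorObj : DGBimod A C where
  carrier := TensorCarrier M N
  grading := tgrading M N
  isInternal := isInternal_of_proj _ (tproj M N)
    (fun l x hx => tgrading_ext (f := tproj M N l) (g := LinearMap.id) (by
      intro i j h m hm n hn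
      obtain rfl : j = l - i := by omega
      rw [tproj, tlift_tmk, gmap_of_mem _ _ hm, LinearMap.compl₂_apply, gproj_same _ hn]
      rfl) hx)
    (fun l l' h x hx => tgrading_ext (f := tproj M N l') (g := 0) (by
      intro i j h m hm n hn
      rw [tproj, tlift_tmk, gmap_of_mem _ _ hm, LinearMap.compl₂_apply,
        gproj_other _ (show j ≠ l' - i by omega) hn]
      simp) hx)
    (by
      rw [← LinearMap.ker_eq_top.2 (thom_gext
        (f := (⨆ l, tgrading M N l).mkQ) (g := 0) ?_), Submodule.ker_mkQ]
      intro i m hm j n hn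
      rw [LinearMap.zero_apply, Submodule.mkQ_apply, Submodule.Quotient.mk_eq_zero]
      exact Submodule.mem_iSup_of_mem (i + j) (tmk_mem rfl hm hn))
  smul_mem := fun {i j a x} ha hx => tgrading_map (f := tleft M N a)
    (fun p q h m hm n hn => tmk_mem (by omega) (A := A) (M.smul_mem ha hm) hn) hx
  rsmul_mem := fun {i j x c} hx hc => tgrading_map (f := tright M N c)
    (fun p q h m hm n hn => tmk_mem (by omega) hm (N.rsmul_mem hn hc)) hx
  d := tdiff M N
  d_mem := fun {l x} hx => tgrading_map (fun i j h m hm n hn => by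
    rw [tdiff_tmk hm]
    exact Submodule.add_mem _ (tmk_mem (by omega) (M.d_mem hm) hn)
      (Submodule.smul_mem _ _ (tmk_mem (by omega) hm (N.d_mem hn)))) hx
  d_d := fun x => by
    change (tdiff M N ∘ₗ tdiff M N) x = (0 : TensorCarrier M N →ₗ[k] TensorCarrier M N) x
    congr 1
    refine thom_gext fun i m hm j n hn => ?_
    rw [LinearMap.comp_apply, tdiff_tmk hm, map_add, map_smul, tdiff_tmk (M.d_mem hm),
      tdiff_tmk hm, M.d_d, N.d_d, ksign_add, ksign_one]
    simp
  d_smul := fun {i a} ha x => by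
    change (tdiff M N ∘ₗ tleft M N a) x =
      (tleft M N (A.d a) + ksign k i • (tleft M N a ∘ₗ tdiff M N)) x
    congr 1
    refine thom_gext fun p m hm j n hn => ?_
    simp only [LinearMap.comp_apply, LinearMap.add_apply, LinearMap.smul_apply, tleft_tmk]
    rw [tdiff_tmk hm, tdiff_tmk (M.smul_mem ha hm), M.d_smul ha]
    simp only [map_add, map_smul, LinearMap.add_apply, LinearMap.smul_apply, smul_add,
      smul_smul, ksign_add, tleft_tmk]
    abel
  d_rsmul := fun {l x} hx c => by
    change (tdiff M N ∘ₗ tright M N c) x =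
      (tright M N c ∘ₗ tdiff M N + ksign k l • tright M N (C.d c)) x
    refine tgrading_ext (fun i j h m hm n hn => ?_) hx
    simp only [LinearMap.comp_apply, LinearMap.add_apply, LinearMap.smul_apply, tright_tmk]
    rw [tdiff_tmk hm, tdiff_tmk hm, N.d_rsmul hn, ← h]
    simp only [map_add, map_smul, smul_add, smul_smul, ksign_add, tright_tmk]
    abel

variable {M}

/-- The morphism `f ⊗ N`. -/
def tensorMap {M' : DGBimod A B} (f : M ⟶ M') : tensorObj M N ⟶ tensorObj M' N :=
  let g : TensorCarrier M N →ₗ[k] TensorCarrier M' N :=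
    tlift (tmk M' N ∘ₗ lin f) (fun b m n => by
      rw [LinearMap.comp_apply, LinearMap.comp_apply, lin_map_rsmul, tmk_balanced])
  Hom.mk g
    (fun a x => by
      change (g ∘ₗ tleft M N a) x = (tleft M' N a ∘ₗ g) x
      congr 1
      exact thom_ext fun m n => by simp [g, tleft, lin_map_smul])
    (fun c x => by
      change (g ∘ₗ tright M N c) x = (tright M' N c ∘ₗ g) x
      congr 1
      exact thom_ext fun m n => by simp [g, tright])
    (fun {l x} hx => tgrading_map (f := g)
      (fun i j h m hm n hn => tmk_mem h (lin_mem f hm) hn) hx)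
    (fun x => by
      change (g ∘ₗ tdiff M N) x = (tdiff M' N ∘ₗ g) x
      congr 1
      refine thom_gext fun i m hm j n hn => ?_
      rw [LinearMap.comp_apply, LinearMap.comp_apply, tdiff_tmk hm]
      simp only [g, map_add, map_smul, tlift_tmk, LinearMap.comp_apply]
      rw [tdiff_tmk (lin_mem f hm), lin_d])

variable {N}

@[simp] lemma lin_tensorMap {M' : DGBimod A B} (f : M ⟶ M') (m : M) (n : N) :
    lin (tensorMap N f) (tmk M N m n) = tmk M' N (lin f m) n := rfl

variable (N)

/-- The functor `- ⊗_B N` from dg `A`-`B`-bimodules to dg `A`-`C`-bimodules. -/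
def tensorFun : DGBimod A B ⥤ DGBimod A C where
  obj M := tensorObj M N
  map f := tensorMap N f
  map_id _ := Hom.ext (thom_ext fun _ _ => rfl)
  map_comp _ _ := Hom.ext (thom_ext fun _ _ => rfl)

end Tensor

/-! ### The standard modules -/

section Regular

/-- The diagonal bimodule `A`. -/
def diag (A : DGAlg k) : DGBimod A A where
  carrier := A
  grading := A.grading
  isInternal := DirectSum.Decomposition.isInternal A.grading
  smul_mem := fun ha hm => SetLike.GradedMul.mul_mem ha hm
  rsmul_mem := fun hm hb => SetLike.GradedMul.mul_mem hm hb
  d := A.d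
  d_mem := A.d_mem
  d_d := A.d_d
  d_smul := fun ha m => A.leibniz ha m
  d_rsmul := fun hm b => A.leibniz hm b

lemma ground_mem {i : ℤ} {c : DGAlg.ground k} (hc : c ∈ (DGAlg.ground k).grading i) :
    i = 0 ∨ c = 0 := by
  by_cases h : i = 0
  · exact Or.inl h
  · have : (show k from c) ∈ (if i = 0 then ⊤ else ⊥ : Submodule k k) := hc
    rw [if_neg h, Submodule.mem_bot] at this
    exact Or.inr this

/-- The right dg `B`-module underlying a dg bimodule. -/
def forgetLeft (M : DGBimod A B) : DGBimod (DGAlg.ground k) B :=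
  letI i₁ : Module (DGAlg.ground k) M := inferInstanceAs (Module k M)
  { carrier := M
    left := i₁
    tower_left := inferInstanceAs (IsScalarTower k k M)
    comm := inferInstanceAs (SMulCommClass k Bᵐᵒᵖ M)
    grading := M.grading
    isInternal := M.isInternal
    smul_mem := fun {i j c m} hc hm => by
      rcases ground_mem hc with rfl | h
      · rw [zero_add]
        exact Submodule.smul_mem (M.grading j) (show k from c) hm
      · rw [h, zero_smul]
        exact Submodule.zero_mem _
    rsmul_mem := M.rsmul_mem
    d := M.d
    d_mem := M.d_mem
    d_d := M.d_d
    d_smul := fun {i c} hc m => by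
      rw [show (DGAlg.ground k).d c = 0 from rfl, zero_smul, zero_add]
      rcases ground_mem hc with rfl | h
      · rw [ksign_zero, one_smul]
        exact M.d.map_smul (show k from c) m
      · rw [h, zero_smul, zero_smul, smul_zero, map_zero]
    d_rsmul := M.d_rsmul }

/-- The left dg `A`-module underlying a dg bimodule. -/
def forgetRight (M : DGBimod A B) : DGBimod A (DGAlg.ground k) :=
  letI i₁ : Module (DGAlg.ground k)ᵐᵒᵖ M :=
    Module.compHom M ((RingEquiv.toOpposite k).symm : kᵐᵒᵖ →+* k)
  have h₁ : ∀ (c : DGAlg.ground k) (m : M), op c • m = (show k from c) • m := fun _ _ => rfl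
  { carrier := M
    right := i₁
    tower_right := ⟨fun x c m => by
      have := h₁ (x • unop c) m
      rw [show op (x • unop c) = x • c from rfl] at this
      rw [this, show (show k from x • unop c) = x * (show k from unop c) from rfl, mul_smul]
      rfl⟩
    comm := ⟨fun a c m => (smul_comm (show k from unop c) a m).symm⟩
    grading := M.grading
    isInternal := M.isInternal
    smul_mem := M.smul_mem
    rsmul_mem := fun {i j m c} hm hc => by
      rcases ground_mem hc with rfl | h
      · rw [add_zero]
        exact Submodule.smul_mem (M.grading i) (show k from c) hm
      · rw [h, MulOpposite.op_zero, zero_smul]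
        exact Submodule.zero_mem _
    d := M.d
    d_mem := M.d_mem
    d_d := M.d_d
    d_smul := M.d_smul
    d_rsmul := fun {i m} hm c => by
      rw [show (DGAlg.ground k).d c = 0 from rfl, MulOpposite.op_zero, zero_smul, smul_zero, add_zero]
      exact M.d.map_smul (show k from c) m }

end Regular

/-! ### Cohomology and quasi-isomorphisms -/

section Cohomology

/-- The (total) cohomology `ker d / im d`. -/
abbrev Cohomology (M : DGBimod A B) : Type u :=
  LinearMap.ker M.d ⧸ (LinearMap.range M.d).submoduleOf (LinearMap.ker M.d)

variable {M N : DGBimod A B}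

/-- The map induced on cocycles. -/
def cocyclesMap (f : M ⟶ N) : LinearMap.ker M.d →ₗ[k] LinearMap.ker N.d :=
  (lin f).restrict fun m hm => by
    rw [LinearMap.mem_ker] at hm ⊢
    rw [← lin_d, hm, map_zero]

/-- The map induced on cohomology. -/
def cohomologyMap (f : M ⟶ N) : Cohomology M →ₗ[k] Cohomology N :=
  Submodule.mapQ _ _ (cocyclesMap f) (by
    rintro ⟨m, hm⟩ ⟨m', hm'⟩
    exact ⟨lin f m', by rw [← lin_d, hm']; rfl⟩)

lemma cohomologyMap_injective_iff (f : M ⟶ N) : Function.Injective (cohomologyMap f) ↔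
    ∀ m n, M.d m = 0 → N.d n = lin f m → ∃ m', M.d m' = m := by
  rw [injective_iff_map_eq_zero]
  constructor
  · intro h m n hm hn
    have := h (Submodule.Quotient.mk ⟨m, hm⟩) ((Submodule.Quotient.mk_eq_zero _).2 ⟨n, hn⟩)
    exact (Submodule.Quotient.mk_eq_zero _).1 this
  · intro h x hx
    obtain ⟨⟨m, hm⟩, rfl⟩ := Submodule.Quotient.mk_surjective _ x
    obtain ⟨n, hn⟩ := (Submodule.Quotient.mk_eq_zero _).1 hx
    exact (Submodule.Quotient.mk_eq_zero _).2 (h m n hm hn)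

lemma cohomologyMap_surjective_iff (f : M ⟶ N) : Function.Surjective (cohomologyMap f) ↔
    ∀ n, N.d n = 0 → ∃ m n', M.d m = 0 ∧ lin f m = n + N.d n' := by
  constructor
  · intro h n hn
    obtain ⟨x, hx⟩ := h (Submodule.Quotient.mk ⟨n, hn⟩)
    obtain ⟨⟨m, hm⟩, rfl⟩ := Submodule.Quotient.mk_surjective _ x
    obtain ⟨n', hn'⟩ := (Submodule.Quotient.eq _).1 hx
    exact ⟨m, n', hm, eq_add_of_sub_eq' hn'.symm⟩
  · intro h x
    obtain ⟨⟨n, hn⟩, rfl⟩ := Submodule.Quotient.mk_surjective _ x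
    obtain ⟨m, n', hm, hn'⟩ := h n hn
    exact ⟨Submodule.Quotient.mk ⟨m, hm⟩, (Submodule.Quotient.eq _).2
      ⟨n', (sub_eq_of_eq_add' hn').symm⟩⟩

/-- The class of quasi-isomorphisms. -/
def quasiIso (A B : DGAlg k) : MorphismProperty (DGBimod A B) :=
  fun _ _ f => Function.Bijective (cohomologyMap f)

lemma quasiIso_iff (f : M ⟶ N) : quasiIso A B f ↔
    (∀ m n, M.d m = 0 → N.d n = lin f m → ∃ m', M.d m' = m) ∧
      ∀ n, N.d n = 0 → ∃ m n', M.d m = 0 ∧ lin f m = n + N.d n' := by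
  rw [← cohomologyMap_injective_iff, ← cohomologyMap_surjective_iff]
  rfl

lemma quasiIso_shiftMap_iff (f : M ⟶ N) (l : ℤ) :
    quasiIso A B (shiftMap f l) ↔ quasiIso A B f := by
  have h : ksign k l ≠ 0 := ksign_ne_zero l
  rw [quasiIso_iff, quasiIso_iff]
  refine and_congr ⟨fun H m n hm hn => ?_, fun H m n hm hn => ?_⟩
    ⟨fun H n hn => ?_, fun H n hn => ?_⟩
  · obtain ⟨m', hm'⟩ := H (M.toShift l m) (N.toShift l ((ksign k l)⁻¹ • n))
      (by rw [d_toShift, hm]; simp) (by rw [d_toShift, lin_shiftMap, N.d.map_smul, hn,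
        (N.toShift l).map_smul, smul_smul, mul_inv_cancel₀ h, one_smul])
    obtain ⟨m', rfl⟩ := M.toShift_surj l m'
    refine ⟨ksign k l • m', (M.toShift l).injective ?_⟩
    rw [M.d.map_smul, (M.toShift l).map_smul, ← d_toShift, hm']
  · obtain ⟨m, rfl⟩ := M.toShift_surj l m
    obtain ⟨n, rfl⟩ := N.toShift_surj l n
    rw [d_toShift] at hm hn
    rw [lin_shiftMap, ← (N.toShift l).map_smul, ← N.d.map_smul] at hn
    obtain ⟨m', hm'⟩ := H m _ (by simpa [h] using hm) ((N.toShift l).injective hn)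
    refine ⟨M.toShift l ((ksign k l)⁻¹ • m'), ?_⟩
    rw [d_toShift, M.d.map_smul, hm', (M.toShift l).map_smul, smul_smul, mul_inv_cancel₀ h,
      one_smul]
  · obtain ⟨m, n', hm, hn'⟩ := H (N.toShift l n) (by rw [d_toShift, hn]; simp)
    obtain ⟨m, rfl⟩ := M.toShift_surj l m
    obtain ⟨n', rfl⟩ := N.toShift_surj l n'
    rw [d_toShift] at hm hn'
    rw [lin_shiftMap, ← (N.toShift l).map_smul, ← (N.toShift l).map_add, ← N.d.map_smul] at hn'
    exact ⟨m, _, by simpa [h] using hm, (N.toShift l).injective hn'⟩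
  · obtain ⟨n, rfl⟩ := N.toShift_surj l n
    rw [d_toShift] at hn
    obtain ⟨m, n', hm, hn'⟩ := H n (by simpa [h] using hn)
    refine ⟨M.toShift l m, N.toShift l ((ksign k l)⁻¹ • n'), by rw [d_toShift, hm]; simp, ?_⟩
    rw [d_toShift, lin_shiftMap, hn', N.d.map_smul, (N.toShift l).map_smul, smul_smul,
      mul_inv_cancel₀ h, one_smul, (N.toShift l).map_add]

instance : (quasiIso A B).IsCompatibleWithShift ℤ where
  condition l := by
    ext M N f
    exact quasiIso_shiftMap_iff f l

end Cohomology

/-! ### Cones -/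

section Cone

variable {M N : DGBimod A B} (f : M ⟶ N)

/-- The differential `d (n, m) = (d n + f m, - d m)` of the cone. -/
def coneD : (N × M.shiftObj 1) →ₗ[k] N × M.shiftObj 1 :=
  (N.d.coprod (lin f ∘ₗ (M.toShift 1).symm.toLinearMap)).prod
    ((M.shiftObj 1).d ∘ₗ LinearMap.snd k N (M.shiftObj 1))

lemma coneD_apply (n : N) (m : M) : coneD f (n, M.toShift 1 m) =
    (N.d n + lin f m, (M.shiftObj 1).d (M.toShift 1 m)) := rfl

/-- The cone `N ⊕ M[1]` of `f : M → N`, with differential `d (n, m) = (d n + f m, - d m)`. -/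
def cone : DGBimod A B where
  carrier := N × M.shiftObj 1
  grading := fun i => (N.grading i).prod ((M.shiftObj 1).grading i)
  isInternal := isInternal_of_proj _
    (fun i => (gproj N.grading i).prodMap (gproj (M.shiftObj 1).grading i))
    (by rintro i ⟨n, m⟩ ⟨hn, hm⟩; simp [gproj_same _ hn, gproj_same _ hm])
    (by rintro i j h ⟨n, m⟩ ⟨hn, hm⟩; simp [gproj_other _ h hn, gproj_other _ h hm])
    (by
      rw [eq_top_iff]
      rintro ⟨n, m⟩ -
      have h₁ : (⨆ i, N.grading i) ≤
          (⨆ i, (N.grading i).prod ((M.shiftObj 1).grading i)).comap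
            (LinearMap.inl k N (M.shiftObj 1)) :=
        iSup_le fun i n hn => Submodule.mem_iSup_of_mem i ⟨hn, Submodule.zero_mem _⟩
      have h₂ : (⨆ i, (M.shiftObj 1).grading i) ≤
          (⨆ i, (N.grading i).prod ((M.shiftObj 1).grading i)).comap
            (LinearMap.inr k N (M.shiftObj 1)) :=
        iSup_le fun i n hn => Submodule.mem_iSup_of_mem i ⟨Submodule.zero_mem _, hn⟩
      rw [N.isInternal.submodule_iSup_eq_top] at h₁
      rw [(M.shiftObj 1).isInternal.submodule_iSup_eq_top] at h₂
      rw [show (n, m) = LinearMap.inl k N (M.shiftObj 1) n + LinearMap.inr k N (M.shiftObj 1) m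
        from Prod.ext (add_zero n).symm (zero_add m).symm]
      exact Submodule.add_mem _ (h₁ (show n ∈ (⊤ : Submodule k N) from trivial))
        (h₂ (show m ∈ (⊤ : Submodule k (M.shiftObj 1)) from trivial)))
  smul_mem := fun ha hm => ⟨N.smul_mem ha hm.1, (M.shiftObj 1).smul_mem ha hm.2⟩
  rsmul_mem := fun hm hb => ⟨N.rsmul_mem hm.1 hb, (M.shiftObj 1).rsmul_mem hm.2 hb⟩
  d := coneD f
  d_mem := by
    rintro i ⟨n, m⟩ ⟨hn, hm⟩
    obtain ⟨m, rfl⟩ := M.toShift_surj 1 m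
    exact ⟨Submodule.add_mem _ (N.d_mem hn) (lin_mem f ((M.toShift_mem 1).1 hm)),
      (M.shiftObj 1).d_mem hm⟩
  d_d := by
    rintro ⟨n, m⟩
    obtain ⟨m, rfl⟩ := M.toShift_surj 1 m
    rw [coneD_apply, d_toShift, ← (M.toShift 1).map_smul, coneD_apply, d_toShift, map_add,
      (lin f).map_smul, M.d.map_smul, N.d_d, M.d_d, lin_d, ksign_one]
    simp
  d_smul := by
    rintro i a ha ⟨n, m⟩
    obtain ⟨m, rfl⟩ := M.toShift_surj 1 m
    refine Prod.ext ?_ ((M.shiftObj 1).d_smul ha _)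
    change N.d (a • n) + lin f (twist A.grading 1 a • m) =
      A.d a • n + ksign k i • (a • (N.d n + lin f m))
    rw [N.d_smul ha, twist_of_mem _ _ ha, one_mul, smul_assoc, (lin f).map_smul, lin_map_smul,
      smul_add, smul_add, add_assoc]
  d_rsmul := by
    rintro i ⟨n, m⟩ ⟨hn, hm⟩ b
    obtain ⟨m, rfl⟩ := M.toShift_surj 1 m
    refine Prod.ext ?_ ((M.shiftObj 1).d_rsmul hm _)
    change N.d (op b • n) + lin f (op b • m) =
      op b • (N.d n + lin f m) + ksign k i • (op (B.d b) • n)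
    rw [N.d_rsmul hn, lin_map_rsmul, smul_add]
    abel

/-- The inclusion `N → cone f`. -/
def coneIn : N ⟶ cone f :=
  Hom.mk (LinearMap.inl k N (M.shiftObj 1)) (fun a m => Prod.ext rfl (smul_zero a).symm)
    (fun a m => Prod.ext rfl (smul_zero (op a)).symm) (fun h => ⟨h, Submodule.zero_mem _⟩)
    (fun m => by
      change (N.d m, (0 : M.shiftObj 1)) = coneD f (m, M.toShift 1 0)
      rw [coneD_apply, map_zero, map_zero, map_zero, add_zero])

/-- The projection `cone f → M[1]`. -/
def coneOut : cone f ⟶ M⟦(1 : ℤ)⟧ :=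
  Hom.mk (LinearMap.snd k N (M.shiftObj 1)) (fun _ _ => rfl) (fun _ _ => rfl) (fun h => h.2)
    (fun _ => rfl)

/-- The standard triangle `M → N → cone f → M[1]`. -/
def coneTriangle : Pretriangulated.Triangle (DGBimod A B) :=
  Pretriangulated.Triangle.mk f (coneIn f) (coneOut f)

end Cone

end DGBimod

/-! ### Derived categories -/

/-- The derived category of dg `A`-`B`-bimodules, i.e. `D(A^op ⊗ B)`: the localization of the
category of dg bimodules at the quasi-isomorphisms, with the induced shift. -/
abbrev DCat {k : Type u} [Field k] (A B : DGAlg k) := (DGBimod.quasiIso A B).Localization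

namespace DCat

open DGBimod

variable {k : Type u} [Field k] {A B : DGAlg k}

/-- The localization functor. -/
abbrev Q (A B : DGAlg k) : DGBimod A B ⥤ DCat A B := (quasiIso A B).Q

/-- The distinguished triangles of the derived category: those isomorphic to the image of a
standard triangle `M → N → cone f → M[1]`. -/
def IsDistinguished (T : Pretriangulated.Triangle (DCat A B)) : Prop :=
  ∃ (M N : DGBimod A B) (f : M ⟶ N), Nonempty (T ≅ (Q A B).mapTriangle.obj (coneTriangle f))

/-- `P ⋆ P'`: the objects `Y` with a distinguished triangle `X → Y → Z → X[1]`, where `X` is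
in `P` and `Z` is in `P'`. -/
def star (P P' : ObjectProperty (DCat A B)) : ObjectProperty (DCat A B) := fun Y =>
  ∃ T : Pretriangulated.Triangle (DCat A B),
    IsDistinguished T ∧ P T.obj₁ ∧ T.obj₂ = Y ∧ P' T.obj₃

/-- `[E]_0`: the finite direct sums of shifts of `E`. -/
def sums (E : DCat A B) : ObjectProperty (DCat A B) := fun X =>
  ∃ (r : ℕ) (n : Fin r → ℤ) (c : Cofan fun i => E⟦n i⟧), c.pt = X ∧ Nonempty (IsColimit c)

/-- `[E]_n`: the `n`-fold star product `[E]_0 ⋆ ... ⋆ [E]_0` (`n + 1` factors). -/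
def steps (E : DCat A B) : ℕ → ObjectProperty (DCat A B)
  | 0 => sums E
  | n + 1 => star (steps E n) (sums E)

/-- `⟨E⟩_n`: the direct summands of objects of `[E]_n`. -/
def gen (E : DCat A B) (n : ℕ) : ObjectProperty (DCat A B) := fun X =>
  ∃ Y, steps E n Y ∧ Nonempty (Retract X Y)

/-- Full thick triangulated subcategories: closed under isomorphisms, shifts, cones and direct
summands. -/
structure IsThick (P : ObjectProperty (DCat A B)) : Prop where
  iso : ∀ {X Y : DCat A B}, (X ≅ Y) → P X → P Y
  shift : ∀ (X : DCat A B) (n : ℤ), P X → P (X⟦n⟧)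
  cone : ∀ T : Pretriangulated.Triangle (DCat A B), IsDistinguished T →
    P T.obj₁ → P T.obj₂ → P T.obj₃
  summand : ∀ {X Y : DCat A B}, Retract X Y → P Y → P X

/-- The smallest full thick triangulated subcategory containing `E`. -/
def thick (E : DCat A B) : ObjectProperty (DCat A B) := fun X =>
  ∀ P : ObjectProperty (DCat A B), IsThick P → P E → P X

end DCat

namespace DGAlg

open DGBimod DCat

variable {k : Type u} [Field k] (A B : DGAlg k)

/-- The category of right dg `A`-modules, as dg `k`-`A`-bimodules. -/
abbrev RMod := DGBimod (ground k) A

/-- The category of left dg `A`-modules, i.e. of right dg `A^op`-modules. -/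
abbrev LMod := DGBimod A (ground k)

/-- The derived category `D(A)` of right dg `A`-modules. -/
abbrev D := DCat (ground k) A

/-- The derived category `D(A^op)` of left dg `A`-modules. -/
abbrev Dop := DCat A (ground k)

/-- `Perf(A)`, the thick subcategory of `D(A)` generated by `A`. -/
def Perf : ObjectProperty A.D := thick ((Q _ _).obj (diag A).forgetLeft)

/-- `Perf(A^op)`, the thick subcategory of `D(A^op)` generated by `A`. -/
def PerfOp : ObjectProperty A.Dop := thick ((Q _ _).obj (diag A).forgetRight)

variable {A B} in
/-- `Φ` is (with `α`) the derived functor `M ↦ M ⊗ᴸ_A K` from `D(A)` to `D(B)`: the total left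
derived functor of `M ↦ M ⊗_A K`. -/
def IsDerivedTensor (K : DGBimod A B) (Φ : A.D ⥤ B.D)
    (α : Q (ground k) A ⋙ Φ ⟶ (tensorFun K : A.RMod ⥤ B.RMod) ⋙ Q (ground k) B) : Prop :=
  Φ.IsLeftDerivedFunctor α (quasiIso (ground k) A)

/-- Morita equivalence: there is `K` in `D(A^op ⊗ B)` such that `- ⊗ᴸ_A K : D(A) → D(B)` is
an equivalence. -/
def MoritaEquivalent : Prop :=
  ∃ (K : DGBimod A B) (Φ : A.D ⥤ B.D)
    (α : Q (ground k) A ⋙ Φ ⟶ (tensorFun K : A.RMod ⥤ B.RMod) ⋙ Q (ground k) B),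
    IsDerivedTensor K Φ α ∧ Φ.IsEquivalence

variable {A} in
/-- The exterior product `F ⊠ G = F ⊗_k G`, a dg `A`-`A`-bimodule (exact in both variables as
`k` is a field). -/
def boxtimes (F : A.LMod) (G : A.RMod) : DGBimod A A := tensorObj F G

/-- The diagonal dimension of `Perf(A)`: the least `n` such that the diagonal bimodule `A` is in
`⟨F ⊠ G⟩_n` for some `F` in `Perf(A^op)` and `G` in `Perf(A)`, and `∞` if there is none. -/
def Ddim : ℕ∞ :=
  ⨅ n : {n : ℕ // ∃ (F : A.LMod) (G : A.RMod), A.PerfOp ((Q _ _).obj F) ∧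
    A.Perf ((Q _ _).obj G) ∧ gen ((Q A A).obj (boxtimes F G)) n ((Q A A).obj (diag A))}, (n : ℕ∞)

end DGAlg

end

/-!
# Morita invariance of the diagonal dimension

Let `K₀` induce the Morita equivalence and let `K` be a semifree resolution of `K₀`. The proof
replaces the equivalence `- ⊗ᴸ K₀ : D(A) → D(B)` by a pair of dg bimodules `K`, `L`, flat on both
sides, such that `K ⊗_B L` and `L ⊗_A K` are quasi-isomorphic to the diagonal bimodules
(`InvPair`). Then `M ↦ L ⊗_A M ⊗_A K` is an exact functor from `D(A^op ⊗ A)` to `D(B^op ⊗ B)`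
which sends `A` to `B` and `F ⊠ G` to `(L ⊗_A F) ⊠ (G ⊗_A K)`, so that it only remains to know
that `L ⊗_A F` and `G ⊗_A K` are perfect (`InvPair.ddim_le`). The situation is symmetric in `A`
and `B`, which gives both inequalities.

*Exact functors* (`IsExact`). The classes `⟨E⟩_n` and the thick subcategories only depend on the
objects of distinguished triangles. Hence a functor on dg bimodules which preserves
quasi-isomorphisms, sums, shifts and cones, up to isomorphisms of objects, transports them;
no compatibility of the isomorphisms with the triangulated structure is needed.

*Resolutions* (`res`). A dg bimodule is resolved by attaching free bimodules `A ⊗ e ⊗ B` in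
countably many steps, each of which kills all the classes in the kernel and adds all the classes
missing in the image on cohomology. The construction lifts morphisms, and its outcome is flat on
both sides since `k` is a field, homotopically projective as a right module
(`rightProjective_res`), and every finite subset of it lies in a finite cell submodule
(`locallyFinCell_res`).

*The inverse* (`exists_invPair`). As `- ⊗_A K` computes the derived tensor product
(`isDerivedTensor_res`), it induces an equivalence of derived categories, and so does its right
adjoint `Hom_B(K, -)`. The unit and counit of the adjunction are therefore quasi-isomorphisms, for
right modules and hence for bimodules. For `L₀ = Hom_B(K, B)` the counit is a quasi-isomorphism
`L₀ ⊗_A K → B`; the unit gives `A → Hom_B(K, K) ← K ⊗_B L₀`. Finally `L` is a resolution of `L₀`.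

*Perfectness* (`InvPair.perf`, `InvPair.perfOp`). Let `S` resolve the right module `K`. The class
of `1` in `H⁰(A) = H⁰(S ⊗_B L)` is represented by a cocycle, which involves finitely many elements
of `S`, and so comes from a cocycle of `W ⊗_B L` for a finite cell module `W` (also the finitely
many relations which express that it is a cocycle have to hold in `W ⊗_B L`). This makes `A` a
direct summand of `W ⊗_B L` in `D(A)`, and `K` a direct summand of `W ⊗_B L ⊗_A K ≅ W` in `D(B)`.
-/

noncomputable section

/-! ### Cohomology, acyclicity and cones -/

namespace DGBimod

variable {k : Type u} [Field k] {A B C E : DGAlg k}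

/-- A dg bimodule is acyclic if its cohomology vanishes. -/
def Acyclic (M : DGBimod A B) : Prop := ∀ m : M, M.d m = 0 → ∃ m' : M, M.d m' = m

lemma lin_injective {M N : DGBimod A B} : Function.Injective (lin : (M ⟶ N) → (M →ₗ[k] N)) :=
  fun _ _ h => Hom.ext h

@[simp] lemma hom_inv_lin {M N : DGBimod A B} (e : M ≅ N) (m : M) :
    lin e.inv (lin e.hom m) = m := by
  rw [← lin_comp, e.hom_inv_id, lin_id]

@[simp] lemma inv_hom_lin {M N : DGBimod A B} (e : M ≅ N) (n : N) :
    lin e.hom (lin e.inv n) = n := by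
  rw [← lin_comp, e.inv_hom_id, lin_id]

lemma Acyclic.of_iso {M N : DGBimod A B} (e : M ≅ N) (h : Acyclic M) : Acyclic N := fun n hn => by
  obtain ⟨m, hm⟩ := h (lin e.inv n) (by rw [← lin_d, hn, map_zero])
  exact ⟨lin e.hom m, by rw [← lin_d, hm, inv_hom_lin]⟩

lemma Acyclic.shift {M : DGBimod A B} (h : Acyclic M) (n : ℤ) : Acyclic (M.shiftObj n) := by
  intro m hm
  obtain ⟨m, rfl⟩ := M.toShift_surj n m
  rw [d_toShift] at hm
  obtain ⟨m', hm'⟩ := h m (by simpa [ksign_ne_zero] using hm)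
  refine ⟨M.toShift n (ksign k n • m'), ?_⟩
  rw [d_toShift, M.d.map_smul, hm', map_smul, smul_smul, ksign_mul_self, one_smul]

section

variable {M N : DGBimod A B} (f : M ⟶ N)

lemma cone_d (n : N) (m : M) : (cone f).d (n, M.toShift 1 m) =
    (N.d n + lin f m, M.toShift 1 (-M.d m)) := by
  change coneD f (n, M.toShift 1 m) = _
  rw [coneD_apply, d_toShift, ksign_one, map_neg, neg_one_smul]

/-- A morphism is a quasi-isomorphism if and only if its cone is acyclic. -/
lemma quasiIso_iff_acyclic_cone : quasiIso A B f ↔ Acyclic (cone f) := by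
  rw [quasiIso_iff]
  constructor
  · rintro ⟨hi, hs⟩ ⟨n, m⟩ h
    obtain ⟨m, rfl⟩ := M.toShift_surj 1 m
    rw [cone_d] at h
    have h₁ : N.d n + lin f m = 0 := congrArg Prod.fst h
    have h₂ : M.d m = 0 := by
      have := (M.toShift 1).map_eq_zero_iff.1 (congrArg Prod.snd h)
      simpa using this
    obtain ⟨m', hm'⟩ := hi m (-n) h₂ (by rw [map_neg]; exact neg_eq_of_add_eq_zero_right h₁)
    obtain ⟨p, n', hp, hn'⟩ := hs (n + lin f m') (by rw [map_add, ← lin_d, hm', h₁])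
    refine ⟨(-n', M.toShift 1 (-m' + p)), ?_⟩
    rw [cone_d]
    refine Prod.ext ?_ ?_
    · change N.d (-n') + lin f (-m' + p) = n
      rw [map_add, map_neg, map_neg, hn']
      abel
    · change M.toShift 1 (-M.d (-m' + p)) = M.toShift 1 m
      rw [map_add, hp, M.d.map_neg, hm', add_zero, neg_neg]
  · intro h
    constructor
    · intro m n hm hn
      obtain ⟨⟨n', m'⟩, h'⟩ := h (-n, M.toShift 1 m) (by
        rw [cone_d, hm, map_neg, hn, neg_add_cancel, neg_zero, map_zero]; rfl)
      obtain ⟨m', rfl⟩ := M.toShift_surj 1 m'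
      rw [cone_d] at h'
      exact ⟨-m', by rw [map_neg]; exact (M.toShift 1).injective (congrArg Prod.snd h')⟩
    · intro n hn
      obtain ⟨⟨n', m'⟩, h'⟩ := h (n, M.toShift 1 0) (by
        rw [cone_d, hn, map_zero, map_zero, add_zero, neg_zero, map_zero]; rfl)
      obtain ⟨m', rfl⟩ := M.toShift_surj 1 m'
      rw [cone_d] at h'
      have h₁ : N.d n' + lin f m' = n := congrArg Prod.fst h'
      have h₂ : -M.d m' = 0 := (M.toShift 1).injective (congrArg Prod.snd h')
      exact ⟨m', -n', neg_eq_zero.1 h₂, by rw [map_neg, ← h₁]; abel⟩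

end

/-- Total cohomology as a functor to vector spaces. -/
def cohomologyFunctor (A B : DGAlg k) : DGBimod A B ⥤ ModuleCat.{u} k where
  obj M := ModuleCat.of k (Cohomology M)
  map f := ModuleCat.ofHom (cohomologyMap f)
  map_id M := by
    ext x
    rfl
  map_comp f g := by
    ext x
    rfl

lemma quasiIso_eq_inverseImage (A B : DGAlg k) : quasiIso A B =
    (MorphismProperty.isomorphisms (ModuleCat.{u} k)).inverseImage (cohomologyFunctor A B) := by
  ext M N f
  exact (ConcreteCategory.isIso_iff_bijective ((cohomologyFunctor A B).map f)).symm

instance : (quasiIso A B).HasTwoOutOfThreeProperty := by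
  rw [quasiIso_eq_inverseImage]; infer_instance

instance : (quasiIso A B).IsMultiplicative := by
  rw [quasiIso_eq_inverseImage]; infer_instance

instance : (quasiIso A B).RespectsIso := by
  rw [quasiIso_eq_inverseImage]; infer_instance

lemma quasiIso_of_isIso {M N : DGBimod A B} (f : M ⟶ N) [IsIso f] : quasiIso A B f :=
  (MorphismProperty.isomorphisms_le_of_containsIdentities (quasiIso A B)) f ‹_›

lemma isIso_Q_map {M N : DGBimod A B} (f : M ⟶ N) (hf : quasiIso A B f) :
    IsIso ((DCat.Q A B).map f) :=
  Localization.inverts (DCat.Q A B) (quasiIso A B) f hf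

/-- The class of quasi-isomorphisms is saturated: cohomology is defined on the derived category. -/
lemma quasiIso_of_isIso_Q_map {M N : DGBimod A B} (f : M ⟶ N)
    (h : IsIso ((DCat.Q A B).map f)) : quasiIso A B f := by
  have H : (quasiIso A B).IsInvertedBy (cohomologyFunctor A B) := by
    intro X Y g hg
    rw [quasiIso_eq_inverseImage] at hg
    exact hg
  let e := Localization.fac (cohomologyFunctor A B) H (DCat.Q A B)
  rw [quasiIso_eq_inverseImage]
  exact (NatIso.isIso_map_iff e f).1
    (inferInstanceAs (IsIso ((Localization.lift (cohomologyFunctor A B) H (DCat.Q A B)).map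
      ((DCat.Q A B).map f))))

/-! ### Additive structure and finite direct sums -/

instance (M N : DGBimod A B) : Zero (M ⟶ N) :=
  ⟨Hom.mk 0 (by simp) (by simp) (fun _ => Submodule.zero_mem _) (by simp)⟩

instance (M N : DGBimod A B) : Add (M ⟶ N) :=
  ⟨fun f g => Hom.mk (lin f + lin g) (fun a m => by simp [lin_map_smul])
    (fun a m => by simp [lin_map_rsmul]) (fun h => Submodule.add_mem _ (lin_mem f h) (lin_mem g h))
    (fun m => by simp [lin_d])⟩

instance (M N : DGBimod A B) : Neg (M ⟶ N) :=
  ⟨fun f => Hom.mk (-lin f) (fun a m => by simp [lin_map_smul])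
    (fun a m => by simp [lin_map_rsmul]) (fun h => Submodule.neg_mem _ (lin_mem f h))
    (fun m => by simp [lin_d])⟩

@[simp] lemma lin_zero (M N : DGBimod A B) : lin (0 : M ⟶ N) = 0 := rfl

@[simp] lemma lin_add {M N : DGBimod A B} (f g : M ⟶ N) : lin (f + g) = lin f + lin g := rfl

@[simp] lemma lin_neg {M N : DGBimod A B} (f : M ⟶ N) : lin (-f) = -lin f := rfl

instance (M N : DGBimod A B) : AddCommGroup (M ⟶ N) where
  add_assoc f g h := lin_injective (by simp [add_assoc])
  zero_add f := lin_injective (by simp)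
  add_zero f := lin_injective (by simp)
  add_comm f g := lin_injective (by simp [add_comm])
  neg_add_cancel f := lin_injective (by simp)
  nsmul := nsmulRec
  zsmul := zsmulRec

instance : Preadditive (DGBimod A B) where
  add_comp M N P f f' g := hom_ext fun m => by simp
  comp_add M N P f g g' := hom_ext fun m => by simp

/-- The zero dg bimodule. -/
def zeroObj (A B : DGAlg k) : DGBimod A B where
  carrier := PUnit
  grading := fun _ => ⊤
  isInternal := isInternal_of_proj _ 0 (fun _ _ _ => rfl) (fun _ _ _ _ _ => rfl) (by simp)
  smul_mem := fun _ _ => trivial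
  rsmul_mem := fun _ _ => trivial
  d := 0
  d_mem := fun _ => trivial
  d_d := fun _ => rfl
  d_smul := fun _ _ => rfl
  d_rsmul := fun _ _ => rfl

instance : Subsingleton (zeroObj A B) := inferInstanceAs (Subsingleton PUnit)

lemma isZero_of_subsingleton (M : DGBimod A B) [Subsingleton M] : IsZero M := by
  rw [IsZero.iff_id_eq_zero]
  exact hom_ext fun m => Subsingleton.elim _ _

instance : HasZeroObject (DGBimod A B) := ⟨⟨_, isZero_of_subsingleton (zeroObj A B)⟩⟩

/-- The direct sum of two dg bimodules. -/
def prodObj (M N : DGBimod A B) : DGBimod A B where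
  carrier := M × N
  grading := fun i => (M.grading i).prod (N.grading i)
  isInternal := isInternal_of_proj _ (fun i => (gproj M.grading i).prodMap (gproj N.grading i))
    (by rintro i ⟨n, m⟩ ⟨hn, hm⟩; simp [gproj_same _ hn, gproj_same _ hm])
    (by rintro i j h ⟨n, m⟩ ⟨hn, hm⟩; simp [gproj_other _ h hn, gproj_other _ h hm])
    (by
      have h₁ : (⨆ i, M.grading i) ≤ (⨆ i, (M.grading i).prod (N.grading i)).comap
            (LinearMap.inl k M N) :=
        iSup_le fun i n hn => Submodule.mem_iSup_of_mem i ⟨hn, Submodule.zero_mem _⟩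
      have h₂ : (⨆ i, N.grading i) ≤ (⨆ i, (M.grading i).prod (N.grading i)).comap
            (LinearMap.inr k M N) :=
        iSup_le fun i n hn => Submodule.mem_iSup_of_mem i ⟨Submodule.zero_mem _, hn⟩
      rw [M.isInternal.submodule_iSup_eq_top] at h₁
      rw [N.isInternal.submodule_iSup_eq_top] at h₂
      rw [eq_top_iff]
      rintro ⟨n, m⟩ -
      rw [show (n, m) = LinearMap.inl k M N n + LinearMap.inr k M N m
        from Prod.ext (add_zero n).symm (zero_add m).symm]
      exact Submodule.add_mem _ (h₁ (show n ∈ (⊤ : Submodule k M) from trivial))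
        (h₂ (show m ∈ (⊤ : Submodule k N) from trivial)))
  smul_mem := fun ha hm => ⟨M.smul_mem ha hm.1, N.smul_mem ha hm.2⟩
  rsmul_mem := fun hm hb => ⟨M.rsmul_mem hm.1 hb, N.rsmul_mem hm.2 hb⟩
  d := M.d.prodMap N.d
  d_mem := fun h => ⟨M.d_mem h.1, N.d_mem h.2⟩
  d_d := fun m => Prod.ext (M.d_d _) (N.d_d _)
  d_smul := fun ha m => Prod.ext (M.d_smul ha _) (N.d_smul ha _)
  d_rsmul := fun hm b => Prod.ext (M.d_rsmul hm.1 _) (N.d_rsmul hm.2 _)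

/-- The direct sum of two dg bimodules is a biproduct. -/
def prodBicone (M N : DGBimod A B) : BinaryBicone M N where
  pt := prodObj M N
  fst := Hom.mk (LinearMap.fst k M N) (fun _ _ => rfl) (fun _ _ => rfl) (fun h => h.1)
    (fun _ => rfl)
  snd := Hom.mk (LinearMap.snd k M N) (fun _ _ => rfl) (fun _ _ => rfl) (fun h => h.2)
    (fun _ => rfl)
  inl := Hom.mk (LinearMap.inl k M N) (fun a _ => Prod.ext rfl (smul_zero a).symm)
    (fun b _ => Prod.ext rfl (smul_zero (op b)).symm) (fun h => ⟨h, Submodule.zero_mem _⟩)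
    (fun _ => Prod.ext rfl N.d.map_zero.symm)
  inr := Hom.mk (LinearMap.inr k M N) (fun a _ => Prod.ext (smul_zero a).symm rfl)
    (fun b _ => Prod.ext (smul_zero (op b)).symm rfl) (fun h => ⟨Submodule.zero_mem _, h⟩)
    (fun _ => Prod.ext M.d.map_zero.symm rfl)
  inl_fst := rfl
  inl_snd := rfl
  inr_fst := rfl
  inr_snd := rfl

instance : HasBinaryBiproducts (DGBimod A B) where
  has_binary_biproduct M N := hasBinaryBiproduct_of_total (prodBicone M N) (by
      refine hom_ext fun x => ?_
      exact Prod.ext (add_zero x.1) (zero_add x.2))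

instance : HasFiniteProducts (DGBimod A B) := by
  have : HasTerminal (DGBimod A B) := HasZeroObject.hasTerminal
  exact hasFiniteProducts_of_has_binary_and_terminal

instance : HasFiniteBiproducts (DGBimod A B) := HasFiniteBiproducts.of_hasFiniteProducts

end DGBimod

/-! ### Finite direct sums in the derived category -/

namespace DGBimod

variable {k : Type u} [Field k] {A B : DGAlg k}

instance : (cohomologyFunctor A B).Additive where
  map_add := ModuleCat.hom_ext (Submodule.linearMap_qext _ (LinearMap.ext fun _ => rfl))

/-- Finite direct sums of quasi-isomorphisms are quasi-isomorphisms, so the localization functor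
creates finite coproducts in the derived category. -/
instance : (quasiIso A B).op.IsStableUnderFiniteProducts where
  isStableUnderProductsOfShape J _ := by
    have hp : PreservesFiniteProducts (cohomologyFunctor A B).op := preservesFiniteProducts_op _
    have : PreservesLimitsOfShape (Discrete J) (cohomologyFunctor A B).op := inferInstance
    constructor
    intro X₁ X₂ c₁ c₂ h₁ h₂ f hf φ hφ
    change quasiIso A B φ.unop
    rw [quasiIso_eq_inverseImage]
    suffices h : IsIso ((cohomologyFunctor A B).op.map φ) from
      (isIso_unop ((cohomologyFunctor A B).op.map φ))
    have hf' : ∀ j, IsIso ((Functor.whiskerRight f (cohomologyFunctor A B).op).app j) := fun j => by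
      have := hf j
      change quasiIso A B (f.app j).unop at this
      rw [quasiIso_eq_inverseImage] at this
      have : IsIso ((cohomologyFunctor A B).map (f.app j).unop) := this
      exact inferInstanceAs (IsIso ((cohomologyFunctor A B).map (f.app j).unop).op)
    have := NatIso.isIso_of_isIso_app (Functor.whiskerRight f (cohomologyFunctor A B).op)
    have e : (cohomologyFunctor A B).op.map φ = (IsLimit.conePointsIsoOfNatIso
        (isLimitOfPreserves (cohomologyFunctor A B).op h₁)
        (isLimitOfPreserves (cohomologyFunctor A B).op h₂)
        (asIso (Functor.whiskerRight f (cohomologyFunctor A B).op))).hom := by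
      refine (isLimitOfPreserves (cohomologyFunctor A B).op h₂).hom_ext fun j => ?_
      rw [IsLimit.conePointsIsoOfNatIso_hom_comp]
      change (cohomologyFunctor A B).op.map φ ≫ (cohomologyFunctor A B).op.map (c₂.π.app j) =
        (cohomologyFunctor A B).op.map (c₁.π.app j) ≫ (cohomologyFunctor A B).op.map (f.app j)
      rw [← Functor.map_comp, hφ, Functor.map_comp]
    rw [e]
    infer_instance

instance : HasFiniteCoproducts (DCat A B) := by
  have : HasFiniteProducts (DCat A B)ᵒᵖ :=
    Localization.hasFiniteProducts (DCat.Q A B).op (quasiIso A B).op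
  exact hasFiniteCoproducts_of_opposite

instance : PreservesFiniteCoproducts (DCat.Q A B) := by
  have : PreservesFiniteProducts (DCat.Q A B).op :=
    Localization.preservesFiniteProducts (DCat.Q A B).op (quasiIso A B).op
  exact preservesFiniteCoproducts_unop (DCat.Q A B).op

end DGBimod

/-! ### Generation in derived categories -/

namespace DCat

open DGBimod

variable {k : Type u} [Field k] {A B A' B' : DGAlg k}

lemma exists_eq_Q_obj (X : DCat A B) : ∃ M : DGBimod A B, X = (Q A B).obj M :=
  ⟨(Localization.Construction.objEquiv (quasiIso A B)).symm X,
    ((Localization.Construction.objEquiv (quasiIso A B)).apply_symm_apply X).symm⟩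

lemma IsDistinguished.exists_of_iso {T₀ : Pretriangulated.Triangle (DCat A B)}
    (h : IsDistinguished T₀) {X Y Z : DCat A B}
    (eX : X ≅ T₀.obj₁) (eY : Y ≅ T₀.obj₂) (eZ : Z ≅ T₀.obj₃) :
    ∃ T : Pretriangulated.Triangle (DCat A B),
      IsDistinguished T ∧ T.obj₁ = X ∧ T.obj₂ = Y ∧ T.obj₃ = Z := by
  obtain ⟨M, N, f, ⟨i⟩⟩ := h
  obtain ⟨X₀, Y₀, Z₀, a, b, c⟩ := T₀
  dsimp only at eX eY eZ
  refine ⟨Pretriangulated.Triangle.mk (eX.hom ≫ a ≫ eY.inv) (eY.hom ≫ b ≫ eZ.inv)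
    (eZ.hom ≫ c ≫ eX.inv⟦1⟧'), ⟨M, N, f, ⟨?_ ≪≫ i⟩⟩, rfl, rfl, rfl⟩
  refine Pretriangulated.Triangle.isoMk _ _ eX eY eZ ?_ ?_ ?_
  · change (eX.hom ≫ a ≫ eY.inv) ≫ eY.hom = eX.hom ≫ a
    simp
  · change (eY.hom ≫ b ≫ eZ.inv) ≫ eZ.hom = eY.hom ≫ b
    simp
  · change (eZ.hom ≫ c ≫ eX.inv⟦1⟧') ≫ eX.hom⟦1⟧' = eZ.hom ≫ c
    rw [Category.assoc, Category.assoc, ← Functor.map_comp, eX.inv_hom_id,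
      CategoryTheory.Functor.map_id, Category.comp_id]

lemma isDistinguished_of_iso {M N : DGBimod A B} (f : M ⟶ N) {X Y Z : DCat A B}
    (eX : X ≅ (Q A B).obj M) (eY : Y ≅ (Q A B).obj N) (eZ : Z ≅ (Q A B).obj (cone f)) :
    ∃ T : Pretriangulated.Triangle (DCat A B),
      IsDistinguished T ∧ T.obj₁ = X ∧ T.obj₂ = Y ∧ T.obj₃ = Z :=
  IsDistinguished.exists_of_iso (T₀ := (Q A B).mapTriangle.obj (coneTriangle f))
    ⟨M, N, f, ⟨Iso.refl _⟩⟩ eX eY eZ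

lemma IsDistinguished.exists_cone {T : Pretriangulated.Triangle (DCat A B)}
    (h : IsDistinguished T) : ∃ (M N : DGBimod A B) (f : M ⟶ N),
      Nonempty (T.obj₁ ≅ (Q A B).obj M) ∧ Nonempty (T.obj₂ ≅ (Q A B).obj N) ∧
        Nonempty (T.obj₃ ≅ (Q A B).obj (cone f)) := by
  obtain ⟨M, N, f, ⟨e⟩⟩ := h
  exact ⟨M, N, f, ⟨Pretriangulated.Triangle.π₁.mapIso e⟩, ⟨Pretriangulated.Triangle.π₂.mapIso e⟩,
    ⟨Pretriangulated.Triangle.π₃.mapIso e⟩⟩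

/-- The localization functor commutes with shifts. -/
def shiftQIso (M : DGBimod A B) (n : ℤ) :
    ((Q A B).obj M)⟦n⟧ ≅ (Q A B).obj (M.shiftObj n) :=
  (((Q A B).commShiftIso n).app M).symm

/-- Finite direct sums of shifts of a dg bimodule are formed at the level of dg bimodules. -/
lemma sums_iff (M : DGBimod A B) (X : DCat A B) : sums ((Q A B).obj M) X ↔
    ∃ (r : ℕ) (n : Fin r → ℤ), Nonempty (X ≅ (Q A B).obj (∐ fun i => M.shiftObj (n i))) := by
  have e (r : ℕ) (n : Fin r → ℤ) : (Q A B).obj (∐ fun i => M.shiftObj (n i)) ≅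
      ∐ fun i => ((Q A B).obj M)⟦n i⟧ :=
    PreservesCoproduct.iso (Q A B) _ ≪≫ Sigma.mapIso fun i => (shiftQIso M (n i)).symm
  constructor
  · rintro ⟨r, n, c, rfl, ⟨hc⟩⟩
    exact ⟨r, n, ⟨hc.coconePointUniqueUpToIso (coproductIsCoproduct _) ≪≫ (e r n).symm⟩⟩
  · rintro ⟨r, n, ⟨i⟩⟩
    exact ⟨r, n,
      Cofan.mk X fun j => Sigma.ι (fun i => ((Q A B).obj M)⟦n i⟧) j ≫ (i ≪≫ e r n).inv, rfl,
      ⟨IsColimit.ofIsoColimit (coproductIsCoproduct _)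
        (Cofan.ext (i ≪≫ e r n).symm fun j => rfl)⟩⟩

lemma sums_of_iso {M : DCat A B} {X Y : DCat A B} (e : X ≅ Y) (h : sums M X) : sums M Y := by
  obtain ⟨M, rfl⟩ := exists_eq_Q_obj M
  rw [sums_iff] at h ⊢
  obtain ⟨r, n, ⟨i⟩⟩ := h
  exact ⟨r, n, ⟨e.symm ≪≫ i⟩⟩

/-- Every extension in the derived category is represented by the mapping cone of a morphism of
dg bimodules. -/
lemma star_iff {P P' : ObjectProperty (DCat A B)} [P.IsClosedUnderIsomorphisms]
    [P'.IsClosedUnderIsomorphisms] (X : DCat A B) :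
    star P P' X ↔ ∃ (M N : DGBimod A B) (f : M ⟶ N), P ((Q A B).obj M) ∧
      Nonempty (X ≅ (Q A B).obj N) ∧ P' ((Q A B).obj (cone f)) := by
  constructor
  · rintro ⟨T, hT, h₁, rfl, h₃⟩
    obtain ⟨M, N, f, ⟨e₁⟩, ⟨e₂⟩, ⟨e₃⟩⟩ := hT.exists_cone
    exact ⟨M, N, f, P.prop_of_iso e₁ h₁, ⟨e₂⟩, P'.prop_of_iso e₃ h₃⟩
  · rintro ⟨M, N, f, h₁, ⟨e⟩, h₃⟩
    obtain ⟨T, hT, e₁, e₂, e₃⟩ := isDistinguished_of_iso f (Iso.refl _) e (Iso.refl _)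
    exact ⟨T, hT, e₁ ▸ h₁, e₂, e₃ ▸ h₃⟩

lemma star_of_iso {P P' : ObjectProperty (DCat A B)} {X Y : DCat A B} (e : X ≅ Y)
    (h : star P P' X) : star P P' Y := by
  obtain ⟨T, hT, h₁, rfl, h₃⟩ := h
  obtain ⟨T', hT', e₁, e₂, e₃⟩ := hT.exists_of_iso (Iso.refl _) e.symm (Iso.refl _)
  exact ⟨T', hT', e₁ ▸ h₁, e₂, e₃ ▸ h₃⟩

instance (E : DCat A B) (n : ℕ) : (steps E n).IsClosedUnderIsomorphisms where
  of_iso e h := by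
    cases n with
    | zero => exact sums_of_iso e h
    | succ n => exact star_of_iso e h

instance (E : DCat A B) : (sums E).IsClosedUnderIsomorphisms where
  of_iso e h := sums_of_iso e h

lemma gen_of_iso {E : DCat A B} {n : ℕ} {X Y : DCat A B} (e : X ≅ Y) (h : gen E n X) :
    gen E n Y := by
  obtain ⟨Z, hZ, ⟨r⟩⟩ := h
  exact ⟨Z, hZ, ⟨(Retract.ofIso e.symm).trans r⟩⟩

lemma sums_eq_of_iso {E E' : DCat A B} (e : E ≅ E') : sums E ≤ sums E' := by
  rintro _ ⟨r, n, c, rfl, ⟨hc⟩⟩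
  exact ⟨r, n, Cofan.mk c.pt fun j => (shiftFunctor _ (n j)).map e.inv ≫ c.inj j, rfl,
    ⟨(IsColimit.precomposeInvEquiv (Discrete.natIso fun i =>
      (shiftFunctor _ (n i.as)).mapIso e) c).symm hc |>.ofIsoColimit
      (Cofan.ext (Iso.refl _) fun j => by simp [Cofan.inj])⟩⟩

lemma steps_le_of_iso {E E' : DCat A B} (e : E ≅ E') (n : ℕ) : steps E n ≤ steps E' n := by
  induction n with
  | zero => exact sums_eq_of_iso e
  | succ n ih =>
    rintro X ⟨T, hT, h₁, h₂, h₃⟩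
    exact ⟨T, hT, ih _ h₁, h₂, sums_eq_of_iso e _ h₃⟩

lemma gen_le_of_iso {E E' : DCat A B} (e : E ≅ E') (n : ℕ) : gen E n ≤ gen E' n := by
  rintro X ⟨Y, hY, r⟩
  exact ⟨Y, steps_le_of_iso e n _ hY, r⟩

lemma thick_isThick (E : DCat A B) : IsThick (thick E) where
  iso e h P hP hE := hP.iso e (h P hP hE)
  shift X n h P hP hE := hP.shift X n (h P hP hE)
  cone T hT h₁ h₂ P hP hE := hP.cone T hT (h₁ P hP hE) (h₂ P hP hE)
  summand r h P hP hE := hP.summand r (h P hP hE)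

lemma thick_self (E : DCat A B) : thick E E := fun _ _ h => h

lemma IsThick.cone_mem {P : ObjectProperty (DCat A B)} (hP : IsThick P) {M N : DGBimod A B}
    (f : M ⟶ N) (hM : P ((Q A B).obj M)) (hN : P ((Q A B).obj N)) :
    P ((Q A B).obj (DGBimod.cone f)) := by
  obtain ⟨T, hT, e₁, e₂, e₃⟩ := isDistinguished_of_iso f (Iso.refl _) (Iso.refl _) (Iso.refl _)
  rw [← e₃]
  exact hP.cone T hT (e₁ ▸ hM) (e₂ ▸ hN)

lemma IsThick.shift_mem {P : ObjectProperty (DCat A B)} (hP : IsThick P) {M : DGBimod A B}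
    (n : ℤ) (hM : P ((Q A B).obj M)) : P ((Q A B).obj (M.shiftObj n)) :=
  hP.iso (shiftQIso M n) (hP.shift _ n hM)

end DCat

namespace DGBimod

open DCat

variable {k : Type u} [Field k] {A B A' B' : DGAlg k}

/-- A functor between categories of dg bimodules is exact if it is additive, preserves
quasi-isomorphisms and, up to isomorphism, shifts and cones.  No compatibility of these
isomorphisms with the structure morphisms of triangles is required, because star products and
thick subcategories only depend on the objects of distinguished triangles. -/
structure IsExact (F : DGBimod A B ⥤ DGBimod A' B') : Prop where
  additive : F.Additive
  quasiIso_map : ∀ {M N : DGBimod A B} (f : M ⟶ N), quasiIso A B f → quasiIso A' B' (F.map f)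
  shift : ∀ (M : DGBimod A B) (n : ℤ), Nonempty (F.obj (M.shiftObj n) ≅ (F.obj M).shiftObj n)
  cone : ∀ {M N : DGBimod A B} (f : M ⟶ N),
    Nonempty (F.obj (DGBimod.cone f) ≅ DGBimod.cone (F.map f))

namespace IsExact

variable {F : DGBimod A B ⥤ DGBimod A' B'}

lemma inverts (hF : IsExact F) : (quasiIso A B).IsInvertedBy (F ⋙ Q A' B') :=
  fun _ _ f hf => isIso_Q_map _ (hF.quasiIso_map f hf)

variable (hF : IsExact F)

/-- The functor induced by an exact functor on derived categories. -/
def derived : DCat A B ⥤ DCat A' B' := Localization.lift (F ⋙ Q A' B') hF.inverts (Q A B)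

/-- The induced functor on the image of the localization functor. -/
def derivedIso : Q A B ⋙ hF.derived ≅ F ⋙ Q A' B' :=
  Localization.fac (F ⋙ Q A' B') hF.inverts (Q A B)

/-- The induced functor on objects. -/
def derivedObjIso (M : DGBimod A B) : hF.derived.obj ((Q A B).obj M) ≅ (Q A' B').obj (F.obj M) :=
  hF.derivedIso.app M

/-- The value of the induced functor on an object isomorphic to the image of `M`. -/
def derivedIsoOfIso {X : DCat A B} {M : DGBimod A B} (e : X ≅ (Q A B).obj M) :
    hF.derived.obj X ≅ (Q A' B').obj (F.obj M) :=
  hF.derived.mapIso e ≪≫ hF.derivedObjIso M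

lemma sums_derived {M : DGBimod A B} {X : DCat A B} (h : sums ((Q A B).obj M) X) :
    sums ((Q A' B').obj (F.obj M)) (hF.derived.obj X) := by
  rw [sums_iff] at h ⊢
  obtain ⟨r, n, ⟨e⟩⟩ := h
  have := hF.additive
  exact ⟨r, n, ⟨hF.derivedIsoOfIso e ≪≫ (Q A' B').mapIso (PreservesCoproduct.iso F _ ≪≫
    Sigma.mapIso fun i => (hF.shift M (n i)).some)⟩⟩

lemma steps_derived {M : DGBimod A B} {X : DCat A B} {n : ℕ} (h : steps ((Q A B).obj M) n X) :
    steps ((Q A' B').obj (F.obj M)) n (hF.derived.obj X) := by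
  induction n generalizing X with
  | zero => exact hF.sums_derived h
  | succ n ih =>
    obtain ⟨L, N, f, h₁, ⟨e⟩, h₃⟩ := (star_iff X).1 h
    refine (star_iff _).2 ⟨F.obj L, F.obj N, F.map f, ?_, ⟨hF.derivedIsoOfIso e⟩, ?_⟩
    · exact ObjectProperty.prop_of_iso _ (hF.derivedObjIso L) (ih h₁)
    · exact sums_of_iso (hF.derivedObjIso _ ≪≫ (Q A' B').mapIso (hF.cone f).some)
        (hF.sums_derived h₃)

/-- Exact functors do not increase the number of cones needed for generation. -/
lemma gen_map (hF : IsExact F) {M N : DGBimod A B} {n : ℕ}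
    (h : gen ((Q A B).obj M) n ((Q A B).obj N)) :
    gen ((Q A' B').obj (F.obj M)) n ((Q A' B').obj (F.obj N)) := by
  obtain ⟨Y, hY, ⟨r⟩⟩ := h
  exact gen_of_iso (hF.derivedObjIso N) ⟨_, hF.steps_derived hY, ⟨r.map hF.derived⟩⟩

/-- The preimage of a thick subcategory under an exact functor is thick. -/
lemma isThick_inverseImage {P : ObjectProperty (DCat A' B')} (hP : IsThick P) :
    IsThick (P.inverseImage hF.derived) where
  iso e h := hP.iso (hF.derived.mapIso e) h
  shift X n h := by
    obtain ⟨M, rfl⟩ := exists_eq_Q_obj X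
    have h' : P ((Q A' B').obj (F.obj M)) := hP.iso (hF.derivedObjIso M) h
    exact hP.iso (hF.derivedIsoOfIso (shiftQIso M n) ≪≫
      (Q A' B').mapIso (hF.shift M n).some).symm (hP.shift_mem n h')
  cone T hT h₁ h₂ := by
    obtain ⟨M, N, f, ⟨e₁⟩, ⟨e₂⟩, ⟨e₃⟩⟩ := hT.exists_cone
    have h₁' : P ((Q A' B').obj (F.obj M)) := hP.iso (hF.derivedIsoOfIso e₁) h₁
    have h₂' : P ((Q A' B').obj (F.obj N)) := hP.iso (hF.derivedIsoOfIso e₂) h₂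
    exact hP.iso (hF.derivedIsoOfIso e₃ ≪≫ (Q A' B').mapIso (hF.cone f).some).symm
      (hP.cone_mem (F.map f) h₁' h₂')
  summand r h := hP.summand (r.map hF.derived) h

lemma thick_map (hF : IsExact F) {M N : DGBimod A B} {P : ObjectProperty (DCat A' B')}
    (hP : IsThick P) (hM : P ((Q A' B').obj (F.obj M)))
    (h : thick ((Q A B).obj M) ((Q A B).obj N)) :
    P ((Q A' B').obj (F.obj N)) :=
  hP.iso (hF.derivedObjIso N) (h _ (hF.isThick_inverseImage hP)
    (hP.iso (hF.derivedObjIso M).symm hM))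

end IsExact

end DGBimod

/-! ### Tensor products of dg bimodules -/

section Graded

variable {k : Type u} [Field k] {M : Type u} [AddCommGroup M] [Module k M]
  (ℳ : ℤ → Submodule k M) [DirectSum.Decomposition ℳ]

lemma gproj_mem (i : ℤ) (m : M) : gproj ℳ i m ∈ ℳ i := (DirectSum.decompose ℳ m i).2

lemma mem_of_gproj_eq {i : ℤ} {m : M} (h : gproj ℳ i m = m) : m ∈ ℳ i := h ▸ gproj_mem ℳ i m

/-- Linear maps of degree `l` commute with projections. -/
lemma gproj_comm {N : Type u} [AddCommGroup N] [Module k N] (𝒩 : ℤ → Submodule k N)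
    [DirectSum.Decomposition 𝒩] (f : M →ₗ[k] N) (l : ℤ)
    (h : ∀ i, ∀ m ∈ ℳ i, f m ∈ 𝒩 (i + l)) (i : ℤ) (m : M) :
    f (gproj ℳ i m) = gproj 𝒩 (i + l) (f m) := by
  have : f ∘ₗ gproj ℳ i = gproj 𝒩 (i + l) ∘ₗ f := by
    refine gext ℳ fun j m hm => ?_
    rw [LinearMap.comp_apply, LinearMap.comp_apply]
    by_cases hij : j = i
    · subst hij
      rw [gproj_same _ hm, gproj_same _ (h _ _ hm)]
    · rw [gproj_other _ hij hm, gproj_other _ (show j + l ≠ i + l by omega) (h _ _ hm), map_zero]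
  exact LinearMap.congr_fun this m

lemma twist_mem (n : ℤ) {i : ℤ} {m : M} (hm : m ∈ ℳ i) : twist ℳ n m ∈ ℳ i := by
  rw [twist_of_mem ℳ n hm]
  exact Submodule.smul_mem _ _ hm

lemma ksign_sub_one (i : ℤ) : ksign k (i - 1) = - ksign k i := by
  have := ksign_add (k := k) (i - 1) 1
  rw [sub_add_cancel, ksign_one] at this
  rw [this]
  ring

lemma twist_neg_twist (n : ℤ) (m : M) : twist ℳ n (twist ℳ n m) = m := by
  induction m using DirectSum.Decomposition.inductionOn ℳ with
  | zero => simp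
  | homogeneous m =>
    rw [twist_of_mem ℳ _ m.2, map_smul, twist_of_mem ℳ _ m.2, smul_smul, ksign_mul_self, one_smul]
  | add x y hx hy => simp [hx, hy]

end Graded

namespace DGBimod

variable {k : Type u} [Field k] {A B C E : DGAlg k}

lemma lin_gproj {M N : DGBimod A B} (f : M ⟶ N) (i : ℤ) (m : M) :
    lin f (gproj M.grading i m) = gproj N.grading i (lin f m) := by
  have := gproj_comm M.grading N.grading (lin f) 0 (fun i m hm => by
    rw [add_zero]; exact lin_mem f hm) i m
  rwa [add_zero] at this

lemma d_gproj (M : DGBimod A B) (i : ℤ) (m : M) :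
    M.d (gproj M.grading i m) = gproj M.grading (i + 1) (M.d m) :=
  gproj_comm M.grading M.grading M.d 1 (fun _ _ hm => M.d_mem hm) i m

lemma mem_of_lin_mem {M N : DGBimod A B} (f : M ⟶ N) (hf : Function.Injective (lin f)) {i : ℤ}
    {m : M} (h : lin f m ∈ N.grading i) : m ∈ M.grading i :=
  mem_of_gproj_eq _ (hf (by rw [lin_gproj, gproj_same _ h]))

/-- A morphism with a linear inverse is an isomorphism. -/
def isoOfInverse {M N : DGBimod A B} (f : M ⟶ N) (g : N →ₗ[k] M) (h₁ : ∀ m, g (lin f m) = m)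
    (h₂ : ∀ n, lin f (g n) = n) : M ≅ N :=
  have hf : Function.Injective (lin f) := Function.LeftInverse.injective h₁
  mkIso (LinearEquiv.ofLinearMap (lin f) g (LinearMap.ext h₂) (LinearMap.ext h₁))
    (fun a m => lin_map_smul f a m) (fun b m => lin_map_rsmul f (op b) m)
    (fun _ _ => ⟨lin_mem f, mem_of_lin_mem f hf⟩) (fun m => lin_d f m)

lemma twist_smul (M : DGBimod A B) (n : ℤ) (a : A) (m : M) :
    twist M.grading n (a • m) = twist A.grading n a • twist M.grading n m := by
  have : (M.lact).compr₂ (twist M.grading n) =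
      (M.lact).compl₁₂ (twist A.grading n) (twist M.grading n) := by
    refine gext A.grading fun i a ha => gext M.grading fun j m hm => ?_
    simp only [LinearMap.compr₂_apply, lact_apply, LinearMap.compl₁₂_apply]
    rw [twist_of_mem _ _ ha, twist_of_mem _ _ hm, twist_of_mem _ _ (M.smul_mem ha hm), mul_add,
      ksign_add, smul_assoc, smul_comm a (ksign k (n * j)) m, smul_smul]
  exact LinearMap.congr_fun₂ this a m

lemma twist_rsmul (M : DGBimod A B) (n : ℤ) (b : B) (m : M) :
    twist M.grading n (op b • m) = op (twist B.grading n b) • twist M.grading n m := by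
  have : (M.ract).compr₂ (twist M.grading n) =
      (M.ract).compl₁₂ (twist B.grading n) (twist M.grading n) := by
    refine gext B.grading fun i b hb => gext M.grading fun j m hm => ?_
    simp only [LinearMap.compr₂_apply, ract_apply, LinearMap.compl₁₂_apply]
    rw [twist_of_mem _ _ hb, twist_of_mem _ _ hm, twist_of_mem _ _ (M.rsmul_mem hm hb), mul_add,
      ksign_add, op_smul, smul_assoc, smul_comm (op b) (ksign k (n * j)) m, smul_smul, mul_comm]
  exact LinearMap.congr_fun₂ this b m

section Tensor

variable (M : DGBimod A B) (N : DGBimod B C)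

/-- The universal balanced map `(m, n) ↦ m ⊗ n` with values in the dg bimodule `M ⊗_B N`. -/
def tm : M →ₗ[k] N →ₗ[k] tensorObj M N := tmk M N

variable {M N}

lemma tm_balanced (b : B) (m : M) (n : N) : tm M N (op b • m) n = tm M N m (b • n) :=
  tmk_balanced b m n

lemma smul_tm (a : A) (m : M) (n : N) : a • tm M N m n = tm M N (a • m) n := rfl

lemma rsmul_tm (c : Cᵐᵒᵖ) (m : M) (n : N) : c • tm M N m n = tm M N m (c • n) := rfl

lemma tm_mem {i j : ℤ} {m : M} (hm : m ∈ M.grading i) {n : N} (hn : n ∈ N.grading j) :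
    tm M N m n ∈ (tensorObj M N).grading (i + j) := tmk_mem rfl hm hn

lemma d_tm {i : ℤ} {m : M} (hm : m ∈ M.grading i) (n : N) : (tensorObj M N).d (tm M N m n) =
    tm M N (M.d m) n + ksign k i • tm M N m (N.d n) := tdiff_tmk hm n

section

variable {P : Type u} [AddCommGroup P] [Module k P]

/-- The linear map on `M ⊗_B N` induced by a balanced bilinear map. -/
def tdesc (φ : M →ₗ[k] N →ₗ[k] P)
    (h : ∀ (b : B) (m : M) (n : N), φ (op b • m) n = φ m (b • n)) : tensorObj M N →ₗ[k] P :=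
  tlift φ h

@[simp] lemma tdesc_tm (φ : M →ₗ[k] N →ₗ[k] P)
    (h : ∀ (b : B) (m : M) (n : N), φ (op b • m) n = φ m (b • n)) (m : M) (n : N) :
    tdesc φ h (tm M N m n) = φ m n := rfl

lemma tm_ext {f g : tensorObj M N →ₗ[k] P} (h : ∀ m n, f (tm M N m n) = g (tm M N m n)) :
    f = g := thom_ext h

lemma tm_gext {f g : tensorObj M N →ₗ[k] P}
    (h : ∀ i, ∀ m ∈ M.grading i, ∀ j, ∀ n ∈ N.grading j, f (tm M N m n) = g (tm M N m n)) :
    f = g := thom_gext h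

end

/-- A morphism of dg bimodules out of a tensor product. -/
def tHom {P : DGBimod A C} (φ : M →ₗ[k] N →ₗ[k] P)
    (bal : ∀ (b : B) (m : M) (n : N), φ (op b • m) n = φ m (b • n))
    (left : ∀ (a : A) (m : M) (n : N), φ (a • m) n = a • φ m n)
    (right : ∀ (c : C) (m : M) (n : N), φ m (op c • n) = op c • φ m n)
    (mem : ∀ i, ∀ m ∈ M.grading i, ∀ j, ∀ n ∈ N.grading j, φ m n ∈ P.grading (i + j))
    (hd : ∀ i, ∀ m ∈ M.grading i, ∀ j, ∀ n ∈ N.grading j,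
      P.d (φ m n) = φ (M.d m) n + ksign k i • φ m (N.d n)) : tensorObj M N ⟶ P :=
  Hom.mk (tdesc φ bal)
    (fun a x => by
      change (tdesc φ bal ∘ₗ (tensorObj M N).lact a) x = (P.lact a ∘ₗ tdesc φ bal) x
      congr 1
      exact tm_ext fun m n => left a m n)
    (fun c x => by
      change (tdesc φ bal ∘ₗ (tensorObj M N).ract c) x = (P.ract c ∘ₗ tdesc φ bal) x
      congr 1
      exact tm_ext fun m n => right c m n)
    (fun {l x} hx => tgrading_map (f := tdesc φ bal)
      (fun i j h m hm n hn => h ▸ mem i m hm j n hn) hx)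
    (fun x => by
      change (tdesc φ bal ∘ₗ (tensorObj M N).d) x = (P.d ∘ₗ tdesc φ bal) x
      congr 1
      refine tm_gext fun i m hm j n hn => ?_
      rw [LinearMap.comp_apply, LinearMap.comp_apply, d_tm hm, map_add, map_smul, tdesc_tm,
        tdesc_tm, tdesc_tm, hd i m hm j n hn])

lemma tensorHom_ext {P : DGBimod A C} {f g : tensorObj M N ⟶ P}
    (h : ∀ m n, lin f (tm M N m n) = lin g (tm M N m n)) : f = g := lin_injective (tm_ext h)

@[simp] lemma lin_tensorMap_tm {M' : DGBimod A B} (f : M ⟶ M') (m : M) (n : N) :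
    lin (tensorMap N f) (tm M N m n) = tm M' N (lin f m) n := rfl

variable (M)

/-- The morphism `M ⊗ g`. -/
def tensorMapRight {N' : DGBimod B C} (g : N ⟶ N') : tensorObj M N ⟶ tensorObj M N' :=
  tHom ((tm M N').compl₂ (lin g))
    (fun b m n => by
      rw [LinearMap.compl₂_apply, LinearMap.compl₂_apply, lin_map_smul, tm_balanced])
    (fun a m n => rfl)
    (fun c m n => by
      rw [LinearMap.compl₂_apply, LinearMap.compl₂_apply, lin_map_rsmul, rsmul_tm])
    (fun i m hm j n hn => tm_mem hm (lin_mem g hn))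
    (fun i m hm j n hn => by
      simp only [LinearMap.compl₂_apply]
      rw [d_tm hm, lin_d])

@[simp] lemma lin_tensorMapRight_tm {N' : DGBimod B C} (g : N ⟶ N') (m : M) (n : N) :
    lin (tensorMapRight M g) (tm M N m n) = tm M N' m (lin g n) := rfl

/-- The functor `M ⊗_B -`. -/
def tensorLeftFun : DGBimod B C ⥤ DGBimod A C where
  obj N := tensorObj M N
  map g := tensorMapRight M g
  map_id _ := tensorHom_ext fun _ _ => rfl
  map_comp _ _ := tensorHom_ext fun _ _ => rfl

instance : (tensorLeftFun M : DGBimod B C ⥤ DGBimod A C).Additive where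
  map_add := tensorHom_ext fun m _ => (tm M _ m).map_add _ _

variable (N)

instance : (tensorFun N : DGBimod A B ⥤ DGBimod A C).Additive where
  map_add {X Y f g} := tensorHom_ext fun m n => by
    change tm Y N (lin f m + lin g m) n = tm Y N (lin f m) n + tm Y N (lin g m) n
    rw [map_add]; rfl

variable {M N} in
lemma tensorMap_comp_tensorMapRight {M' : DGBimod A B} {N' : DGBimod B C} (f : M ⟶ M')
    (g : N ⟶ N') : tensorMap N f ≫ tensorMapRight M' g = tensorMapRight M g ≫ tensorMap N' f :=
  tensorHom_ext fun _ _ => rfl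

/-! ### Units and associativity -/

/-- The isomorphism `A ⊗_A M ≅ M`. -/
def leftUnit : tensorObj (diag A) M ≅ M :=
  isoOfInverse
    (tHom (M := diag A) (N := M) (P := M) M.lact (fun (b a : A) m => mul_smul a b m)
      (fun (a b : A) m => mul_smul a b m) (fun b (a : A) m => (smul_comm a (op b) m))
      (fun i a ha j m hm => M.smul_mem ha hm) (fun i a ha j m hm => M.d_smul ha m))
    (tm (diag A) M (1 : A))
    (fun x => by
      change ((tm (diag A) M (1 : A)) ∘ₗ lin _) x = LinearMap.id (R := k) x
      congr 1
      refine tm_ext fun a m => ?_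
      exact (tm_balanced (M := diag A) (N := M) a (1 : A) m).symm.trans
        (congrArg (fun y : A => tm (diag A) M y m) (one_mul (show A from a))))
    (fun m => one_smul A m)

/-- The isomorphism `M ⊗_B B ≅ M`. -/
def rightUnit : tensorObj M (diag B) ≅ M :=
  isoOfInverse
    (tHom (M := M) (N := diag B) (P := M) M.ract.flip
      (fun b m (b' : B) => (mul_smul (op b') (op b) m).symm)
      (fun a m (b : B) => (smul_comm a (op b) m).symm) (fun c m (b : B) => mul_smul (op c) (op b) m)
      (fun i m hm j b hb => M.rsmul_mem hm hb) (fun i m hm j b hb => M.d_rsmul hm b))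
    ((tm M (diag B)).flip (1 : B))
    (fun x => by
      change ((tm M (diag B)).flip (1 : B) ∘ₗ lin _) x = LinearMap.id (R := k) x
      congr 1
      refine tm_ext fun m b => ?_
      exact (tm_balanced (M := M) (N := diag B) b m (1 : B)).trans
        (congrArg (fun y : B => tm M (diag B) m y) (mul_one (show B from b))))
    (fun m => one_smul Bᵐᵒᵖ m)

section Assoc

variable (P : DGBimod C E)

/-- The trilinear map underlying the associator. -/
def assocAux : tensorObj M N →ₗ[k] P →ₗ[k] tensorObj M (tensorObj N P) :=
  tdesc (LinearMap.mk₂ k (fun m n => tm M (tensorObj N P) m ∘ₗ tm N P n)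
      (fun m m' n => by ext; simp) (fun c m n => by ext; simp) (fun m n n' => by ext; simp)
      (fun c m n => by ext; simp))
    (fun b m n => by
      ext p
      change tm M (tensorObj N P) (op b • m) (tm N P n p) =
        tm M (tensorObj N P) m (tm N P (b • n) p)
      rw [tm_balanced, smul_tm])

@[simp] lemma assocAux_tm (m : M) (n : N) (p : P) :
    assocAux M N P (tm M N m n) p = tm M (tensorObj N P) m (tm N P n p) := rfl

/-- The trilinear map underlying the inverse of the associator. -/
def assocInvAux : M →ₗ[k] tensorObj N P →ₗ[k] tensorObj (tensorObj M N) P :=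
  LinearMap.flip (tdesc (LinearMap.mk₂ k
      (fun n p => (tm (tensorObj M N) P).flip p ∘ₗ (tm M N).flip n)
      (fun m m' n => by ext; simp) (fun c m n => by ext; simp) (fun m n n' => by ext; simp)
      (fun c m n => by ext; simp))
    (fun c n p => by
      ext m
      change tm (tensorObj M N) P (tm M N m (op c • n)) p =
        tm (tensorObj M N) P (tm M N m n) (c • p)
      rw [← tm_balanced, rsmul_tm]))

/-- The morphism `(M ⊗_B N) ⊗_C P → M ⊗_B (N ⊗_C P)`. -/
def assocHom : tensorObj (tensorObj M N) P ⟶ tensorObj M (tensorObj N P) :=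
  tHom (assocAux M N P)
    (fun c x p => by
      change (assocAux M N P ∘ₗ (tensorObj M N).ract c) x p =
        ((assocAux M N P).compl₂ (P.lact c)) x p
      congr 2
      exact tm_ext fun m n => LinearMap.ext fun p =>
        congrArg (tm M (tensorObj N P) m) (tm_balanced c n p))
    (fun a x p => by
      change (assocAux M N P ∘ₗ (tensorObj M N).lact a) x p =
        ((assocAux M N P).compr₂ ((tensorObj M (tensorObj N P)).lact a)) x p
      congr 2
      exact tm_ext fun m n => LinearMap.ext fun p => rfl)
    (fun c x p => by
      change ((assocAux M N P).compl₂ (P.ract c)) x p =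
        ((assocAux M N P).compr₂ ((tensorObj M (tensorObj N P)).ract c)) x p
      congr 2
      exact tm_ext fun m n => LinearMap.ext fun p => rfl)
    (fun i x hx l p hp => tgrading_map (f := (assocAux M N P).flip p)
      (fun i' j h m hm n hn => by
        have := tm_mem hm (tm_mem hn hp)
        rwa [← add_assoc, h] at this) hx)
    (fun i x hx l p hp => by
      refine tgrading_ext (f := (tensorObj M (tensorObj N P)).d ∘ₗ (assocAux M N P).flip p)
        (g := (assocAux M N P).flip p ∘ₗ (tensorObj M N).d +
          ksign k i • (assocAux M N P).flip (P.d p)) (fun i' j h m hm n hn => ?_) hx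
      change (tensorObj M (tensorObj N P)).d (tm M (tensorObj N P) m (tm N P n p)) =
        assocAux M N P ((tensorObj M N).d (tm M N m n)) p +
          ksign k i • tm M (tensorObj N P) m (tm N P n (P.d p))
      rw [d_tm hm, d_tm hm, d_tm hn, ← h, ksign_add]
      simp only [map_add, map_smul, LinearMap.add_apply, LinearMap.smul_apply, assocAux_tm,
        smul_add, smul_smul]
      abel)

/-- The inverse of the associator as a linear map. -/
def assocInv : tensorObj M (tensorObj N P) →ₗ[k] tensorObj (tensorObj M N) P :=
  tdesc (assocInvAux M N P)
    (fun b m x => by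
      change (assocInvAux M N P).flip.compl₂ (M.ract b) x m =
        ((assocInvAux M N P).flip ∘ₗ (tensorObj N P).lact b) x m
      congr 2
      refine tm_ext fun n p => LinearMap.ext fun m => ?_
      change tm (tensorObj M N) P (tm M N (op b • m) n) p =
        tm (tensorObj M N) P (tm M N m (b • n)) p
      rw [tm_balanced])

/-- The isomorphism `(M ⊗_B N) ⊗_C P ≅ M ⊗_B (N ⊗_C P)`. -/
def assoc : tensorObj (tensorObj M N) P ≅ tensorObj M (tensorObj N P) :=
  isoOfInverse (assocHom M N P) (assocInv M N P)
    (fun x => LinearMap.congr_fun (f := assocInv M N P ∘ₗ lin (assocHom M N P))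
      (g := LinearMap.id) (tm_ext fun y p => LinearMap.congr_fun
        (f := assocInv M N P ∘ₗ (assocAux M N P).flip p) (g := (tm (tensorObj M N) P).flip p)
        (tm_ext fun _ _ => rfl) y) x)
    (fun x => LinearMap.congr_fun (f := lin (assocHom M N P) ∘ₗ assocInv M N P)
      (g := LinearMap.id) (tm_ext fun m y => LinearMap.congr_fun
        (f := lin (assocHom M N P) ∘ₗ assocInvAux M N P m) (g := tm M (tensorObj N P) m)
        (tm_ext fun _ _ => rfl) y) x)

end Assoc

end Tensor

end DGBimod

/-! ### Exactness of tensor products -/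

namespace DGBimod

variable {k : Type u} [Field k] {A B C E : DGAlg k}

section

variable (M : DGBimod A B) (N : DGBimod B C) (n : ℤ)

/-- The morphism `M[n] ⊗ N → (M ⊗ N)[n]`. -/
def tensorShiftLeftHom : tensorObj (M.shiftObj n) N ⟶ (tensorObj M N).shiftObj n :=
  tHom ((tm M N).compr₂ ((tensorObj M N).toShift n).toLinearMap ∘ₗ
      (M.toShift n).symm.toLinearMap)
    (fun b x y => by
      obtain ⟨x, rfl⟩ := M.toShift_surj n x
      exact congrArg ((tensorObj M N).toShift n) (tm_balanced b x y))
    (fun a x y => rfl) (fun c x y => rfl)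
    (fun i x hx j y hy => by
      obtain ⟨x, rfl⟩ := M.toShift_surj n x
      refine ((tensorObj M N).toShift_mem n).2 ?_
      have := tm_mem ((M.toShift_mem n).1 hx) hy
      rwa [show i + n + j = i + j + n by ring] at this)
    (fun i x hx j y hy => by
      obtain ⟨x, rfl⟩ := M.toShift_surj n x
      rw [d_toShift]
      change ((tensorObj M N).shiftObj n).d ((tensorObj M N).toShift n (tm M N x y)) =
        (tensorObj M N).toShift n (tm M N (ksign k n • M.d x) y) +
          ksign k i • (tensorObj M N).toShift n (tm M N x (N.d y))
      rw [d_toShift, d_tm ((M.toShift_mem n).1 hx)]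
      simp only [map_add, map_smul, LinearMap.smul_apply, smul_add, smul_smul, ksign_add]
      rw [mul_left_comm, ksign_mul_self, mul_one])

/-- The inverse of `tensorShiftLeftHom` as a linear map. -/
def tensorShiftLeftInv : tensorObj M N →ₗ[k] tensorObj (M.shiftObj n) N :=
  tdesc ((tm (M.shiftObj n) N) ∘ₗ (M.toShift n).toLinearMap)
    (fun b x y => tm_balanced (M := M.shiftObj n) b (M.toShift n x) y)

/-- The isomorphism `M[n] ⊗ N ≅ (M ⊗ N)[n]`. -/
def tensorShiftLeft : tensorObj (M.shiftObj n) N ≅ (tensorObj M N).shiftObj n :=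
  isoOfInverse (tensorShiftLeftHom M N n)
    (tensorShiftLeftInv M N n ∘ₗ ((tensorObj M N).toShift n).symm.toLinearMap)
    (fun x => LinearMap.congr_fun (f := (tensorShiftLeftInv M N n ∘ₗ
        ((tensorObj M N).toShift n).symm.toLinearMap) ∘ₗ lin (tensorShiftLeftHom M N n))
      (g := LinearMap.id) (tm_ext fun _ _ => rfl) x)
    (fun x => by
      obtain ⟨x, rfl⟩ := (tensorObj M N).toShift_surj n x
      exact LinearMap.congr_fun
        (f := lin (tensorShiftLeftHom M N n) ∘ₗ tensorShiftLeftInv M N n)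
        (g := ((tensorObj M N).toShift n).toLinearMap) (tm_ext fun _ _ => rfl) x)

/-- The morphism `M ⊗ N[n] → (M ⊗ N)[n]`, which sends `m ⊗ y` to `(-1)^{n|m|} m ⊗ y`. -/
def tensorShiftRightHom : tensorObj M (N.shiftObj n) ⟶ (tensorObj M N).shiftObj n :=
  tHom (((tm M N ∘ₗ twist M.grading n).compr₂ ((tensorObj M N).toShift n).toLinearMap).compl₂
      (N.toShift n).symm.toLinearMap)
    (fun b x y => by
      obtain ⟨y, rfl⟩ := N.toShift_surj n y
      refine congrArg ((tensorObj M N).toShift n) ?_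
      change tm M N (twist M.grading n (op b • x)) y =
        tm M N (twist M.grading n x) (twist B.grading n b • y)
      rw [twist_rsmul, tm_balanced])
    (fun a x y => by
      refine congrArg ((tensorObj M N).toShift n) ?_
      change tm M N (twist M.grading n (a • x)) ((N.toShift n).symm y) =
        twist A.grading n a • tm M N (twist M.grading n x) ((N.toShift n).symm y)
      rw [twist_smul, smul_tm])
    (fun c x y => rfl)
    (fun i x hx j y hy => by
      obtain ⟨y, rfl⟩ := N.toShift_surj n y
      refine ((tensorObj M N).toShift_mem n).2 ?_
      have := tm_mem (twist_mem M.grading n hx) ((N.toShift_mem n).1 hy)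
      rwa [← add_assoc] at this)
    (fun i x hx j y hy => by
      obtain ⟨y, rfl⟩ := N.toShift_surj n y
      rw [d_toShift]
      change ((tensorObj M N).shiftObj n).d ((tensorObj M N).toShift n
          (tm M N (twist M.grading n x) y)) =
        (tensorObj M N).toShift n (tm M N (twist M.grading n (M.d x)) y) +
          ksign k i • (tensorObj M N).toShift n
            (tm M N (twist M.grading n x) (ksign k n • N.d y))
      rw [d_toShift, twist_of_mem _ _ hx, twist_of_mem _ _ (M.d_mem hx)]
      simp only [map_add, map_smul, LinearMap.smul_apply, d_tm hx, smul_add, smul_smul, mul_add,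
        mul_one, ksign_add]
      congr 2 <;> ring)

/-- The inverse of `tensorShiftRightHom` as a linear map. -/
def tensorShiftRightInv : tensorObj M N →ₗ[k] tensorObj M (N.shiftObj n) :=
  tdesc (((tm M (N.shiftObj n)) ∘ₗ twist M.grading n).compl₂ (N.toShift n).toLinearMap)
    (fun b x y => by
      change tm M (N.shiftObj n) (twist M.grading n (op b • x)) (N.toShift n y) =
        tm M (N.shiftObj n) (twist M.grading n x) (N.toShift n (b • y))
      rw [twist_rsmul, tm_balanced, smul_toShift, twist_neg_twist])

/-- The isomorphism `M ⊗ N[n] ≅ (M ⊗ N)[n]`. -/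
def tensorShiftRight : tensorObj M (N.shiftObj n) ≅ (tensorObj M N).shiftObj n :=
  isoOfInverse (tensorShiftRightHom M N n)
    (tensorShiftRightInv M N n ∘ₗ ((tensorObj M N).toShift n).symm.toLinearMap)
    (fun x => LinearMap.congr_fun (f := (tensorShiftRightInv M N n ∘ₗ
        ((tensorObj M N).toShift n).symm.toLinearMap) ∘ₗ lin (tensorShiftRightHom M N n))
      (g := LinearMap.id) (tm_ext fun x y => congrArg (fun z => tm M (N.shiftObj n) z y)
        (twist_neg_twist M.grading n x)) x)
    (fun x => by
      obtain ⟨x, rfl⟩ := (tensorObj M N).toShift_surj n x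
      exact LinearMap.congr_fun
        (f := lin (tensorShiftRightHom M N n) ∘ₗ tensorShiftRightInv M N n)
        (g := ((tensorObj M N).toShift n).toLinearMap) (tm_ext fun x y =>
          congrArg (fun z => (tensorObj M N).toShift n (tm M N z y))
            (twist_neg_twist M.grading n x)) x)

end

/-! ### The universal property of the cone -/

section

variable {M N : DGBimod A B} (f : M ⟶ N)

/-- The inclusion of the summand `N` into the cone of `M → N`. -/
def cIn : N →ₗ[k] cone f := LinearMap.inl k N (M.shiftObj 1)

/-- The inclusion of the summand `M` into the cone of `M → N`, of degree `-1`. -/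
def cSh : M →ₗ[k] cone f := LinearMap.inr k N (M.shiftObj 1) ∘ₗ (M.toShift 1).toLinearMap

lemma lin_coneIn (n : N) : lin (coneIn f) n = cIn f n := rfl

lemma exists_eq_cIn_add_cSh (x : cone f) : ∃ n m, x = cIn f n + cSh f m := by
  obtain ⟨n, m⟩ := x
  obtain ⟨m, rfl⟩ := M.toShift_surj 1 m
  exact ⟨n, m, Prod.ext (add_zero n).symm (zero_add _).symm⟩

lemma cIn_injective : Function.Injective (cIn f) := fun _ _ h => congrArg Prod.fst h

lemma d_cIn (n : N) : (cone f).d (cIn f n) = cIn f (N.d n) := (lin_d (coneIn f) n).symm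

lemma d_cSh (m : M) : (cone f).d (cSh f m) = cIn f (lin f m) - cSh f (M.d m) := by
  refine Prod.ext ?_ ?_
  · change N.d 0 + lin f m = lin f m - 0
    rw [map_zero, zero_add, sub_zero]
  · change (M.shiftObj 1).d (M.toShift 1 m) = 0 - M.toShift 1 (M.d m)
    rw [d_toShift, ksign_one, neg_one_smul, zero_sub]

lemma smul_cIn (a : A) (n : N) : a • cIn f n = cIn f (a • n) := (lin_map_smul (coneIn f) a n).symm

lemma smul_cSh (a : A) (m : M) : a • cSh f m = cSh f (twist A.grading 1 a • m) :=
  Prod.ext (smul_zero a) rfl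

lemma rsmul_cIn (b : Bᵐᵒᵖ) (n : N) : b • cIn f n = cIn f (b • n) :=
  (lin_map_rsmul (coneIn f) b n).symm

lemma rsmul_cSh (b : Bᵐᵒᵖ) (m : M) : b • cSh f m = cSh f (b • m) :=
  Prod.ext (smul_zero b) rfl

lemma add_mem_cone_grading {i : ℤ} {n : N} {m : M} :
    cIn f n + cSh f m ∈ (cone f).grading i ↔ n ∈ N.grading i ∧ m ∈ M.grading (i + 1) := by
  rw [← M.toShift_mem]
  change (n + 0 ∈ N.grading i ∧ 0 + M.toShift 1 m ∈ (M.shiftObj 1).grading i) ↔ _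
  rw [add_zero, zero_add]

lemma cSh_mem {i j : ℤ} {m : M} (h : m ∈ M.grading j) (hij : j = i + 1) :
    cSh f m ∈ (cone f).grading i := by
  have := (add_mem_cone_grading f (i := i) (n := 0) (m := m)).2 ⟨Submodule.zero_mem _, hij ▸ h⟩
  rwa [map_zero, zero_add] at this

/-- The linear map out of a cone which is `g` on `N` and `h` on `M`. -/
def coneDesc {P : Type*} [AddCommGroup P] [Module k P] (g : N →ₗ[k] P) (h : M →ₗ[k] P) :
    cone f →ₗ[k] P := LinearMap.coprod g (h ∘ₗ (M.toShift 1).symm.toLinearMap)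

section

variable {P : Type*} [AddCommGroup P] [Module k P] (g : N →ₗ[k] P) (h : M →ₗ[k] P)

@[simp] lemma coneDesc_cIn (n : N) : coneDesc f g h (cIn f n) = g n := by
  change g n + h 0 = g n
  rw [map_zero, add_zero]

@[simp] lemma coneDesc_cSh (m : M) : coneDesc f g h (cSh f m) = h m := by
  change g 0 + h m = h m
  rw [map_zero, zero_add]

lemma cone_lin_ext {φ ψ : cone f →ₗ[k] P} (h₁ : ∀ n, φ (cIn f n) = ψ (cIn f n))
    (h₂ : ∀ m, φ (cSh f m) = ψ (cSh f m)) : φ = ψ := by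
  ext x
  obtain ⟨n, m, rfl⟩ := exists_eq_cIn_add_cSh f x
  rw [map_add, map_add, h₁, h₂]

end

/-- A morphism out of the cone of `f` is a morphism `g` out of `N` together with a null-homotopy
`h` of `f ≫ g`. -/
def coneDescHom {P : DGBimod A B} (g : N ⟶ P) (h : M →ₗ[k] P)
    (left : ∀ (a : A) (m : M), h (twist A.grading 1 a • m) = a • h m)
    (right : ∀ (b : B) (m : M), h (op b • m) = op b • h m)
    (mem : ∀ i, ∀ m ∈ M.grading (i + 1), h m ∈ P.grading i)
    (hd : ∀ m, P.d (h m) = lin g (lin f m) - h (M.d m)) : cone f ⟶ P :=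
  Hom.mk (coneDesc f (lin g) h)
    (fun a x => by
      obtain ⟨n, m, rfl⟩ := exists_eq_cIn_add_cSh f x
      rw [smul_add, map_add, map_add, smul_add, smul_cIn, smul_cSh, coneDesc_cIn, coneDesc_cIn,
        coneDesc_cSh, coneDesc_cSh, left, lin_map_smul])
    (fun b x => by
      obtain ⟨n, m, rfl⟩ := exists_eq_cIn_add_cSh f x
      rw [smul_add, map_add, map_add, smul_add, rsmul_cIn, rsmul_cSh, coneDesc_cIn, coneDesc_cIn,
        coneDesc_cSh, coneDesc_cSh, right, lin_map_rsmul])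
    (fun {i x} hx => by
      obtain ⟨n, m, rfl⟩ := exists_eq_cIn_add_cSh f x
      rw [add_mem_cone_grading] at hx
      rw [map_add, coneDesc_cIn, coneDesc_cSh]
      exact Submodule.add_mem _ (lin_mem g hx.1) (mem i m hx.2))
    (fun x => by
      obtain ⟨n, m, rfl⟩ := exists_eq_cIn_add_cSh f x
      simp only [map_add, d_cIn, d_cSh, map_sub, coneDesc_cIn, coneDesc_cSh, hd, lin_d])

variable {f} in
/-- The morphism of cones induced by a commutative square. -/
def coneMap {M' N' : DGBimod A B} {f' : M' ⟶ N'} (a : M ⟶ M') (b : N ⟶ N')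
    (w : f ≫ b = a ≫ f') : cone f ⟶ cone f' :=
  coneDescHom f (b ≫ coneIn f') (cSh f' ∘ₗ lin a)
    (fun x m => by
      rw [LinearMap.comp_apply, LinearMap.comp_apply, smul_cSh, lin_map_smul])
    (fun x m => by
      rw [LinearMap.comp_apply, LinearMap.comp_apply, rsmul_cSh, lin_map_rsmul])
    (fun i m hm => cSh_mem f' (lin_mem a hm) rfl)
    (fun m => by
      rw [LinearMap.comp_apply, LinearMap.comp_apply, d_cSh, lin_comp, lin_coneIn, ← lin_comp f b,
        w, lin_comp, lin_d])

section

variable {M' N' : DGBimod A B} {f' : M' ⟶ N'} (a : M ⟶ M') (b : N ⟶ N') (w : f ≫ b = a ≫ f')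

@[simp] lemma lin_coneMap_cIn (n : N) : lin (coneMap a b w) (cIn f n) = cIn f' (lin b n) :=
  coneDesc_cIn f _ _ n

@[simp] lemma lin_coneMap_cSh (m : M) : lin (coneMap a b w) (cSh f m) = cSh f' (lin a m) :=
  coneDesc_cSh f _ _ m

end

end

section

variable {M M' : DGBimod A B} (f : M ⟶ M') (N : DGBimod B C)

/-- The linear map from `M ⊗ N` to the summand `M[1] ⊗ N` of `cone f ⊗ N`. -/
def tensorConeLeftAux : tensorObj M N →ₗ[k] tensorObj (cone f) N :=
  tdesc (tm (cone f) N ∘ₗ cSh f) (fun b m n => by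
    rw [LinearMap.comp_apply, LinearMap.comp_apply, ← rsmul_cSh, tm_balanced])

lemma tensorConeLeftAux_tm (m : M) (n : N) : tensorConeLeftAux f N (tm M N m n) =
    tm (cone f) N (cSh f m) n := rfl

/-- The morphism `cone (f ⊗ N) → cone f ⊗ N`. -/
def tensorConeLeftInv : cone (tensorMap N f) ⟶ tensorObj (cone f) N :=
  coneDescHom _ (tensorMap N (coneIn f)) (tensorConeLeftAux f N)
    (fun a x => LinearMap.congr_fun (f := tensorConeLeftAux f N ∘ₗ
        (tensorObj M N).lact (twist A.grading 1 a))
      (g := (tensorObj (cone f) N).lact a ∘ₗ tensorConeLeftAux f N)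
      (tm_ext fun m n => congrArg (fun z => tm (cone f) N z n) (smul_cSh f a m).symm) x)
    (fun b x => LinearMap.congr_fun (f := tensorConeLeftAux f N ∘ₗ (tensorObj M N).ract b)
      (g := (tensorObj (cone f) N).ract b ∘ₗ tensorConeLeftAux f N)
      (tm_ext fun m n => rfl) x)
    (fun i x hx => tgrading_map (f := tensorConeLeftAux f N)
      (fun p q h m hm n hn => by
        have := tm_mem (cSh_mem f (i := p - 1) hm (by ring)) hn
        rwa [show p - 1 + q = i by omega] at this) hx)
    (fun x => LinearMap.congr_fun
      (f := (tensorObj (cone f) N).d ∘ₗ tensorConeLeftAux f N)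
      (g := lin (tensorMap N (coneIn f)) ∘ₗ lin (tensorMap N f) -
        tensorConeLeftAux f N ∘ₗ (tensorObj M N).d)
      (tm_gext fun i m hm j n hn => by
        rw [LinearMap.sub_apply, LinearMap.comp_apply, LinearMap.comp_apply, LinearMap.comp_apply,
          tensorConeLeftAux_tm, d_tm (cSh_mem f (i := i - 1) hm (by ring)), d_cSh,
          d_tm hm, map_add, map_smul, tensorConeLeftAux_tm, tensorConeLeftAux_tm,
          lin_tensorMap_tm, lin_tensorMap_tm, lin_coneIn, map_sub,
          ksign_sub_one, neg_smul, LinearMap.sub_apply]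
        abel) x)

lemma lin_tensorConeLeftInv_cIn (y : tensorObj M' N) :
    lin (tensorConeLeftInv f N) (cIn _ y) = lin (tensorMap N (coneIn f)) y := coneDesc_cIn _ _ _ y

lemma lin_tensorConeLeftInv_cSh (y : tensorObj M N) :
    lin (tensorConeLeftInv f N) (cSh _ y) = tensorConeLeftAux f N y := coneDesc_cSh _ _ _ y

/-- The inverse of `tensorConeLeftInv` as a linear map. -/
def tensorConeLeftHom : tensorObj (cone f) N →ₗ[k] cone (tensorMap N f) :=
  tdesc (coneDesc f ((tm M' N).compr₂ (cIn (tensorMap N f)))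
      ((tm M N).compr₂ (cSh (tensorMap N f))))
    (fun b x n => by
      obtain ⟨x, m, rfl⟩ := exists_eq_cIn_add_cSh f x
      simp only [smul_add, map_add, rsmul_cIn, rsmul_cSh, coneDesc_cIn, coneDesc_cSh,
        LinearMap.add_apply, LinearMap.compr₂_apply, tm_balanced])

lemma tensorConeLeftHom_tm_cIn (m : M') (n : N) :
    tensorConeLeftHom f N (tm (cone f) N (cIn f m) n) = cIn _ (tm M' N m n) :=
  LinearMap.congr_fun (coneDesc_cIn f _ _ m) n

lemma tensorConeLeftHom_tm_cSh (m : M) (n : N) :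
    tensorConeLeftHom f N (tm (cone f) N (cSh f m) n) = cSh _ (tm M N m n) :=
  LinearMap.congr_fun (coneDesc_cSh f _ _ m) n

/-- The isomorphism `cone f ⊗ N ≅ cone (f ⊗ N)`. -/
def tensorConeLeft : tensorObj (cone f) N ≅ cone (tensorMap N f) :=
  (isoOfInverse (tensorConeLeftInv f N) (tensorConeLeftHom f N)
    (fun x => LinearMap.congr_fun (f := tensorConeLeftHom f N ∘ₗ lin (tensorConeLeftInv f N))
      (g := LinearMap.id) (cone_lin_ext _
        (fun y => LinearMap.congr_fun (f := (tensorConeLeftHom f N ∘ₗ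
          lin (tensorConeLeftInv f N)) ∘ₗ cIn _) (g := cIn _) (tm_ext fun x n => by
            rw [LinearMap.comp_apply, LinearMap.comp_apply, lin_tensorConeLeftInv_cIn,
              lin_tensorMap_tm, lin_coneIn, tensorConeLeftHom_tm_cIn]) y)
        (fun y => LinearMap.congr_fun (f := (tensorConeLeftHom f N ∘ₗ
          lin (tensorConeLeftInv f N)) ∘ₗ cSh _) (g := cSh _) (tm_ext fun x n => by
            rw [LinearMap.comp_apply, LinearMap.comp_apply, lin_tensorConeLeftInv_cSh,
              tensorConeLeftAux_tm, tensorConeLeftHom_tm_cSh]) y)) x)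
    (fun x => LinearMap.congr_fun (f := lin (tensorConeLeftInv f N) ∘ₗ tensorConeLeftHom f N)
      (g := LinearMap.id) (tm_ext fun x n => by
        obtain ⟨x, m, rfl⟩ := exists_eq_cIn_add_cSh f x
        rw [LinearMap.comp_apply, map_add, LinearMap.add_apply, map_add, map_add,
          tensorConeLeftHom_tm_cIn, tensorConeLeftHom_tm_cSh, lin_tensorConeLeftInv_cIn,
          lin_tensorConeLeftInv_cSh, tensorConeLeftAux_tm, lin_tensorMap_tm, lin_coneIn,
          LinearMap.id_apply]) x)).symm

end

section

variable (M : DGBimod A B) {N N' : DGBimod B C} (g : N ⟶ N')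

/-- The linear map `m ⊗ n ↦ (-1)^{|m|} m ⊗ n` from `M ⊗ N` to the summand `M ⊗ N[1]` of
`M ⊗ cone g`. -/
def tensorConeRightAux : tensorObj M N →ₗ[k] tensorObj M (cone g) :=
  tdesc ((tm M (cone g) ∘ₗ twist M.grading 1).compl₂ (cSh g)) (fun b m n => by
    simp only [LinearMap.compl₂_apply, LinearMap.comp_apply]
    rw [twist_rsmul, tm_balanced, smul_cSh, twist_neg_twist])

lemma tensorConeRightAux_tm (m : M) (n : N) : tensorConeRightAux M g (tm M N m n) =
    tm M (cone g) (twist M.grading 1 m) (cSh g n) := rfl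

/-- The morphism `cone (M ⊗ g) → M ⊗ cone g`. -/
def tensorConeRightInv : cone (tensorMapRight M g) ⟶ tensorObj M (cone g) :=
  coneDescHom _ (tensorMapRight M (coneIn g)) (tensorConeRightAux M g)
    (fun a x => LinearMap.congr_fun (f := tensorConeRightAux M g ∘ₗ
        (tensorObj M N).lact (twist A.grading 1 a))
      (g := (tensorObj M (cone g)).lact a ∘ₗ tensorConeRightAux M g)
      (tm_ext fun m n => by
        change tm M (cone g) (twist M.grading 1 (twist A.grading 1 a • m)) (cSh g n) =
          tm M (cone g) (a • twist M.grading 1 m) (cSh g n)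
        rw [twist_smul, twist_neg_twist]) x)
    (fun b x => LinearMap.congr_fun (f := tensorConeRightAux M g ∘ₗ (tensorObj M N).ract b)
      (g := (tensorObj M (cone g)).ract b ∘ₗ tensorConeRightAux M g)
      (tm_ext fun m n => congrArg (tm M (cone g) (twist M.grading 1 m))
        (rsmul_cSh g (op b) n).symm) x)
    (fun i x hx => tgrading_map (f := tensorConeRightAux M g)
      (fun p q h m hm n hn => by
        have := tm_mem (twist_mem M.grading 1 hm) (cSh_mem g (i := q - 1) hn (by ring))
        rwa [show p + (q - 1) = i by omega] at this) hx)
    (fun x => LinearMap.congr_fun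
      (f := (tensorObj M (cone g)).d ∘ₗ tensorConeRightAux M g)
      (g := lin (tensorMapRight M (coneIn g)) ∘ₗ lin (tensorMapRight M g) -
        tensorConeRightAux M g ∘ₗ (tensorObj M N).d)
      (tm_gext fun i m hm j n hn => by
        rw [LinearMap.sub_apply, LinearMap.comp_apply, LinearMap.comp_apply, LinearMap.comp_apply,
          tensorConeRightAux_tm, d_tm (twist_mem M.grading 1 hm), d_cSh, d_tm hm, map_add,
          map_smul, tensorConeRightAux_tm, tensorConeRightAux_tm, lin_tensorMapRight_tm,
          lin_tensorMapRight_tm, lin_coneIn, map_sub, twist_of_mem _ _ hm,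
          twist_of_mem _ _ (M.d_mem hm), one_mul, one_mul, ksign_add, ksign_one]
        rw [show ksign k i * (-1) = - ksign k i by ring]
        simp only [map_smul, LinearMap.smul_apply, smul_sub, smul_smul, ksign_mul_self, one_smul,
          neg_smul, map_neg, LinearMap.neg_apply]
        abel) x)

lemma lin_tensorConeRightInv_cIn (y : tensorObj M N') :
    lin (tensorConeRightInv M g) (cIn _ y) = lin (tensorMapRight M (coneIn g)) y :=
  coneDesc_cIn _ _ _ y

lemma lin_tensorConeRightInv_cSh (y : tensorObj M N) :
    lin (tensorConeRightInv M g) (cSh _ y) = tensorConeRightAux M g y := coneDesc_cSh _ _ _ y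

/-- The inverse of `tensorConeRightInv` as a linear map. -/
def tensorConeRightHom : tensorObj M (cone g) →ₗ[k] cone (tensorMapRight M g) :=
  tdesc (LinearMap.flip (coneDesc g ((tm M N').compr₂ (cIn (tensorMapRight M g))).flip
      ((tm M N ∘ₗ twist M.grading 1).compr₂ (cSh (tensorMapRight M g))).flip))
    (fun b m x => by
      obtain ⟨x, n, rfl⟩ := exists_eq_cIn_add_cSh g x
      simp only [smul_add, map_add, smul_cIn, smul_cSh, coneDesc_cIn, coneDesc_cSh,
        LinearMap.compr₂_apply, LinearMap.flip_apply, tm_balanced, LinearMap.comp_apply,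
        twist_rsmul])

lemma tensorConeRightHom_tm_cIn (m : M) (n : N') :
    tensorConeRightHom M g (tm M (cone g) m (cIn g n)) = cIn _ (tm M N' m n) :=
  LinearMap.congr_fun (coneDesc_cIn g _ _ n) m

lemma tensorConeRightHom_tm_cSh (m : M) (n : N) :
    tensorConeRightHom M g (tm M (cone g) m (cSh g n)) =
      cSh _ (tm M N (twist M.grading 1 m) n) :=
  LinearMap.congr_fun (coneDesc_cSh g _ _ n) m

/-- The isomorphism `M ⊗ cone g ≅ cone (M ⊗ g)`. -/
def tensorConeRight : tensorObj M (cone g) ≅ cone (tensorMapRight M g) :=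
  (isoOfInverse (tensorConeRightInv M g) (tensorConeRightHom M g)
    (fun x => LinearMap.congr_fun (f := tensorConeRightHom M g ∘ₗ lin (tensorConeRightInv M g))
      (g := LinearMap.id) (cone_lin_ext _
        (fun y => LinearMap.congr_fun (f := (tensorConeRightHom M g ∘ₗ
          lin (tensorConeRightInv M g)) ∘ₗ cIn _) (g := cIn _) (tm_ext fun x n => by
            rw [LinearMap.comp_apply, LinearMap.comp_apply, lin_tensorConeRightInv_cIn,
              lin_tensorMapRight_tm, lin_coneIn, tensorConeRightHom_tm_cIn]) y)
        (fun y => LinearMap.congr_fun (f := (tensorConeRightHom M g ∘ₗ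
          lin (tensorConeRightInv M g)) ∘ₗ cSh _) (g := cSh _) (tm_ext fun x n => by
            rw [LinearMap.comp_apply, LinearMap.comp_apply, lin_tensorConeRightInv_cSh,
              tensorConeRightAux_tm, tensorConeRightHom_tm_cSh, twist_neg_twist]) y)) x)
    (fun x => LinearMap.congr_fun (f := lin (tensorConeRightInv M g) ∘ₗ tensorConeRightHom M g)
      (g := LinearMap.id) (tm_ext fun m x => by
        obtain ⟨x, n, rfl⟩ := exists_eq_cIn_add_cSh g x
        rw [LinearMap.comp_apply, map_add, map_add, map_add,
          tensorConeRightHom_tm_cIn, tensorConeRightHom_tm_cSh, lin_tensorConeRightInv_cIn,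
          lin_tensorConeRightInv_cSh, tensorConeRightAux_tm, lin_tensorMapRight_tm, lin_coneIn,
          twist_neg_twist, LinearMap.id_apply]) x)).symm

end

/-! ### Flatness -/

/-- `N` is flat as a left dg module: tensoring with `N` preserves acyclicity. -/
def LeftFlat (N : DGBimod B C) : Prop :=
  ∀ (A : DGAlg.{u} k) (M : DGBimod A B), Acyclic M → Acyclic (tensorObj M N)

/-- `M` is flat as a right dg module: tensoring with `M` preserves acyclicity. -/
def RightFlat (M : DGBimod A B) : Prop :=
  ∀ (C : DGAlg.{u} k) (N : DGBimod B C), Acyclic N → Acyclic (tensorObj M N)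

lemma LeftFlat.quasiIso_tensorMap {N : DGBimod B C} (hN : LeftFlat N) {M M' : DGBimod A B}
    (f : M ⟶ M') (hf : quasiIso A B f) : quasiIso A C (tensorMap N f) := by
  rw [quasiIso_iff_acyclic_cone] at hf ⊢
  exact (hN _ _ hf).of_iso (tensorConeLeft f N)

lemma RightFlat.quasiIso_tensorMapRight {M : DGBimod A B} (hM : RightFlat M)
    {N N' : DGBimod B C} (g : N ⟶ N') (hg : quasiIso B C g) :
    quasiIso A C (tensorMapRight M g) := by
  rw [quasiIso_iff_acyclic_cone] at hg ⊢
  exact (hM _ _ hg).of_iso (tensorConeRight M g)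

lemma LeftFlat.isExact {N : DGBimod B C} (hN : LeftFlat N) :
    IsExact (tensorFun N : DGBimod A B ⥤ DGBimod A C) where
  additive := inferInstance
  quasiIso_map f hf := hN.quasiIso_tensorMap f hf
  shift M n := ⟨tensorShiftLeft M N n⟩
  cone f := ⟨tensorConeLeft f N⟩

lemma RightFlat.isExact {M : DGBimod A B} (hM : RightFlat M) :
    IsExact (tensorLeftFun M : DGBimod B C ⥤ DGBimod A C) where
  additive := inferInstance
  quasiIso_map f hf := hM.quasiIso_tensorMapRight f hf
  shift N n := ⟨tensorShiftRight M N n⟩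
  cone f := ⟨tensorConeRight M f⟩

end DGBimod

/-! ### Forgetting one of the actions -/

namespace DGBimod

open DGAlg

variable {k : Type u} [Field k] {A B C E : DGAlg k}

lemma ground_smul (M : DGBimod (ground k) B) (c : ground k) (m : M) :
    c • m = (show k from c) • m := by
  have h : (show k from c) • (1 : ground k) = c := mul_one (show k from c)
  rw [← h, smul_assoc, one_smul, h]

lemma ground_rsmul (M : DGBimod A (ground k)) (c : ground k) (m : M) :
    op c • m = (show k from c) • m := by
  have h : (show k from c) • (op (1 : ground k)) = op c :=
    congrArg op (mul_one (show k from c))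
  rw [← h, smul_assoc, op_one, one_smul]

/-- The morphism of underlying right dg modules. -/
def forgetLeftMap {M N : DGBimod A B} (f : M ⟶ N) : M.forgetLeft ⟶ N.forgetLeft :=
  Hom.mk (M := M.forgetLeft) (N := N.forgetLeft) (lin f : M →ₗ[k] N)
    (fun c m => (lin f).map_smul c m)
    (fun b m => lin_map_rsmul f (op b) m) (fun h => lin_mem f h) (fun m => lin_d f m)

/-- The morphism of underlying left dg modules. -/
def forgetRightMap {M N : DGBimod A B} (f : M ⟶ N) : M.forgetRight ⟶ N.forgetRight :=
  Hom.mk (M := M.forgetRight) (N := N.forgetRight) (lin f : M →ₗ[k] N)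
    (fun a m => lin_map_smul f a m)
    (fun c m => (lin f).map_smul (show k from c) m) (fun h => lin_mem f h) (fun m => lin_d f m)

lemma quasiIso_forgetLeftMap {M N : DGBimod A B} {f : M ⟶ N} :
    quasiIso _ _ (forgetLeftMap f) ↔ quasiIso A B f := by
  rw [quasiIso_iff, quasiIso_iff]; rfl

lemma quasiIso_forgetRightMap {M N : DGBimod A B} {f : M ⟶ N} :
    quasiIso _ _ (forgetRightMap f) ↔ quasiIso A B f := by
  rw [quasiIso_iff, quasiIso_iff]; rfl

section

variable (M : DGBimod A B) (N : DGBimod B C)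

/-- The morphism underlying `forgetLeftTensor`. -/
def forgetLeftTensorHom : tensorObj M.forgetLeft N ⟶ (tensorObj M N).forgetLeft :=
  tHom (M := M.forgetLeft) (P := (tensorObj M N).forgetLeft) (tm M N)
    (fun b m n => tm_balanced (M := M) b m n)
    (fun c m n => LinearMap.congr_fun ((tm M N).map_smul (show k from c) m) n)
    (fun _ _ _ => rfl) (fun _ _ hm _ _ hn => tm_mem (M := M) hm hn)
    (fun _ _ hm _ n _ => d_tm (M := M) hm n)

/-- The inverse of `forgetLeftTensorHom` as a linear map. -/
def forgetLeftTensorInv : tensorObj M N →ₗ[k] tensorObj M.forgetLeft N :=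
  tdesc (M := M) (tm M.forgetLeft N) (fun b m n => tm_balanced (M := M.forgetLeft) b m n)

/-- Forgetting the left action commutes with tensor products. -/
def forgetLeftTensor : tensorObj M.forgetLeft N ≅ (tensorObj M N).forgetLeft :=
  isoOfInverse (forgetLeftTensorHom M N) (forgetLeftTensorInv M N)
    (fun x => LinearMap.congr_fun (f := forgetLeftTensorInv M N ∘ₗ
        (lin (forgetLeftTensorHom M N) : tensorObj M.forgetLeft N →ₗ[k] tensorObj M N))
      (g := LinearMap.id) (tm_ext (M := M.forgetLeft) fun _ _ => rfl) x)
    (fun x => LinearMap.congr_fun (f := (lin (forgetLeftTensorHom M N) :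
        tensorObj M.forgetLeft N →ₗ[k] tensorObj M N) ∘ₗ forgetLeftTensorInv M N)
      (g := LinearMap.id) (tm_ext (M := M) fun _ _ => rfl) x)

/-- The morphism underlying `forgetRightTensor`. -/
def forgetRightTensorHom : tensorObj M N.forgetRight ⟶ (tensorObj M N).forgetRight :=
  tHom (N := N.forgetRight) (P := (tensorObj M N).forgetRight) (tm M N)
    (fun b m n => tm_balanced (N := N) b m n) (fun _ _ _ => rfl)
    (fun c m n => (tm M N m).map_smul (show k from c) n)
    (fun _ _ hm _ _ hn => tm_mem (N := N) hm hn)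
    (fun _ _ hm _ n _ => d_tm (N := N) hm n)

/-- The inverse of `forgetRightTensorHom` as a linear map. -/
def forgetRightTensorInv : tensorObj M N →ₗ[k] tensorObj M N.forgetRight :=
  tdesc (N := N) (tm M N.forgetRight) (fun b m n => tm_balanced (N := N.forgetRight) b m n)

/-- Forgetting the right action commutes with tensor products. -/
def forgetRightTensor : tensorObj M N.forgetRight ≅ (tensorObj M N).forgetRight :=
  isoOfInverse (forgetRightTensorHom M N) (forgetRightTensorInv M N)
    (fun x => LinearMap.congr_fun
      (f := forgetRightTensorInv M N ∘ₗ
        (lin (forgetRightTensorHom M N) : tensorObj M N.forgetRight →ₗ[k] tensorObj M N))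
      (g := LinearMap.id) (tm_ext (N := N.forgetRight) fun _ _ => rfl) x)
    (fun x => LinearMap.congr_fun (f := (lin (forgetRightTensorHom M N) :
        tensorObj M N.forgetRight →ₗ[k] tensorObj M N) ∘ₗ forgetRightTensorInv M N)
      (g := LinearMap.id) (tm_ext (N := N) fun _ _ => rfl) x)

/-- Isomorphic dg bimodules have isomorphic underlying right dg modules. -/
def forgetLeftIso {M N : DGBimod A B} (e : M ≅ N) : M.forgetLeft ≅ N.forgetLeft where
  hom := forgetLeftMap e.hom
  inv := forgetLeftMap e.inv
  hom_inv_id := hom_ext fun (m : M) => hom_inv_lin e m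
  inv_hom_id := hom_ext fun (m : N) => inv_hom_lin e m

/-- Isomorphic dg bimodules have isomorphic underlying left dg modules. -/
def forgetRightIso {M N : DGBimod A B} (e : M ≅ N) : M.forgetRight ≅ N.forgetRight where
  hom := forgetRightMap e.hom
  inv := forgetRightMap e.inv
  hom_inv_id := hom_ext fun (m : M) => hom_inv_lin e m
  inv_hom_id := hom_ext fun (m : N) => inv_hom_lin e m

/-- The isomorphism `M ⊗_B B ≅ M`, where the right actions are forgotten. -/
def forgetRightUnit : tensorObj M (diag B).forgetRight ≅ M.forgetRight :=
  forgetRightTensor M (diag B) ≪≫ forgetRightIso (rightUnit M)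

/-- The isomorphism `B ⊗_B N ≅ N`, where the left actions are forgotten. -/
def forgetLeftUnit : tensorObj (diag B).forgetLeft N ≅ N.forgetLeft :=
  forgetLeftTensor (diag B) N ≪≫ forgetLeftIso (leftUnit N)

end

/-! ### Flatness over the ground field -/

/-- Over a field every acyclic complex is contractible. -/
lemma Acyclic.exists_contraction {M : DGBimod A B} (hM : Acyclic M) : ∃ s : M →ₗ[k] M,
    (∀ i, ∀ m ∈ M.grading i, s m ∈ M.grading (i - 1)) ∧ ∀ m, M.d (s m) + s (M.d m) = m := by
  obtain ⟨g, hg⟩ := M.d.rangeRestrict.exists_rightInverse_of_surjective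
    (LinearMap.range_rangeRestrict _)
  obtain ⟨t, ht⟩ := LinearMap.exists_extend g
  have hdt : ∀ m, M.d (t (M.d m)) = M.d m := fun m => by
    have h₁ : t (M.d m) = g (M.d.rangeRestrict m) :=
      LinearMap.congr_fun ht (M.d.rangeRestrict m)
    rw [h₁]
    exact congrArg Subtype.val (LinearMap.congr_fun hg (M.d.rangeRestrict m))
  -- the part of degree `-1` of the splitting `t` is again a splitting
  let t' : M →ₗ[k] M := gmap M.grading fun i => gproj M.grading (i - 1) ∘ₗ t
  have ht' : ∀ i, ∀ m ∈ M.grading i, t' m ∈ M.grading (i - 1) := fun i m hm => by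
    rw [gmap_of_mem _ _ hm]
    exact gproj_mem _ _ _
  have hdt' : ∀ m, M.d (t' (M.d m)) = M.d m := fun m => by
    refine LinearMap.congr_fun (f := M.d ∘ₗ t' ∘ₗ M.d) (gext M.grading fun i m hm => ?_) m
    rw [LinearMap.comp_apply, LinearMap.comp_apply, gmap_of_mem _ _ (M.d_mem hm),
      LinearMap.comp_apply, d_gproj, hdt, gproj_same _ (by simpa using M.d_mem hm)]
  refine ⟨t' - M.d ∘ₗ t' ∘ₗ t', fun i m hm => ?_, fun m => ?_⟩
  · refine Submodule.sub_mem _ (ht' i m hm) ?_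
    have := M.d_mem (ht' _ _ (ht' i m hm))
    rwa [sub_add_cancel] at this
  · obtain ⟨y, hy⟩ := hM (m - t' (M.d m)) (by rw [map_sub, hdt', sub_self])
    have := hdt' y
    rw [hy, map_sub, map_sub] at this
    simp only [LinearMap.sub_apply, LinearMap.comp_apply, map_sub, M.d_d, sub_zero]
    rw [add_sub_left_comm, this]
    abel

lemma leftFlat_ground_aux {M : DGBimod A (ground k)} (hM : Acyclic M)
    (N : DGBimod (ground k) C) : Acyclic (tensorObj M N) := fun x hx => by
  obtain ⟨s, hs, hd⟩ := hM.exists_contraction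
  have bal : ∀ (c : ground k) (m : M) (n : N), (tm M N ∘ₗ s) (op c • m) n =
      (tm M N ∘ₗ s) m (c • n) := fun c m n => by
    rw [ground_rsmul, ground_smul, map_smul, map_smul, LinearMap.smul_apply]
  refine ⟨tdesc (tm M N ∘ₗ s) bal x, ?_⟩
  have : (tensorObj M N).d ∘ₗ tdesc (tm M N ∘ₗ s) bal +
      tdesc (tm M N ∘ₗ s) bal ∘ₗ (tensorObj M N).d = LinearMap.id := by
    refine tm_gext fun i m hm j n hn => ?_
    rw [LinearMap.add_apply, LinearMap.comp_apply, LinearMap.comp_apply, d_tm hm, map_add,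
      map_smul, tdesc_tm, tdesc_tm, tdesc_tm, LinearMap.comp_apply, LinearMap.comp_apply,
      d_tm (hs i m hm), ksign_sub_one, neg_smul, LinearMap.id_apply]
    conv_rhs => rw [← hd m]
    rw [map_add, LinearMap.add_apply]
    abel
  have := LinearMap.congr_fun this x
  rwa [LinearMap.add_apply, LinearMap.comp_apply, LinearMap.comp_apply, hx, map_zero, add_zero]
    at this

lemma rightFlat_ground_aux (M : DGBimod A (ground k)) {N : DGBimod (ground k) C}
    (hN : Acyclic N) : Acyclic (tensorObj M N) := fun x hx => by
  obtain ⟨s, hs, hd⟩ := hN.exists_contraction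
  have bal : ∀ (c : ground k) (m : M) (n : N), ((tm M N ∘ₗ twist M.grading 1).compl₂ s)
      (op c • m) n = ((tm M N ∘ₗ twist M.grading 1).compl₂ s) m (c • n) := fun c m n => by
    rw [ground_rsmul, ground_smul, map_smul, map_smul, LinearMap.smul_apply]
  refine ⟨tdesc _ bal x, ?_⟩
  have : (tensorObj M N).d ∘ₗ tdesc _ bal + tdesc _ bal ∘ₗ (tensorObj M N).d =
      LinearMap.id := by
    refine tm_gext fun i m hm j n hn => ?_
    rw [LinearMap.add_apply, LinearMap.comp_apply, LinearMap.comp_apply, d_tm hm, map_add,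
      map_smul, tdesc_tm, tdesc_tm, tdesc_tm]
    simp only [LinearMap.compl₂_apply, LinearMap.comp_apply]
    rw [d_tm (twist_mem _ 1 hm), twist_of_mem _ _ hm, twist_of_mem _ _ (M.d_mem hm), one_mul,
      one_mul, ksign_add, ksign_one, show ksign k i * (-1) = - ksign k i by ring,
      LinearMap.id_apply]
    conv_rhs => rw [← hd n]
    simp only [map_smul, LinearMap.smul_apply, smul_smul, ksign_mul_self, one_smul, neg_smul,
      map_neg, LinearMap.neg_apply, map_add]
    abel
  have := LinearMap.congr_fun this x
  rwa [LinearMap.add_apply, LinearMap.comp_apply, LinearMap.comp_apply, hx, map_zero, add_zero]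
    at this

/-- Every complex of vector spaces with a right action is flat over the ground field. -/
lemma leftFlat_of_ground (N : DGBimod (ground k) C) : LeftFlat N :=
  fun _ _ hM => leftFlat_ground_aux hM N

/-- Every complex of vector spaces with a left action is flat over the ground field. -/
lemma rightFlat_of_ground (M : DGBimod A (ground k)) : RightFlat M :=
  fun _ _ hN => rightFlat_ground_aux M hN

lemma LeftFlat.tensorObj {M : DGBimod A B} {N : DGBimod B C} (hM : LeftFlat M)
    (hN : LeftFlat N) : LeftFlat (tensorObj M N) :=
  fun _ X hX => (hN _ _ (hM _ X hX)).of_iso (assoc X M N)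

lemma RightFlat.tensorObj {M : DGBimod A B} {N : DGBimod B C} (hM : RightFlat M)
    (hN : RightFlat N) : RightFlat (tensorObj M N) :=
  fun _ X hX => (hM _ _ (hN _ X hX)).of_iso (assoc M N X).symm

lemma leftFlat_forgetRight_diag (A : DGAlg k) : LeftFlat (diag A).forgetRight :=
  fun _ M hM => Acyclic.of_iso (M := M.forgetRight) (forgetRightUnit M).symm hM

lemma rightFlat_forgetLeft_diag (B : DGAlg k) : RightFlat (diag B).forgetLeft :=
  fun _ N hN => Acyclic.of_iso (M := N.forgetLeft) (forgetLeftUnit N).symm hN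

lemma acyclic_cone {M N : DGBimod A B} (f : M ⟶ N) (hM : Acyclic M) (hN : Acyclic N) :
    Acyclic (cone f) := by
  rw [← quasiIso_iff_acyclic_cone, quasiIso_iff]
  exact ⟨fun m _ hm _ => hM m hm, fun n hn => by
    obtain ⟨n', hn'⟩ := hN n hn
    exact ⟨0, -n', map_zero _, by rw [map_neg, hn', map_zero, add_neg_cancel]⟩⟩

lemma LeftFlat.cone {M N : DGBimod A B} (f : M ⟶ N) (hM : LeftFlat M) (hN : LeftFlat N) :
    LeftFlat (cone f) := fun _ X hX =>
  (acyclic_cone (tensorMapRight X f) (hM _ X hX) (hN _ X hX)).of_iso (tensorConeRight X f).symm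

lemma RightFlat.cone {M N : DGBimod A B} (f : M ⟶ N) (hM : RightFlat M) (hN : RightFlat N) :
    RightFlat (cone f) := fun _ X hX =>
  (acyclic_cone (tensorMap X f) (hM _ X hX) (hN _ X hX)).of_iso (tensorConeLeft f X).symm

end DGBimod

/-! ### Free dg bimodules -/

lemma DGAlg.one_mem {k : Type u} [Field k] (A : DGAlg k) : (1 : A) ∈ A.grading 0 :=
  SetLike.GradedOne.one_mem (A := A.grading)

namespace DGBimod

open DGAlg

variable {k : Type u} [Field k] {A B C E : DGAlg k}

section

variable {I : Type u} (deg : I → ℤ)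

/-- The component of degree `n` of the graded vector space with basis `I`. -/
def basisGrading (n : ℤ) : Submodule k (I →₀ k) := Finsupp.supported k k (deg ⁻¹' {n})

lemma basisGrading_isInternal : DirectSum.IsInternal (basisGrading (k := k) deg) := by
  classical
  refine isInternal_of_proj _ (fun n => (Finsupp.supported k k (deg ⁻¹' {n})).subtype ∘ₗ
    Finsupp.restrictDom k k (deg ⁻¹' {n})) ?_ ?_ ?_
  · intro n v hv
    rw [LinearMap.comp_apply, Submodule.subtype_apply, Finsupp.restrictDom_apply,
      Finsupp.filter_eq_self_iff]
    exact fun i hi => hv (Finsupp.mem_support_iff.2 hi)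
  · intro n l h v hv
    rw [LinearMap.comp_apply, Submodule.subtype_apply, Finsupp.restrictDom_apply,
      Finsupp.filter_eq_zero_iff]
    intro i hi
    by_contra h'
    exact h ((show deg i = n from hv (Finsupp.mem_support_iff.2 h')).symm.trans hi)
  · rw [eq_top_iff]
    rintro v -
    induction v using Finsupp.induction_linear with
    | zero => exact Submodule.zero_mem _
    | add v w hv hw => exact Submodule.add_mem _ hv hw
    | single i c =>
      exact Submodule.mem_iSup_of_mem (deg i) (Finsupp.single_mem_supported k c rfl)

/-- The graded vector space with basis `I`, where `i` has degree `deg i`, with zero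
differential. -/
def basisObj : DGBimod (ground k) (ground k) :=
  letI i₁ : Module (ground k) (I →₀ k) := inferInstanceAs (Module k (I →₀ k))
  letI i₂ : Module (ground k)ᵐᵒᵖ (I →₀ k) :=
    Module.compHom (I →₀ k) ((RingEquiv.toOpposite k).symm : kᵐᵒᵖ →+* k)
  { carrier := I →₀ k
    left := i₁
    right := i₂
    tower_left := inferInstanceAs (IsScalarTower k k (I →₀ k))
    tower_right := ⟨fun x c v => mul_smul x (show k from unop c) v⟩
    comm := ⟨fun a c v => smul_comm (show k from a) (show k from unop c) v⟩
    grading := basisGrading deg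
    isInternal := basisGrading_isInternal deg
    smul_mem := fun {i j c m} hc hm => by
      rcases ground_mem hc with rfl | h
      · rw [zero_add]
        exact Submodule.smul_mem (basisGrading deg j) (show k from c) hm
      · rw [h, zero_smul]
        exact Submodule.zero_mem _
    rsmul_mem := fun {i j m c} hm hc => by
      rcases ground_mem hc with rfl | h
      · rw [add_zero]
        exact Submodule.smul_mem (basisGrading deg i) (show k from c) hm
      · rw [h, MulOpposite.op_zero, zero_smul]
        exact Submodule.zero_mem _
    d := 0
    d_mem := fun _ => Submodule.zero_mem _
    d_d := fun _ => rfl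
    d_smul := fun {i c} _ m => by
      rw [show (ground k).d c = 0 from rfl, zero_smul]
      simp
    d_rsmul := fun {i m} _ c => by
      rw [show (ground k).d c = 0 from rfl, MulOpposite.op_zero]
      simp }

/-- The basis element of `basisObj deg` with index `i`. -/
def basisEl (i : I) : (basisObj deg : DGBimod (ground k) (ground k)) :=
  Finsupp.single i (1 : k)

lemma basisEl_mem (i : I) : basisEl deg i ∈ (basisObj (k := k) deg).grading (deg i) :=
  Finsupp.single_mem_supported k (1 : k) rfl

variable (A B)

/-- The free dg bimodule on closed generators `e i` of degrees `deg i`. -/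
def cell : DGBimod A B :=
  tensorObj (tensorObj (diag A).forgetRight (basisObj deg)) (diag B).forgetLeft

/-- The bilinear map `(a, b) ↦ a e_i b` with values in the free dg bimodule. -/
def el (i : I) : A →ₗ[k] B →ₗ[k] cell A B deg :=
  tm (tensorObj (diag A).forgetRight (basisObj deg)) (diag B).forgetLeft ∘ₗ
    (tm (diag A).forgetRight (basisObj deg)).flip (basisEl deg i)

variable {A B}

lemma smul_el (i : I) (a a' : A) (b : B) : a • el A B deg i a' b = el A B deg i (a * a') b := rfl

lemma rsmul_el (i : I) (a : A) (b b' : B) :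
    op b' • el A B deg i a b = el A B deg i a (b * b') := rfl

lemma el_mem (i : I) {p q : ℤ} {a : A} (ha : a ∈ A.grading p) {b : B} (hb : b ∈ B.grading q) :
    el A B deg i a b ∈ (cell A B deg).grading (p + deg i + q) :=
  tm_mem (tm_mem (M := (diag A).forgetRight) ha (basisEl_mem deg i))
    (N := (diag B).forgetLeft) hb

lemma d_el (i : I) {p : ℤ} {a : A} (ha : a ∈ A.grading p) (b : B) :
    (cell A B deg).d (el A B deg i a b) =
      el A B deg i (A.d a) b + ksign k (p + deg i) • el A B deg i a (B.d b) := by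
  refine (d_tm (tm_mem (M := (diag A).forgetRight) ha (basisEl_mem deg i)) _).trans ?_
  congr 1
  refine LinearMap.congr_fun (congrArg _ ((d_tm (M := (diag A).forgetRight) ha _).trans ?_)) b
  rw [show (basisObj (k := k) deg).d (basisEl deg i) = 0 from rfl, map_zero, smul_zero, add_zero]
  rfl

lemma d_el_one (i : I) : (cell A B deg).d (el A B deg i 1 1) = 0 := by
  rw [d_el deg i (A.one_mem), A.d_one, B.d_one]
  simp

lemma el_one_mem (i : I) : el A B deg i 1 1 ∈ (cell A B deg).grading (deg i) := by
  have := el_mem deg i (A.one_mem)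
    (B.one_mem)
  rwa [zero_add, add_zero] at this

variable {P : Type u} [AddCommGroup P] [Module k P]

/-- Linear maps out of a free dg bimodule agree if they agree on homogeneous `a e_i b`. -/
lemma cell_gext {f g : cell A B deg →ₗ[k] P} (h : ∀ p, ∀ a ∈ A.grading p, ∀ i, ∀ q,
    ∀ b ∈ B.grading q, f (el A B deg i a b) = g (el A B deg i a b)) : f = g := by
  refine tm_gext fun _ y _ q b hb => ?_
  refine LinearMap.congr_fun (f := f ∘ₗ (tm _ (diag B).forgetLeft).flip b)
    (g := g ∘ₗ (tm _ (diag B).forgetLeft).flip b) (tm_gext fun p a ha _ v _ => ?_) y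
  refine LinearMap.congr_fun (f := (f ∘ₗ (tm _ (diag B).forgetLeft).flip b) ∘ₗ
    (tm (diag A).forgetRight (basisObj deg) a))
    (g := (g ∘ₗ (tm _ (diag B).forgetLeft).flip b) ∘ₗ
    (tm (diag A).forgetRight (basisObj deg) a)) ?_ v
  exact Finsupp.lhom_ext' fun i => LinearMap.ext_ring (h p a ha i q b hb)

lemma cell_ext {f g : cell A B deg →ₗ[k] P}
    (h : ∀ a i b, f (el A B deg i a b) = g (el A B deg i a b)) : f = g :=
  cell_gext deg fun _ a _ i _ b _ => h a i b

/-- A linear map which sends the homogeneous `a e_i b` of degree `n` to a submodule sends the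
component of degree `n` to it. -/
lemma cell_map_mem {f : cell A B deg →ₗ[k] P} {n : ℤ} {S : Submodule k P}
    (h : ∀ p, ∀ a ∈ A.grading p, ∀ i, ∀ q, ∀ b ∈ B.grading q, p + deg i + q = n →
      f (el A B deg i a b) ∈ S) {x : cell A B deg} (hx : x ∈ (cell A B deg).grading n) :
    f x ∈ S := by
  have : S.mkQ ∘ₗ f ∘ₗ gproj (cell A B deg).grading n = 0 := by
    refine cell_gext deg fun p a ha i q b hb => ?_
    rw [LinearMap.comp_apply, LinearMap.comp_apply, LinearMap.zero_apply]
    by_cases hn : p + deg i + q = n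
    · rw [gproj_same _ (hn ▸ el_mem deg i ha hb)]
      exact (Submodule.Quotient.mk_eq_zero S).2 (h p a ha i q b hb hn)
    · rw [gproj_other _ hn (el_mem deg i ha hb), map_zero, map_zero]
  have := LinearMap.congr_fun this x
  rw [LinearMap.comp_apply, LinearMap.comp_apply, gproj_same _ hx] at this
  exact (Submodule.Quotient.mk_eq_zero S).1 this

end

section

variable {I : Type u} (deg : I → ℤ) {P : DGBimod A B} (n : ℤ) (x : I → P)

/-- The linear map `a ⊗ v ↦ (-1)^{n|a|} a x_v`. -/
def cellLinAux : tensorObj (diag A).forgetRight (basisObj deg) →ₗ[k] P :=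
  tdesc ((P.lact ∘ₗ twist A.grading n).compl₂ (Finsupp.linearCombination k x) :
      A →ₗ[k] (I →₀ k) →ₗ[k] P)
    (fun c (a : A) (v : I →₀ k) => by
      change twist A.grading n ((show k from c) • a) • Finsupp.linearCombination k x v =
        twist A.grading n a • Finsupp.linearCombination k x ((show k from c) • v)
      rw [map_smul, map_smul, smul_assoc, smul_comm])

/-- The linear map `a e_i b ↦ (-1)^{n|a|} a x_i b`. -/
def cellLin : cell A B deg →ₗ[k] P :=
  tdesc (N := (diag B).forgetLeft) (P.ract.flip ∘ₗ cellLinAux deg n x)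
    (fun c y (b : B) => by
      change op b • cellLinAux deg n x (op c • y) =
        op ((show k from c) • b) • cellLinAux deg n x y
      rw [ground_rsmul, map_smul, op_smul, smul_assoc, smul_comm])

lemma cellLin_el (i : I) (a : A) (b : B) :
    cellLin deg n x (el A B deg i a b) = op b • (twist A.grading n a • x i) := by
  change op b • (twist A.grading n a • Finsupp.linearCombination k x (Finsupp.single i 1)) = _
  rw [Finsupp.linearCombination_single, one_smul]

lemma cellLin_smul (a : A) (t : cell A B deg) :
    cellLin deg n x (a • t) = twist A.grading n a • cellLin deg n x t :=
  LinearMap.congr_fun (f := cellLin deg n x ∘ₗ (cell A B deg).lact a)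
    (g := P.lact (twist A.grading n a) ∘ₗ cellLin deg n x) (cell_ext deg fun a' i b => by
      simp only [LinearMap.comp_apply, lact_apply]
      rw [smul_el, cellLin_el, cellLin_el,
        show twist A.grading n (a * a') = twist A.grading n a * twist A.grading n a' from
          map_mul (A.twistHom n) a a', mul_smul,
        ← smul_comm (_ : A) (op b)]) t

lemma cellLin_rsmul (b : B) (t : cell A B deg) :
    cellLin deg n x (op b • t) = op b • cellLin deg n x t :=
  LinearMap.congr_fun (f := cellLin deg n x ∘ₗ (cell A B deg).ract b)
    (g := P.ract b ∘ₗ cellLin deg n x) (cell_ext deg fun a' i b' => by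
      simp only [LinearMap.comp_apply, ract_apply]
      rw [rsmul_el, cellLin_el, cellLin_el, op_mul, mul_smul]) t

lemma cellLin_mem {l : ℤ} (hx : ∀ i, x i ∈ P.grading (deg i + l)) {j : ℤ} {t : cell A B deg}
    (ht : t ∈ (cell A B deg).grading j) : cellLin deg n x t ∈ P.grading (j + l) := by
  refine cell_map_mem deg (fun p a ha i q b hb h => ?_) ht
  rw [cellLin_el]
  have := P.rsmul_mem (P.smul_mem (twist_mem _ n ha) (hx i)) hb
  rwa [show p + (deg i + l) + q = j + l by omega] at this

/-- The differential of `cellLin`, for generators `x i` of degree `deg i - n`. -/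
lemma d_cellLin (hx : ∀ i, x i ∈ P.grading (deg i - n)) (t : cell A B deg) :
    P.d (cellLin deg n x t) = cellLin deg (n + 1) (fun i => P.d (x i)) t +
      ksign k n • cellLin deg n x ((cell A B deg).d t) := by
  refine LinearMap.congr_fun (f := P.d ∘ₗ cellLin deg n x)
    (g := cellLin deg (n + 1) (fun i => P.d (x i)) +
      ksign k n • (cellLin deg n x ∘ₗ (cell A B deg).d))
    (cell_gext deg fun p a ha i q b hb => ?_) t
  simp only [LinearMap.comp_apply, LinearMap.add_apply, LinearMap.smul_apply]
  rw [d_el deg i ha, map_add, map_smul, cellLin_el, cellLin_el, cellLin_el, cellLin_el,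
    P.d_rsmul (P.smul_mem (twist_mem _ n ha) (hx i)), P.d_smul (twist_mem _ n ha),
    twist_of_mem _ _ ha, twist_of_mem _ _ ha, twist_of_mem _ _ (A.d_mem ha), A.d.map_smul]
  have h₁ : ksign k n * ksign k (n * (p + 1)) = ksign k (n * p) := by
    rw [mul_add, mul_one, ksign_add, mul_left_comm, ksign_mul_self, mul_one]
  have h₂ : ksign k n * (ksign k (p + deg i) * ksign k (n * p)) =
      ksign k (p + (deg i - n)) * ksign k (n * p) := by
    rw [← mul_assoc, ← ksign_add]
    congr 1
    rw [show n + (p + deg i) = p + (deg i - n) + (n + n) by ring, ksign_add _ (n + n), ksign_add n,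
      ksign_mul_self, mul_one]
  have h₃ : ksign k p * ksign k (n * p) = ksign k ((n + 1) * p) := by
    rw [← ksign_add]; congr 1; ring
  simp only [smul_assoc, smul_add, smul_smul, smul_comm (op b) (_ : k),
    smul_comm (op (B.d b)) (_ : k), h₁, h₂, h₃]
  abel

lemma cellLin_two : cellLin deg (1 + 1) x = cellLin deg 0 x :=
  cell_gext deg fun p a ha i q b hb => by
    rw [cellLin_el, cellLin_el, twist_zero, twist_of_mem _ _ ha, add_mul, ksign_add,
      ksign_mul_self, one_smul]

/-- The morphism out of a free dg bimodule sending the generators to given cocycles. -/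
def cellHom (hx : ∀ i, x i ∈ P.grading (deg i)) (hd : ∀ i, P.d (x i) = 0) : cell A B deg ⟶ P :=
  Hom.mk (cellLin deg 0 x)
    (fun a t => by rw [cellLin_smul, twist_zero])
    (fun b t => cellLin_rsmul deg 0 x b t)
    (fun {j t} ht => by
      have := cellLin_mem deg 0 x (l := 0) (by simpa using hx) ht
      rwa [add_zero] at this)
    (fun t => by
      rw [d_cellLin deg 0 x (by simpa using hx), ksign_zero, one_smul]
      refine (add_eq_right.2 (LinearMap.congr_fun (f := cellLin deg (0 + 1) _) (g := 0)
        (cell_ext deg fun a i b => ?_) t)).symm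
      rw [cellLin_el, hd, smul_zero, smul_zero, LinearMap.zero_apply])

lemma lin_cellHom_el (hx) (hd) (i : I) (a : A) (b : B) :
    lin (cellHom deg x hx hd) (el A B deg i a b) = op b • (a • x i) :=
  (cellLin_el deg 0 x i a b).trans (by rw [twist_zero])

end

lemma leftFlat_cell {I : Type u} (deg : I → ℤ) : LeftFlat (cell A B deg) :=
  ((leftFlat_forgetRight_diag A).tensorObj (leftFlat_of_ground _)).tensorObj
    (leftFlat_of_ground _)

lemma rightFlat_cell {I : Type u} (deg : I → ℤ) : RightFlat (cell A B deg) :=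
  (rightFlat_of_ground _).tensorObj (rightFlat_forgetLeft_diag B)

section

variable (A B)

/-- The morphism of free dg bimodules induced by a map of generators. -/
def cellMap {I J : Type u} {deg : I → ℤ} {deg' : J → ℤ} (u : I → J)
    (hu : ∀ i, deg' (u i) = deg i) : cell A B deg ⟶ cell A B deg' :=
  cellHom deg (fun i => el A B deg' (u i) 1 1) (fun i => hu i ▸ el_one_mem deg' (u i))
    (fun i => d_el_one deg' (u i))

lemma lin_cellMap_el {I J : Type u} {deg : I → ℤ} {deg' : J → ℤ} (u : I → J)
    (hu : ∀ i, deg' (u i) = deg i) (i : I) (a : A) (b : B) :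
    lin (cellMap A B u hu) (el A B deg i a b) = el A B deg' (u i) a b := by
  rw [cellMap, lin_cellHom_el, smul_el, rsmul_el, mul_one, one_mul]

/-- Morphisms of free dg bimodules induced by injections are injective. -/
lemma lin_cellMap_injective {I J : Type u} {deg : I → ℤ} {deg' : J → ℤ} (u : I → J)
    (hu : ∀ i, deg' (u i) = deg i) (hinj : Function.Injective u) :
    Function.Injective (lin (cellMap A B u hu)) := by
  classical
  let r : cell A B deg' →ₗ[k] cell A B deg :=
    cellLin deg' 0 fun j => if h : ∃ i, u i = j then el A B deg h.choose 1 1 else 0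
  refine Function.LeftInverse.injective (g := r) fun t => LinearMap.congr_fun
    (f := r ∘ₗ lin (cellMap A B u hu)) (g := LinearMap.id) (cell_ext deg fun a i b => ?_) t
  have h : ∃ i', u i' = u i := ⟨i, rfl⟩
  have hi : h.choose = i := hinj h.choose_spec
  rw [LinearMap.comp_apply, lin_cellMap_el, cellLin_el, dif_pos h, hi, twist_zero, smul_el,
    rsmul_el, mul_one, one_mul, LinearMap.id_apply]

/-- Free dg bimodules on equivalent sets of generators are isomorphic. -/
def cellCongr {I J : Type u} {deg : I → ℤ} {deg' : J → ℤ} (u : I ≃ J)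
    (hu : ∀ i, deg' (u i) = deg i) : cell A B deg ≅ cell A B deg' where
  hom := cellMap A B u hu
  inv := cellMap A B u.symm fun j => by rw [← hu, u.apply_symm_apply]
  hom_inv_id := lin_injective (cell_ext deg fun a i b => by
    rw [lin_comp, lin_cellMap_el, lin_cellMap_el, u.symm_apply_apply, lin_id])
  inv_hom_id := lin_injective (cell_ext deg' fun a i b => by
    rw [lin_comp, lin_cellMap_el, lin_cellMap_el, u.apply_symm_apply, lin_id])

variable {I : Type u} (deg : Option I → ℤ)

/-- The comparison morphism which adds one generator to a free dg bimodule. -/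
def cellOptionHom :
    cone (0 : cell A B (fun i : I => deg (some i) + 1) ⟶
      cell A B (fun _ : PUnit.{u + 1} => deg none)) ⟶ cell A B deg :=
  coneDescHom _ (cellMap A B (fun _ => none) fun _ => rfl)
    (cellLin _ 1 fun i => el A B deg (some i) 1 1)
    (fun a m => by rw [cellLin_smul, twist_neg_twist])
    (fun b m => cellLin_rsmul _ _ _ b m)
    (fun i m hm => by
      have := cellLin_mem _ 1 (fun i => el A B deg (some i) 1 1) (l := -1)
        (fun i => by simpa using el_one_mem deg (some i)) hm
      rwa [add_neg_cancel_right] at this)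
    (fun m => by
      rw [d_cellLin _ 1 _ fun i => by simpa using el_one_mem deg (some i), ksign_one,
        neg_one_smul, lin_zero, LinearMap.zero_apply, map_zero, ← sub_eq_add_neg]
      congr 1
      refine LinearMap.congr_fun (f := cellLin _ (1 + 1) _) (g := 0) (cell_ext _ fun a i b => ?_) m
      rw [cellLin_el, d_el_one, smul_zero, smul_zero, LinearMap.zero_apply])

lemma lin_cellOptionHom_cIn (y) : lin (cellOptionHom A B deg) (cIn _ y) =
    lin (cellMap A B (fun _ => none) fun _ => rfl) y := coneDesc_cIn _ _ _ y

lemma lin_cellOptionHom_cSh (y) : lin (cellOptionHom A B deg) (cSh _ y) =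
    cellLin _ 1 (fun i => el A B deg (some i) 1 1) y := coneDesc_cSh _ _ _ y

/-- The inverse of `cellOptionHom` as a linear map. -/
def cellOptionInv : cell A B deg →ₗ[k]
    cone (0 : cell A B (fun i : I => deg (some i) + 1) ⟶
      cell A B (fun _ : PUnit.{u + 1} => deg none)) :=
  cellLin deg 0 fun i => i.elim (cIn _ (el A B _ PUnit.unit 1 1)) fun i =>
    cSh _ (el A B _ i 1 1)

/-- A free dg bimodule with one more generator is a cone of free dg bimodules. -/
def cellOption : cone (0 : cell A B (fun i : I => deg (some i) + 1) ⟶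
      cell A B (fun _ : PUnit.{u + 1} => deg none)) ≅ cell A B deg :=
  isoOfInverse (cellOptionHom A B deg) (cellOptionInv A B deg)
    (fun x => LinearMap.congr_fun (f := cellOptionInv A B deg ∘ₗ lin (cellOptionHom A B deg))
      (g := LinearMap.id) (cone_lin_ext _
        (fun y => LinearMap.congr_fun (f := (cellOptionInv A B deg ∘ₗ
          lin (cellOptionHom A B deg)) ∘ₗ cIn _) (g := cIn _) (cell_ext _ fun a i b => by
            rw [LinearMap.comp_apply, LinearMap.comp_apply, lin_cellOptionHom_cIn,
              lin_cellMap_el, cellOptionInv, cellLin_el, twist_zero, Option.elim_none, smul_cIn,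
              rsmul_cIn, smul_el, rsmul_el, mul_one, one_mul]) y)
        (fun y => LinearMap.congr_fun (f := (cellOptionInv A B deg ∘ₗ
          lin (cellOptionHom A B deg)) ∘ₗ cSh _) (g := cSh _) (cell_ext _ fun a i b => by
            rw [LinearMap.comp_apply, LinearMap.comp_apply, lin_cellOptionHom_cSh,
              cellLin_el, smul_el, rsmul_el, mul_one, one_mul, cellOptionInv, cellLin_el,
              twist_zero, Option.elim_some, smul_cSh, rsmul_cSh, twist_neg_twist, smul_el,
              rsmul_el, mul_one, one_mul]) y)) x)
    (fun x => LinearMap.congr_fun (f := lin (cellOptionHom A B deg) ∘ₗ cellOptionInv A B deg)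
      (g := LinearMap.id) (cell_ext _ fun a i b => by
        rw [LinearMap.comp_apply, cellOptionInv, cellLin_el, twist_zero, LinearMap.id_apply,
          lin_map_rsmul, lin_map_smul]
        cases i with
        | none =>
          rw [Option.elim_none, lin_cellOptionHom_cIn, lin_cellMap_el, smul_el, rsmul_el, mul_one,
            one_mul]
        | some i =>
          rw [Option.elim_some, lin_cellOptionHom_cSh, cellLin_el, smul_el, rsmul_el, smul_el,
            rsmul_el,
            show twist A.grading 1 (1 : A) = 1 from map_one (A.twistHom 1), mul_one, mul_one,
            one_mul, one_mul]) x)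

lemma cell_subsingleton {I : Type u} [IsEmpty I] (deg : I → ℤ) : Subsingleton (cell A B deg) :=
  ⟨fun x y => LinearMap.congr_fun (f := LinearMap.id + (LinearMap.id : cell A B deg →ₗ[k] _))
    (g := LinearMap.id) (cell_ext deg fun _ i _ => isEmptyElim i) (x - y) |> fun h =>
      sub_eq_zero.1 (add_eq_right.1 h)⟩

end

section

variable (B : DGAlg k) (n : ℤ)

/-- The identity map from `B` to the underlying space of the right dg module `B[n]`. -/
def rightShift : B ≃ₗ[k] (diag B).forgetLeft.shiftObj n := (diag B).forgetLeft.toShift n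

/-- The identity map from `B` to the underlying space of the left dg module `B[n]`. -/
def leftShift : B ≃ₗ[k] (diag B).forgetRight.shiftObj n := (diag B).forgetRight.toShift n

lemma rsmul_rightShift (b b' : B) : op b' • rightShift B n b = rightShift B n (b * b') := rfl

lemma smul_leftShift (b b' : B) :
    b' • leftShift B n b = leftShift B n (twist B.grading n b' * b) := rfl

lemma rightShift_one_mem : rightShift B n 1 ∈ ((diag B).forgetLeft.shiftObj n).grading (-n) :=
  (toShift_mem (diag B).forgetLeft n).2 (by
    rw [neg_add_cancel]; exact B.one_mem)

lemma leftShift_one_mem : leftShift B n 1 ∈ ((diag B).forgetRight.shiftObj n).grading (-n) :=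
  (toShift_mem (diag B).forgetRight n).2 (by
    rw [neg_add_cancel]; exact B.one_mem)

lemma d_rightShift_one : ((diag B).forgetLeft.shiftObj n).d (rightShift B n 1) = 0 := by
  refine (d_toShift (diag B).forgetLeft n (1 : B)).trans ?_
  rw [show (diag B).forgetLeft.d (1 : B) = 0 from B.d_one, map_zero, smul_zero]

lemma d_leftShift_one : ((diag B).forgetRight.shiftObj n).d (leftShift B n 1) = 0 := by
  refine (d_toShift (diag B).forgetRight n (1 : B)).trans ?_
  rw [show (diag B).forgetRight.d (1 : B) = 0 from B.d_one, map_zero, smul_zero]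

/-- The morphism underlying `cellPointRight`. -/
def cellPointRightHom : cell (ground k) B (fun _ : PUnit.{u + 1} => -n) ⟶
    (diag B).forgetLeft.shiftObj n :=
  cellHom _ (fun _ => rightShift B n 1) (fun _ => rightShift_one_mem B n)
    (fun _ => d_rightShift_one B n)

lemma lin_cellPointRightHom_el (c : ground k) (i : PUnit) (b : B) :
    lin (cellPointRightHom B n) (el (ground k) B _ i c b) =
      (show k from c) • rightShift B n b := by
  rw [cellPointRightHom, lin_cellHom_el, ground_smul, ← map_smul, rsmul_rightShift,
    smul_mul_assoc, one_mul, map_smul]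

/-- The free right dg module on one generator is a shift of `B`. -/
def cellPointRight : cell (ground k) B (fun _ : PUnit.{u + 1} => -n) ≅
    (diag B).forgetLeft.shiftObj n :=
  isoOfInverse (cellPointRightHom B n)
    (el (ground k) B _ PUnit.unit (1 : ground k) ∘ₗ (rightShift B n).symm.toLinearMap)
    (fun t => LinearMap.congr_fun (f := (el (ground k) B _ PUnit.unit (1 : ground k) ∘ₗ
        (rightShift B n).symm.toLinearMap) ∘ₗ lin (cellPointRightHom B n))
        (g := LinearMap.id) (cell_ext _ fun c i b => by
      rw [LinearMap.comp_apply, lin_cellPointRightHom_el, map_smul, LinearMap.comp_apply,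
        LinearEquiv.coe_coe, LinearEquiv.symm_apply_apply, ← LinearMap.smul_apply, ← map_smul]
      exact congrArg (fun z => el (ground k) B _ PUnit.unit z b) (mul_one (show k from c))) t)
    (fun y => by
      obtain ⟨y, rfl⟩ := (rightShift B n).surjective y
      rw [LinearMap.comp_apply, LinearEquiv.coe_coe, LinearEquiv.symm_apply_apply,
        lin_cellPointRightHom_el]
      exact one_smul k _)

/-- The morphism underlying `cellPointLeft`. -/
def cellPointLeftHom : cell B (ground k) (fun _ : PUnit.{u + 1} => -n) ⟶
    (diag B).forgetRight.shiftObj n :=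
  cellHom _ (fun _ => leftShift B n 1) (fun _ => leftShift_one_mem B n)
    (fun _ => d_leftShift_one B n)

lemma lin_cellPointLeftHom_el (b : B) (i : PUnit) (c : ground k) :
    lin (cellPointLeftHom B n) (el B (ground k) _ i b c) =
      (show k from c) • leftShift B n (twist B.grading n b) := by
  rw [cellPointLeftHom, lin_cellHom_el, ground_rsmul, smul_leftShift, mul_one]

/-- The free left dg module on one generator is a shift of `B`. -/
def cellPointLeft : cell B (ground k) (fun _ : PUnit.{u + 1} => -n) ≅
    (diag B).forgetRight.shiftObj n :=
  isoOfInverse (cellPointLeftHom B n)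
    ((el B (ground k) _ PUnit.unit).flip (1 : ground k) ∘ₗ twist B.grading n ∘ₗ
      (leftShift B n).symm.toLinearMap)
    (fun t => LinearMap.congr_fun (f := ((el B (ground k) _ PUnit.unit).flip (1 : ground k) ∘ₗ
        twist B.grading n ∘ₗ (leftShift B n).symm.toLinearMap) ∘ₗ lin (cellPointLeftHom B n))
        (g := LinearMap.id) (cell_ext _ fun b i c => by
      rw [LinearMap.comp_apply, lin_cellPointLeftHom_el, map_smul, LinearMap.comp_apply,
        LinearMap.comp_apply, LinearEquiv.coe_coe, LinearEquiv.symm_apply_apply, twist_neg_twist,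
        LinearMap.flip_apply, ← map_smul]
      exact congrArg (fun z => el B (ground k) _ PUnit.unit b z) (mul_one (show k from c))) t)
    (fun y => by
      obtain ⟨y, rfl⟩ := (leftShift B n).surjective y
      rw [LinearMap.comp_apply, LinearMap.comp_apply, LinearEquiv.coe_coe,
        LinearEquiv.symm_apply_apply, LinearMap.flip_apply, lin_cellPointLeftHom_el,
        twist_neg_twist]
      exact one_smul k _)

end

/-! ### Finite cell modules -/

/-- A finite cell module is obtained from zero by attaching finitely many free dg bimodules of
finite rank, each by a morphism to what has been built before. -/
inductive FinCell : DGBimod A B → Prop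
  | zero (M : DGBimod A B) [Subsingleton M] : FinCell M
  | attach {I : Type u} [Finite I] (deg : I → ℤ) (M : DGBimod A B) (f : cell A B deg ⟶ M) :
    FinCell M → FinCell (cone f)

lemma quasiIso_of_acyclic {M N : DGBimod A B} (f : M ⟶ N) (hM : Acyclic M) (hN : Acyclic N) :
    quasiIso A B f := (quasiIso_iff_acyclic_cone f).2 (acyclic_cone f hM hN)

open DCat

lemma mem_thick_of_acyclic {P : ObjectProperty (DCat A B)} (hP : IsThick P) {X M : DGBimod A B}
    (hX : P ((Q A B).obj X)) (hM : Acyclic M) : P ((Q A B).obj M) := by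
  have h : Acyclic (cone (𝟙 X)) := (quasiIso_iff_acyclic_cone _).1 (quasiIso_of_isIso _)
  have := isIso_Q_map _ (quasiIso_of_acyclic (0 : cone (𝟙 X) ⟶ M) h hM)
  exact hP.iso (asIso ((Q A B).map (0 : cone (𝟙 X) ⟶ M))) (hP.cone_mem (𝟙 X) hX hX)

lemma acyclic_of_subsingleton (M : DGBimod A B) [Subsingleton M] : Acyclic M :=
  fun m _ => ⟨m, Subsingleton.elim _ _⟩

/-- A thick class containing the shifts of the free bimodule of rank one contains
all finite cell bimodules. -/
lemma FinCell.mem_thick {P : ObjectProperty (DCat A B)} (hP : IsThick P)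
    (hpt : ∀ n : ℤ, P ((Q A B).obj (cell A B (fun _ : PUnit.{u + 1} => n))))
    {M : DGBimod A B} (hM : FinCell M) : P ((Q A B).obj M) := by
  have hcell : ∀ (I : Type u) [Finite I] (deg : I → ℤ), P ((Q A B).obj (cell A B deg)) := by
    intro I _
    refine Finite.induction_empty_option
      (P := fun I : Type u => ∀ deg : I → ℤ, P ((Q A B).obj (cell A B deg))) ?_ ?_ ?_ I
    · intro I J e h deg
      exact hP.iso ((Q A B).mapIso (cellCongr A B e fun i => rfl)) (h fun i => deg (e i))
    · intro deg
      have := cell_subsingleton A B deg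
      exact mem_thick_of_acyclic hP (hpt 0) (acyclic_of_subsingleton _)
    · intro I _ h deg
      exact hP.iso ((Q A B).mapIso (cellOption A B deg)) (hP.cone_mem _ (h _) (hpt _))
  induction hM with
  | zero M => exact mem_thick_of_acyclic hP (hpt 0) (acyclic_of_subsingleton M)
  | attach deg M f _ ih => exact hP.cone_mem f (hcell _ deg) ih

lemma FinCell.perf {M : B.RMod} (hM : FinCell M) : B.Perf ((Q _ _).obj M) :=
  hM.mem_thick (thick_isThick _) fun n => by
    have e := cellPointRight B (-n)
    rw [neg_neg] at e
    exact (thick_isThick _).iso ((Q _ _).mapIso e.symm)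
      ((thick_isThick _).shift_mem _ (thick_self _))

lemma FinCell.perfOp {M : A.LMod} (hM : FinCell M) : A.PerfOp ((Q _ _).obj M) :=
  hM.mem_thick (thick_isThick _) fun n => by
    have e := cellPointLeft A (-n)
    rw [neg_neg] at e
    exact (thick_isThick _).iso ((Q _ _).mapIso e.symm)
      ((thick_isThick _).shift_mem _ (thick_self _))

end DGBimod

/-! ### Sequential colimits -/

namespace DGBimod

variable {k : Type u} [Field k] {A B C E : DGAlg k}

section

variable (F : ℕ ⥤ DGBimod A B)

/-- The transition morphisms of a sequence. -/
def seqTr (i j : ℕ) (h : i ≤ j) : F.obj i →ₗ[k] F.obj j := lin (F.map (homOfLE h))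

lemma seqTr_apply {i j : ℕ} (h : i ≤ j) (x : F.obj i) :
    seqTr F i j h x = lin (F.map (homOfLE h)) x := rfl

instance : DirectedSystem (fun i => F.obj i) (fun i j h => seqTr F i j h) where
  map_self i x := by
    rw [seqTr_apply, show homOfLE (le_refl i) = 𝟙 i from rfl, F.map_id]; rfl
  map_map k j i hij hjk x := by
    rw [seqTr_apply, seqTr_apply, seqTr_apply, ← lin_comp, ← F.map_comp]; rfl

/-- The underlying space of the colimit of a sequence. -/
def SeqCarrier : Type u := DirectLimit (fun i => F.obj i) (seqTr F)

instance : AddCommGroup (SeqCarrier F) :=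
  inferInstanceAs (AddCommGroup (DirectLimit (fun i => F.obj i) (seqTr F)))

instance : Module k (SeqCarrier F) :=
  inferInstanceAs (Module k (DirectLimit (fun i => F.obj i) (seqTr F)))

/-- The canonical map from a term of a sequence to the colimit. -/
def seqIn (n : ℕ) : F.obj n →ₗ[k] SeqCarrier F where
  toFun x := (⟦⟨n, x⟩⟧ : DirectLimit (fun i => F.obj i) (seqTr F))
  map_add' x y := (DirectLimit.add_def (G := fun i => (F.obj i).carrier) (f := seqTr F) n x y).symm
  map_smul' c x :=
    (DirectLimit.smul_def (G := fun i => (F.obj i).carrier) (f := seqTr F) n x c).symm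

variable {F}

lemma exists_seqIn (x : SeqCarrier F) : ∃ n y, x = seqIn F n y :=
  DirectLimit.exists_eq_mk (F := fun i => (F.obj i).carrier) (seqTr F) x

lemma seqIn_map {i j : ℕ} (h : i ≤ j) (x : F.obj i) :
    seqIn F j (lin (F.map (homOfLE h)) x) = seqIn F i x :=
  DirectLimit.mk_apply (F := fun i => (F.obj i).carrier) (f := seqTr F) i j x h

lemma exists_of_seqIn_eq {n : ℕ} {x y : F.obj n} (h : seqIn F n x = seqIn F n y) :
    ∃ (m : ℕ) (hm : n ≤ m), lin (F.map (homOfLE hm)) x = lin (F.map (homOfLE hm)) y := by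
  obtain ⟨m, h₁, _, h₂⟩ :=
    (Quotient.eq (r := DirectLimit.setoid (F := fun i => (F.obj i).carrier) (seqTr F))).1 h
  exact ⟨m, h₁, h₂⟩

/-- The linear map out of the colimit of a sequence induced by a compatible family. -/
def seqDesc {P : Type*} [AddCommGroup P] [Module k P] (g : ∀ n, F.obj n →ₗ[k] P)
    (hg : ∀ n x, g (n + 1) (lin (F.map (homOfLE n.le_succ)) x) = g n x) :
    SeqCarrier F →ₗ[k] P :=
  have hg' : ∀ i j (h : i ≤ j) (x : F.obj i), g i x = g j (seqTr F i j h x) := fun i j h => by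
    induction j, h using Nat.le_induction with
    | base =>
      intro x
      rw [seqTr_apply, show homOfLE (le_refl i) = 𝟙 i from rfl, F.map_id, lin_id]
    | succ j h ih =>
      intro x
      rw [ih, seqTr_apply, seqTr_apply, ← hg, ← lin_comp, ← F.map_comp]
      rfl
  { toFun := DirectLimit.lift (seqTr F) (fun n => g n) hg'
    map_add' := by
      refine DirectLimit.induction₂ _ fun i x y => ?_
      refine (congrArg (DirectLimit.lift (seqTr F) (fun n => g n) hg')
        (DirectLimit.add_def (G := fun i => (F.obj i).carrier) (f := seqTr F) i x y)).trans ?_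
      exact (g i).map_add x y
    map_smul' := fun c => by
      refine DirectLimit.induction _ fun i x => ?_
      exact (g i).map_smul c x }

lemma seqIn_comp_map (φ : ∀ n, F.obj n →ₗ[k] F.obj n)
    (hφ : ∀ {i j : ℕ} (f : i ⟶ j) (x : F.obj i), lin (F.map f) (φ i x) = φ j (lin (F.map f) x))
    (n : ℕ) (x : F.obj n) :
    (seqIn F (n + 1) ∘ₗ φ (n + 1)) (lin (F.map (homOfLE n.le_succ)) x) =
      (seqIn F n ∘ₗ φ n) x := by
  rw [LinearMap.comp_apply, ← hφ, seqIn_map, LinearMap.comp_apply]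

variable (F) in
/-- The left action on the colimit of a sequence. -/
def seqLact (a : A) : SeqCarrier F →ₗ[k] SeqCarrier F :=
  seqDesc (fun n => seqIn F n ∘ₗ (F.obj n).lact a)
    (seqIn_comp_map (fun n => (F.obj n).lact a) fun f x => lin_map_smul (F.map f) a x)

variable (F) in
/-- The right action on the colimit of a sequence. -/
def seqRact (b : B) : SeqCarrier F →ₗ[k] SeqCarrier F :=
  seqDesc (fun n => seqIn F n ∘ₗ (F.obj n).ract b)
    (seqIn_comp_map (fun n => (F.obj n).ract b) fun f x => lin_map_rsmul (F.map f) (op b) x)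

instance : SMul A (SeqCarrier F) := ⟨fun a x => seqLact F a x⟩

instance : SMul Bᵐᵒᵖ (SeqCarrier F) := ⟨fun b x => seqRact F (unop b) x⟩

lemma smul_seqIn (n : ℕ) (a : A) (x : F.obj n) : a • seqIn F n x = seqIn F n (a • x) := rfl

lemma rsmul_seqIn (n : ℕ) (b : Bᵐᵒᵖ) (x : F.obj n) : b • seqIn F n x = seqIn F n (b • x) := rfl

instance : Module A (SeqCarrier F) where
  one_smul x := by
    obtain ⟨n, x, rfl⟩ := exists_seqIn x
    rw [smul_seqIn, one_smul]
  mul_smul a b x := by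
    obtain ⟨n, x, rfl⟩ := exists_seqIn x
    rw [smul_seqIn, smul_seqIn, smul_seqIn, mul_smul]
  smul_zero a := map_zero (seqLact F a)
  smul_add a := map_add (seqLact F a)
  add_smul a b x := by
    obtain ⟨n, x, rfl⟩ := exists_seqIn x
    rw [smul_seqIn, smul_seqIn, smul_seqIn, add_smul, map_add]
  zero_smul x := by
    obtain ⟨n, x, rfl⟩ := exists_seqIn x
    rw [smul_seqIn, zero_smul, map_zero]

instance : Module Bᵐᵒᵖ (SeqCarrier F) where
  one_smul x := by
    obtain ⟨n, x, rfl⟩ := exists_seqIn x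
    rw [rsmul_seqIn, one_smul]
  mul_smul a b x := by
    obtain ⟨n, x, rfl⟩ := exists_seqIn x
    rw [rsmul_seqIn, rsmul_seqIn, rsmul_seqIn, mul_smul]
  smul_zero b := map_zero (seqRact F (unop b))
  smul_add b := map_add (seqRact F (unop b))
  add_smul a b x := by
    obtain ⟨n, x, rfl⟩ := exists_seqIn x
    rw [rsmul_seqIn, rsmul_seqIn, rsmul_seqIn, add_smul, map_add]
  zero_smul x := by
    obtain ⟨n, x, rfl⟩ := exists_seqIn x
    rw [rsmul_seqIn, zero_smul, map_zero]

instance : IsScalarTower k A (SeqCarrier F) := ⟨fun c a x => by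
  obtain ⟨n, x, rfl⟩ := exists_seqIn x
  rw [smul_seqIn, smul_seqIn, smul_assoc, map_smul]⟩

instance : IsScalarTower k Bᵐᵒᵖ (SeqCarrier F) := ⟨fun c b x => by
  obtain ⟨n, x, rfl⟩ := exists_seqIn x
  rw [rsmul_seqIn, rsmul_seqIn, smul_assoc, map_smul]⟩

instance : SMulCommClass A Bᵐᵒᵖ (SeqCarrier F) := ⟨fun a b x => by
  obtain ⟨n, x, rfl⟩ := exists_seqIn x
  rw [smul_seqIn, rsmul_seqIn, rsmul_seqIn, smul_seqIn, smul_comm]⟩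

variable (F)

/-- The component of degree `i` of the colimit of a sequence. -/
def seqGrading (i : ℤ) : Submodule k (SeqCarrier F) :=
  ⨆ n, ((F.obj n).grading i).map (seqIn F n)

variable {F}

lemma seqIn_mem' {n : ℕ} {i : ℤ} {x : F.obj n} (hx : x ∈ (F.obj n).grading i) :
    seqIn F n x ∈ seqGrading F i :=
  Submodule.mem_iSup_of_mem n ⟨x, hx, rfl⟩

lemma seqGrading_le {i : ℤ} {S : Submodule k (SeqCarrier F)}
    (h : ∀ n, ∀ x ∈ (F.obj n).grading i, seqIn F n x ∈ S) : seqGrading F i ≤ S :=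
  iSup_le fun n => by
    rintro _ ⟨x, hx, rfl⟩
    exact h n x hx

variable (F)

/-- The projection of the colimit of a sequence to the component of degree `i`. -/
def seqProj (i : ℤ) : SeqCarrier F →ₗ[k] SeqCarrier F :=
  seqDesc (fun n => seqIn F n ∘ₗ gproj (F.obj n).grading i) fun n x => by
    rw [LinearMap.comp_apply, ← lin_gproj, seqIn_map, LinearMap.comp_apply]

/-- The differential of the colimit of a sequence. -/
def seqD : SeqCarrier F →ₗ[k] SeqCarrier F :=
  seqDesc (fun n => seqIn F n ∘ₗ (F.obj n).d) fun n x => by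
    rw [LinearMap.comp_apply, ← lin_d, seqIn_map, LinearMap.comp_apply]

/-- The colimit of a sequence of dg bimodules. -/
def seqColim : DGBimod A B where
  carrier := SeqCarrier F
  grading := seqGrading F
  isInternal := isInternal_of_proj _ (seqProj F)
    (fun i x hx => seqGrading_le (S := LinearMap.eqLocus (seqProj F i) LinearMap.id)
      (fun n x hx => congrArg (seqIn F n) (gproj_same _ hx)) hx)
    (fun i j h x hx => seqGrading_le (S := LinearMap.ker (seqProj F j))
      (fun n x hx => (congrArg (seqIn F n) (gproj_other _ h hx)).trans (map_zero _)) hx)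
    (by
      rw [eq_top_iff]
      rintro x -
      obtain ⟨n, x, rfl⟩ := exists_seqIn x
      have h : (⊤ : Submodule k (F.obj n)) ≤ (⨆ i, seqGrading F i).comap (seqIn F n) := by
        rw [← (F.obj n).isInternal.submodule_iSup_eq_top]
        exact iSup_le fun i x hx => Submodule.mem_iSup_of_mem i (seqIn_mem' hx)
      exact h trivial)
  smul_mem := fun {i j a x} ha hx => seqGrading_le
    (S := (seqGrading F (i + j)).comap (DistribSMul.toLinearMap k _ a))
    (fun n x hx => by
      rw [Submodule.mem_comap]
      change a • seqIn F n x ∈ _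
      rw [smul_seqIn]
      exact seqIn_mem' ((F.obj n).smul_mem ha hx)) hx
  rsmul_mem := fun {i j x b} hx hb => seqGrading_le
    (S := (seqGrading F (i + j)).comap (DistribSMul.toLinearMap k _ (op b)))
    (fun n x hx => by
      rw [Submodule.mem_comap]
      change op b • seqIn F n x ∈ _
      rw [rsmul_seqIn]
      exact seqIn_mem' ((F.obj n).rsmul_mem hx hb)) hx
  d := seqD F
  d_mem := fun {i x} hx => seqGrading_le (S := (seqGrading F (i + 1)).comap (seqD F))
    (fun n x hx => seqIn_mem' ((F.obj n).d_mem hx)) hx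
  d_d := fun x => by
    obtain ⟨n, x, rfl⟩ := exists_seqIn x
    exact (congrArg (seqIn F n) ((F.obj n).d_d x)).trans (map_zero _)
  d_smul := fun {i a} ha x => by
    obtain ⟨n, x, rfl⟩ := exists_seqIn x
    rw [smul_seqIn]
    change seqIn F n ((F.obj n).d (a • x)) = A.d a • seqIn F n x +
      ksign k i • (a • seqIn F n ((F.obj n).d x))
    rw [(F.obj n).d_smul ha, smul_seqIn, smul_seqIn, map_add,
      (seqIn F n).map_smul]
  d_rsmul := fun {i x} hx b => by
    refine seqGrading_le (S := LinearMap.eqLocus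
      (seqD F ∘ₗ DistribSMul.toLinearMap k (SeqCarrier F) (op b))
      (DistribSMul.toLinearMap k _ (op b) ∘ₗ seqD F +
        ksign k i • DistribSMul.toLinearMap k _ (op (B.d b)))) (fun n x hx => ?_) hx
    change seqD F (op b • seqIn F n x) = op b • seqIn F n ((F.obj n).d x) +
      ksign k i • (op (B.d b) • seqIn F n x)
    rw [rsmul_seqIn]
    change seqIn F n ((F.obj n).d (op b • x)) = _
    rw [(F.obj n).d_rsmul hx, rsmul_seqIn, rsmul_seqIn, map_add,
      (seqIn F n).map_smul]

/-- The inclusion of a term of a sequence in its colimit. -/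
def seqι (n : ℕ) : F.obj n ⟶ seqColim F :=
  Hom.mk (M := F.obj n) (N := seqColim F) (seqIn F n) (fun a x => (smul_seqIn n a x).symm)
    (fun b x => (rsmul_seqIn n (op b) x).symm) (fun hx => seqIn_mem' hx) (fun _ => rfl)

variable {F}

lemma exists_seqι (x : seqColim F) : ∃ n y, x = lin (seqι F n) y := exists_seqIn x

lemma seqι_map {i j : ℕ} (h : i ≤ j) (x : F.obj i) :
    lin (seqι F j) (lin (F.map (homOfLE h)) x) = lin (seqι F i) x := seqIn_map h x

lemma exists_of_seqι_eq_zero {n : ℕ} {x : F.obj n} (h : lin (seqι F n) x = 0) :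
    ∃ (m : ℕ) (hm : n ≤ m), lin (F.map (homOfLE hm)) x = 0 := by
  obtain ⟨m, hm, h'⟩ := exists_of_seqIn_eq (F := F) (n := n) (x := x) (y := 0)
    (h.trans (map_zero (seqIn F n)).symm)
  exact ⟨m, hm, h'.trans (map_zero _)⟩

/-- A linear map out of the colimit of a sequence. -/
def seqLin {P : Type*} [AddCommGroup P] [Module k P] (g : ∀ n, F.obj n →ₗ[k] P)
    (hg : ∀ n x, g (n + 1) (lin (F.map (homOfLE n.le_succ)) x) = g n x) :
    seqColim F →ₗ[k] P := seqDesc g hg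

@[simp] lemma seqLin_seqι {P : Type*} [AddCommGroup P] [Module k P] (g : ∀ n, F.obj n →ₗ[k] P)
    (hg : ∀ n x, g (n + 1) (lin (F.map (homOfLE n.le_succ)) x) = g n x) (n : ℕ) (x : F.obj n) :
    seqLin g hg (lin (seqι F n) x) = g n x := rfl

/-- The morphism out of the colimit of a sequence induced by a compatible family. -/
def seqColimDesc {P : DGBimod A B} (g : ∀ n, F.obj n ⟶ P)
    (hg : ∀ n, F.map (homOfLE n.le_succ) ≫ g (n + 1) = g n) : seqColim F ⟶ P :=
  Hom.mk (M := seqColim F)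
    (seqLin (fun n => lin (g n)) fun n x => by rw [← lin_comp, hg])
    (fun a x => by
      obtain ⟨n, x, rfl⟩ := exists_seqι x
      rw [← lin_map_smul, seqLin_seqι, seqLin_seqι, lin_map_smul])
    (fun b x => by
      obtain ⟨n, x, rfl⟩ := exists_seqι x
      rw [← lin_map_rsmul, seqLin_seqι, seqLin_seqι, lin_map_rsmul])
    (fun {i x} hx => seqGrading_le (S := (P.grading i).comap
        (seqLin (fun n => lin (g n)) fun n x => by rw [← lin_comp, hg]))
      (fun n _ hx => lin_mem (g n) hx) hx)
    (fun x => by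
      obtain ⟨n, x, rfl⟩ := exists_seqι x
      rw [← lin_d, seqLin_seqι, seqLin_seqι, lin_d])

lemma acyclic_seqColim (h : ∀ n, Acyclic (F.obj n)) : Acyclic (seqColim F) := fun x hx => by
  obtain ⟨n, x, rfl⟩ := exists_seqι x
  rw [← lin_d] at hx
  obtain ⟨m, hm, hx⟩ := exists_of_seqι_eq_zero hx
  rw [lin_d] at hx
  obtain ⟨y, hy⟩ := h m _ hx
  exact ⟨lin (seqι F m) y, by rw [← lin_d, hy, seqι_map]⟩

variable (F)

/-- The comparison morphism `colim (F ⊗ N) → colim F ⊗ N`. -/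
def seqTensorHom (N : DGBimod B C) : seqColim (F ⋙ tensorFun N) ⟶ tensorObj (seqColim F) N :=
  seqColimDesc (F := F ⋙ tensorFun N) (fun n => tensorMap N (seqι F n)) fun n =>
    tensorHom_ext (M := F.obj n) fun x y => by
      change tm _ N (lin (seqι F (n + 1)) (lin (F.map (homOfLE n.le_succ)) x)) y = _
      rw [seqι_map, lin_tensorMap_tm]

/-- The inverse of `seqTensorHom` as a linear map. -/
def seqTensorInv (N : DGBimod B C) :
    tensorObj (seqColim F) N →ₗ[k] seqColim (F ⋙ tensorFun N) :=
  tdesc (seqLin (fun n => (tm (F.obj n) N).compr₂ (lin (seqι (F ⋙ tensorFun N) n)))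
      fun n x => LinearMap.ext fun y =>
        seqι_map (F := F ⋙ tensorFun N) n.le_succ (tm (F.obj n) N x y))
    (fun b x y => by
      obtain ⟨n, x, rfl⟩ := exists_seqι x
      rw [← lin_map_rsmul, seqLin_seqι, seqLin_seqι]
      exact congrArg (lin (seqι (F ⋙ tensorFun N) n)) (tm_balanced b x y))

/-- Tensor products commute with sequential colimits. -/
def seqTensor (N : DGBimod B C) : seqColim (F ⋙ tensorFun N) ≅ tensorObj (seqColim F) N :=
  isoOfInverse (seqTensorHom F N) (seqTensorInv F N)
    (fun x => by
      obtain ⟨n, x, rfl⟩ := exists_seqι x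
      exact LinearMap.congr_fun (f := (seqTensorInv F N ∘ₗ lin (seqTensorHom F N)) ∘ₗ
        lin (seqι (F ⋙ tensorFun N) n)) (g := lin (seqι (F ⋙ tensorFun N) n))
        (tm_ext (M := F.obj n) fun _ _ => rfl) x)
    (fun x => LinearMap.congr_fun (f := lin (seqTensorHom F N) ∘ₗ seqTensorInv F N)
      (g := LinearMap.id) (tm_ext fun x y => by
        obtain ⟨n, x, rfl⟩ := exists_seqι x
        rfl) x)

/-- The comparison morphism `colim (M ⊗ F) → M ⊗ colim F`. -/
def seqTensorLeftHom (M : DGBimod E A) :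
    seqColim (F ⋙ tensorLeftFun M) ⟶ tensorObj M (seqColim F) :=
  seqColimDesc (F := F ⋙ tensorLeftFun M) (fun n => tensorMapRight M (seqι F n)) fun n =>
    tensorHom_ext (N := F.obj n) fun x y => by
      change tm M _ x (lin (seqι F (n + 1)) (lin (F.map (homOfLE n.le_succ)) y)) = _
      rw [seqι_map, lin_tensorMapRight_tm]

/-- The inverse of `seqTensorLeftHom` as a linear map. -/
def seqTensorLeftInv (M : DGBimod E A) :
    tensorObj M (seqColim F) →ₗ[k] seqColim (F ⋙ tensorLeftFun M) :=
  tdesc (seqLin (fun n => ((tm M (F.obj n)).compr₂ (lin (seqι (F ⋙ tensorLeftFun M) n))).flip)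
      fun n x => LinearMap.ext fun y =>
        seqι_map (F := F ⋙ tensorLeftFun M) n.le_succ (tm M (F.obj n) y x)).flip
    (fun b x y => by
      obtain ⟨n, y, rfl⟩ := exists_seqι y
      rw [← lin_map_smul, LinearMap.flip_apply, LinearMap.flip_apply, seqLin_seqι, seqLin_seqι]
      exact congrArg (lin (seqι (F ⋙ tensorLeftFun M) n)) (tm_balanced b x y))

/-- Tensor products commute with sequential colimits. -/
def seqTensorLeft (M : DGBimod E A) :
    seqColim (F ⋙ tensorLeftFun M) ≅ tensorObj M (seqColim F) :=
  isoOfInverse (seqTensorLeftHom F M) (seqTensorLeftInv F M)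
    (fun x => by
      obtain ⟨n, x, rfl⟩ := exists_seqι x
      exact LinearMap.congr_fun (f := (seqTensorLeftInv F M ∘ₗ lin (seqTensorLeftHom F M)) ∘ₗ
        lin (seqι (F ⋙ tensorLeftFun M) n)) (g := lin (seqι (F ⋙ tensorLeftFun M) n))
        (tm_ext (N := F.obj n) fun _ _ => rfl) x)
    (fun x => LinearMap.congr_fun (f := lin (seqTensorLeftHom F M) ∘ₗ seqTensorLeftInv F M)
      (g := LinearMap.id) (tm_ext fun x y => by
        obtain ⟨n, y, rfl⟩ := exists_seqι y
        rfl) x)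

lemma leftFlat_seqColim (h : ∀ n, LeftFlat (F.obj n)) : LeftFlat (seqColim F) := fun _ X hX =>
  (acyclic_seqColim (F := F ⋙ tensorLeftFun X) fun n => h n _ X hX).of_iso (seqTensorLeft F X)

lemma rightFlat_seqColim (h : ∀ n, RightFlat (F.obj n)) : RightFlat (seqColim F) := fun _ X hX =>
  (acyclic_seqColim (F := F ⋙ tensorFun X) fun n => h n _ X hX).of_iso (seqTensor F X)

end

end DGBimod

/-! ### Semifree resolutions -/

namespace DGBimod

open DGAlg

variable {k : Type u} [Field k] {A B C E : DGAlg k}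

lemma acyclic_of_homogeneous {M : DGBimod A B}
    (h : ∀ i, ∀ m ∈ M.grading i, M.d m = 0 → ∃ m', M.d m' = m) : Acyclic M := fun m hm => by
  have h' : ∀ i, gproj M.grading i m ∈ LinearMap.range M.d := fun i =>
    h i _ (gproj_mem _ _ _) (by rw [d_gproj, hm, map_zero])
  have : m ∈ LinearMap.range M.d := by
    classical
    rw [← DirectSum.sum_support_decompose M.grading m]
    exact Submodule.sum_mem _ fun i _ => h' i
  exact this

/-- A criterion for quasi-isomorphisms, in which injectivity and surjectivity on cohomology are
tested at the same time and on homogeneous elements. -/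
lemma quasiIso_of_exists {M N : DGBimod A B} (f : M ⟶ N)
    (h : ∀ i, ∀ m ∈ M.grading i, ∀ n ∈ N.grading (i - 1), M.d m = 0 → N.d n = lin f m →
      ∃ m', M.d m' = m ∧ lin f m' = n) : quasiIso A B f := by
  rw [quasiIso_iff_acyclic_cone]
  refine acyclic_of_homogeneous fun i x hx hd => ?_
  obtain ⟨n, m, rfl⟩ := exists_eq_cIn_add_cSh f x
  rw [add_mem_cone_grading] at hx
  rw [map_add, d_cIn, d_cSh, ← add_sub_assoc, ← map_add] at hd
  have h₁ : N.d n + lin f m = 0 := by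
    simpa using congrArg (coneDesc f LinearMap.id (0 : M →ₗ[k] N)) hd
  have h₂ : M.d m = 0 := by
    simpa using congrArg (coneDesc f (0 : N →ₗ[k] M) LinearMap.id) hd
  obtain ⟨e, he, he'⟩ := h (i + 1) m hx.2 (-n)
    (by rw [add_sub_cancel_right]; exact Submodule.neg_mem _ hx.1) h₂
    (by rw [map_neg]; exact neg_eq_of_add_eq_zero_right h₁)
  refine ⟨-cSh f e, ?_⟩
  rw [map_neg, d_cSh, he, he', map_neg]
  abel

section Step

variable {P X : DGBimod A B} (f : P ⟶ X)

/-- The classes to be killed when `f : P → X` is improved: cocycles `p` of `P` of degree `n`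
together with an element `x` of `X` whose differential is the image of `p`. -/
structure StepIdx : Type u where
  deg : ℤ
  cocycle : P
  bound : X
  cocycle_mem : cocycle ∈ P.grading deg
  d_cocycle : P.d cocycle = 0
  bound_mem : bound ∈ X.grading (deg - 1)
  d_bound : X.d bound = lin f cocycle

/-- The attaching morphism, which sends the generators to the cocycles to be killed. -/
def stepMap : cell A B (StepIdx.deg (f := f)) ⟶ P :=
  cellHom _ StepIdx.cocycle StepIdx.cocycle_mem StepIdx.d_cocycle

lemma lin_stepMap_el (a : A) (i : StepIdx f) (b : B) :
    lin (stepMap f) (el A B _ i a b) = op b • (a • i.cocycle) := lin_cellHom_el _ _ _ _ i a b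

/-- The dg bimodule in which the cocycles of `StepIdx f` have been killed. -/
abbrev stepObj : DGBimod A B := cone (stepMap f)

/-- The extension of `f` to `stepObj f`. -/
def stepHom : stepObj f ⟶ X :=
  coneDescHom _ f (cellLin _ 1 (StepIdx.bound (f := f)))
    (fun a m => by rw [cellLin_smul, twist_neg_twist])
    (fun b m => cellLin_rsmul _ _ _ b m)
    (fun i m hm => by
      have := cellLin_mem _ 1 (StepIdx.bound (f := f)) (l := -1) StepIdx.bound_mem hm
      rwa [add_neg_cancel_right] at this)
    (fun m => by
      rw [d_cellLin _ 1 _ StepIdx.bound_mem, ksign_one, neg_one_smul, cellLin_two,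
        ← sub_eq_add_neg]
      congr 1
      refine LinearMap.congr_fun (f := cellLin (StepIdx.deg (f := f)) 0 _)
        (g := lin f ∘ₗ lin (stepMap f))
        (cell_ext _ fun a i b => ?_) m
      rw [LinearMap.comp_apply, lin_stepMap_el, cellLin_el, twist_zero, i.d_bound,
        lin_map_rsmul, lin_map_smul])

lemma lin_stepHom_cIn (p : P) : lin (stepHom f) (cIn _ p) = lin f p := coneDesc_cIn _ _ _ p

lemma lin_stepHom_cSh (t) : lin (stepHom f) (cSh _ t) =
    cellLin (StepIdx.deg (f := f)) 1 (StepIdx.bound (f := f)) t := coneDesc_cSh _ _ _ t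

lemma coneIn_stepHom : coneIn (stepMap f) ≫ stepHom f = f :=
  hom_ext fun p => lin_stepHom_cIn f p

/-- The classes of `StepIdx f` are killed in `stepObj f`. -/
lemma exists_step {n : ℤ} {p : P} (hp : p ∈ P.grading n) (hd : P.d p = 0) {x : X}
    (hx : x ∈ X.grading (n - 1)) (h : X.d x = lin f p) :
    ∃ e : stepObj f, (stepObj f).d e = lin (coneIn (stepMap f)) p ∧ lin (stepHom f) e = x := by
  refine ⟨cSh _ (el A B _ (⟨n, p, x, hp, hd, hx, h⟩ : StepIdx f) 1 1), ?_, ?_⟩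
  · rw [d_cSh, d_el_one, map_zero, sub_zero, lin_coneIn, lin_stepMap_el, one_smul,
      op_one, one_smul]
  · rw [lin_stepHom_cSh, cellLin_el, show twist A.grading 1 (1 : A) = 1 from
      map_one (A.twistHom 1), one_smul, op_one, one_smul]

variable {f} {P' X' : DGBimod A B} {f' : P' ⟶ X'} (u : P ⟶ P') (g : X ⟶ X')
  (w : u ≫ f' = f ≫ g)

/-- The map on indices induced by a commutative square. -/
def stepIdxMap (t : StepIdx f) : StepIdx f' :=
  ⟨t.deg, lin u t.cocycle, lin g t.bound, lin_mem u t.cocycle_mem,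
    by rw [← lin_d, t.d_cocycle, map_zero], lin_mem g t.bound_mem,
    by rw [← lin_d, t.d_bound, ← lin_comp, ← lin_comp, w]⟩

/-- The morphism of free dg bimodules induced by a commutative square. -/
def stepCellMap : cell A B (StepIdx.deg (f := f)) ⟶ cell A B (StepIdx.deg (f := f')) :=
  cellMap A B (stepIdxMap u g w) (fun _ => rfl)

lemma lin_stepCellMap_el (a : A) (i : StepIdx f) (b : B) :
    lin (stepCellMap u g w) (el A B _ i a b) = el A B _ (stepIdxMap u g w i) a b :=
  lin_cellMap_el A B (stepIdxMap u g w) (fun _ => rfl) i a b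

lemma stepMap_comp : stepMap f ≫ u = stepCellMap u g w ≫ stepMap f' :=
  lin_injective (cell_ext _ fun a i b => by
    rw [lin_comp, lin_comp, lin_stepCellMap_el, lin_stepMap_el, lin_stepMap_el,
      lin_map_rsmul, lin_map_smul]
    rfl)

/-- The morphism `stepObj f → stepObj f'` induced by a commutative square. -/
def stepLift : stepObj f ⟶ stepObj f' :=
  coneMap (stepCellMap u g w) u (stepMap_comp u g w)

lemma lin_stepLift_cIn (p : P) : lin (stepLift u g w) (cIn _ p) = cIn _ (lin u p) :=
  coneDesc_cIn _ _ _ p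

lemma lin_stepLift_cSh (t : cell A B (StepIdx.deg (f := f))) :
    lin (stepLift u g w) (cSh _ t) = cSh _ (lin (stepCellMap u g w) t) :=
  coneDesc_cSh _ _ _ t

lemma coneIn_stepLift : coneIn (stepMap f) ≫ stepLift u g w = u ≫ coneIn (stepMap f') :=
  hom_ext fun p => lin_stepLift_cIn u g w p

lemma stepLift_stepHom : stepLift u g w ≫ stepHom f' = stepHom f ≫ g :=
  lin_injective (cone_lin_ext _
    (fun p => by
      rw [lin_comp, lin_stepLift_cIn, lin_stepHom_cIn, lin_comp, lin_stepHom_cIn,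
        ← lin_comp, w, lin_comp])
    (fun t => by
      rw [lin_comp, lin_stepLift_cSh, lin_stepHom_cSh, lin_comp, lin_stepHom_cSh]
      refine LinearMap.congr_fun (f := cellLin _ 1 _ ∘ₗ lin (stepCellMap u g w))
        (g := lin g ∘ₗ cellLin _ 1 _) (cell_ext _ fun a i b => ?_) t
      rw [LinearMap.comp_apply, LinearMap.comp_apply, lin_stepCellMap_el, cellLin_el, cellLin_el,
        lin_map_rsmul, lin_map_smul]
      rfl))

end Step

section Resolution

/-- A dg bimodule over `X`. -/
structure Stage (X : DGBimod A B) where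
  obj : DGBimod A B
  hom : obj ⟶ X

variable (X : DGBimod A B)

/-- The stages of the construction of the semifree resolution of `X`. -/
def stage : ℕ → Stage X
  | 0 => ⟨zeroObj A B, 0⟩
  | n + 1 => ⟨stepObj (stage n).hom, stepHom (stage n).hom⟩

/-- The inclusion of a stage in the next one. -/
def stageIn (n : ℕ) : (stage X n).obj ⟶ (stage X (n + 1)).obj := coneIn (stepMap (stage X n).hom)

/-- The sequence of stages. -/
def stageSeq : ℕ ⥤ DGBimod A B := Functor.ofSequence (stageIn X)

lemma stageSeq_map (n : ℕ) : (stageSeq X).map (homOfLE n.le_succ) = stageIn X n :=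
  Functor.ofSequence_map_homOfLE_succ _ n

/-- The semifree resolution of `X`. -/
def res : DGBimod A B := seqColim (stageSeq X)

/-- The inclusion of a stage in the semifree resolution. -/
def resι (n : ℕ) : (stage X n).obj ⟶ res X := seqι (stageSeq X) n

lemma resι_succ (n : ℕ) (x : (stage X n).obj) :
    lin (resι X (n + 1)) (lin (stageIn X n) x) = lin (resι X n) x := by
  have := seqι_map (F := stageSeq X) n.le_succ x
  rwa [stageSeq_map] at this

variable {X}

lemma exists_resι (x : res X) : ∃ n y, x = lin (resι X n) y := exists_seqι x

/-- The linear map out of the semifree resolution induced by a compatible family. -/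
def resLin {V : Type*} [AddCommGroup V] [Module k V] (g : ∀ n, (stage X n).obj →ₗ[k] V)
    (hg : ∀ n x, g (n + 1) (lin (stageIn X n) x) = g n x) : res X →ₗ[k] V :=
  seqLin (F := stageSeq X) g fun n x => by
    rw [stageSeq_map]
    exact hg n x

lemma resLin_resι {V : Type*} [AddCommGroup V] [Module k V] (g : ∀ n, (stage X n).obj →ₗ[k] V)
    (hg : ∀ n x, g (n + 1) (lin (stageIn X n) x) = g n x) (n : ℕ) (x : (stage X n).obj) :
    resLin g hg (lin (resι X n) x) = g n x := rfl

/-- The morphism out of the semifree resolution induced by a compatible family. -/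
def resDesc {Y : DGBimod A B} (g : ∀ n, (stage X n).obj ⟶ Y)
    (hg : ∀ n, stageIn X n ≫ g (n + 1) = g n) : res X ⟶ Y :=
  seqColimDesc (F := stageSeq X) g fun n => by
    rw [stageSeq_map]
    exact hg n

variable (X)

/-- The augmentation of the semifree resolution. -/
def resπ : res X ⟶ X :=
  resDesc (fun n => (stage X n).hom) fun n => coneIn_stepHom (stage X n).hom

lemma lin_resπ_resι (n : ℕ) (x : (stage X n).obj) :
    lin (resπ X) (lin (resι X n) x) = lin (stage X n).hom x := rfl

lemma stageSeq_map_injective {i j : ℕ} (h : i ≤ j) :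
    Function.Injective (lin ((stageSeq X).map (homOfLE h))) := by
  induction j, h using Nat.le_induction with
  | base =>
    rw [show homOfLE (le_refl i) = 𝟙 i from rfl, (stageSeq X).map_id]
    exact Function.injective_id
  | succ j h ih =>
    rw [show homOfLE (h.trans j.le_succ) = homOfLE h ≫ homOfLE j.le_succ from rfl,
      (stageSeq X).map_comp, stageSeq_map]
    exact (cIn_injective _).comp ih

lemma resι_injective (n : ℕ) : Function.Injective (lin (resι X n)) :=
  (injective_iff_map_eq_zero _).2 fun x hx => by
    obtain ⟨m, hm, h⟩ := exists_of_seqι_eq_zero (F := stageSeq X) hx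
    exact stageSeq_map_injective X hm (h.trans (map_zero _).symm)

/-- The augmentation of the semifree resolution is a quasi-isomorphism. -/
lemma quasiIso_resπ : quasiIso A B (resπ X) := by
  refine quasiIso_of_exists _ fun i m hm n hn hd h => ?_
  obtain ⟨l, y, rfl⟩ := exists_resι m
  have hy : y ∈ (stage X l).obj.grading i := mem_of_lin_mem _ (resι_injective X l) hm
  have hyd : (stage X l).obj.d y = 0 := resι_injective X l (by rw [lin_d, hd, map_zero])
  obtain ⟨e, he, he'⟩ := exists_step (stage X l).hom hy hyd hn (by rw [h, lin_resπ_resι])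
  let e' : (stage X (l + 1)).obj := e
  refine ⟨lin (resι X (l + 1)) e', ?_, he'⟩
  rw [← lin_d]
  exact (congrArg (lin (resι X (l + 1))) he).trans (resι_succ X l y)

variable {X} {X' : DGBimod A B} (g : X ⟶ X')

/-- The lifts of `g` to the stages. -/
def stageLift : ∀ n, {u : (stage X n).obj ⟶ (stage X' n).obj //
    u ≫ (stage X' n).hom = (stage X n).hom ≫ g}
  | 0 => ⟨0, by
    refine (isZero_of_subsingleton (zeroObj A B)).eq_of_src _ _⟩
  | n + 1 => ⟨stepLift (stageLift n).1 g (stageLift n).2,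
      stepLift_stepHom (stageLift n).1 g (stageLift n).2⟩

/-- A lift of a morphism to semifree resolutions. -/
def resMap : res X ⟶ res X' :=
  resDesc (fun n => (stageLift g n).1 ≫ resι X' n) fun n => by
    rw [← Category.assoc,
      show stageIn X n ≫ (stageLift g (n + 1)).1 = (stageLift g n).1 ≫ stageIn X' n from
        coneIn_stepLift _ _ _, Category.assoc]
    congr 1
    exact hom_ext fun x => resι_succ X' n x

lemma resMap_resπ : resMap g ≫ resπ X' = resπ X ≫ g := hom_ext fun x => by
  obtain ⟨n, x, rfl⟩ := exists_resι x
  exact LinearMap.congr_fun (congrArg lin (stageLift g n).2) x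

variable (X)

lemma leftFlat_stage (n : ℕ) : LeftFlat (stage X n).obj := by
  induction n with
  | zero =>
    intro _ M _ x _
    refine ⟨0, (map_zero _).trans (LinearMap.congr_fun
      (f := (0 : tensorObj M (stage X 0).obj →ₗ[k] _))
      (g := LinearMap.id) (tm_ext fun m n => ?_) x)⟩
    rw [show n = 0 from Subsingleton.elim (α := zeroObj A B) _ _, map_zero]
    simp
  | succ n ih => exact (leftFlat_cell _).cone _ ih

lemma rightFlat_stage (n : ℕ) : RightFlat (stage X n).obj := by
  induction n with
  | zero =>
    intro _ M _ x _
    refine ⟨0, (map_zero _).trans (LinearMap.congr_fun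
      (f := (0 : tensorObj (stage X 0).obj M →ₗ[k] _))
      (g := LinearMap.id) (tm_ext fun m n => ?_) x)⟩
    rw [show m = 0 from Subsingleton.elim (α := zeroObj A B) _ _, map_zero]
    simp
  | succ n ih => exact (rightFlat_cell _).cone _ ih

lemma leftFlat_res : LeftFlat (res X) :=
  leftFlat_seqColim (stageSeq X) fun n => leftFlat_stage X n

lemma rightFlat_res : RightFlat (res X) :=
  rightFlat_seqColim (stageSeq X) fun n => rightFlat_stage X n

end Resolution

/-! ### Semifree modules are homotopically projective -/

section Projective

/-- A dg bimodule is homotopically projective as a right dg module if every closed right linear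
map of degree `0` to an acyclic one is null-homotopic. -/
def RightProjective (K : DGBimod A B) : Prop :=
  ∀ (C : DGAlg.{u} k) (N : DGBimod C B), Acyclic N → ∀ g : K →ₗ[k] N,
    (∀ (b : B) m, g (op b • m) = op b • g m) → (∀ i, ∀ m ∈ K.grading i, g m ∈ N.grading i) →
    (∀ m, g (K.d m) = N.d (g m)) → ∃ h : K →ₗ[k] N,
      (∀ (b : B) m, h (op b • m) = op b • h m) ∧
      (∀ i, ∀ m ∈ K.grading i, h m ∈ N.grading (i - 1)) ∧ ∀ m, N.d (h m) + h (K.d m) = g m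

/-- Right linear null-homotopies can be extended along the attaching of free dg bimodules. -/
lemma exists_extend_homotopy {I : Type u} {deg : I → ℤ} {P : DGBimod A B}
    (φ : cell A B deg ⟶ P) {N : DGBimod C B} (hN : Acyclic N) (g : cone φ →ₗ[k] N)
    (hg : ∀ (b : B) m, g (op b • m) = op b • g m)
    (hg' : ∀ i, ∀ m ∈ (cone φ).grading i, g m ∈ N.grading i)
    (hgd : ∀ m, g ((cone φ).d m) = N.d (g m)) (h : P →ₗ[k] N)
    (hh : ∀ (b : B) m, h (op b • m) = op b • h m)
    (hh' : ∀ i, ∀ m ∈ P.grading i, h m ∈ N.grading (i - 1))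
    (hhd : ∀ m, N.d (h m) + h (P.d m) = g (cIn φ m)) : ∃ h' : cone φ →ₗ[k] N,
      ((∀ (b : B) m, h' (op b • m) = op b • h' m) ∧
      (∀ i, ∀ m ∈ (cone φ).grading i, h' m ∈ N.grading (i - 1)) ∧
      ∀ m, N.d (h' m) + h' ((cone φ).d m) = g m) ∧ ∀ m, h' (cIn φ m) = h m := by
  obtain ⟨s, hs, hsd⟩ := hN.exists_contraction
  let Y := tensorObj (diag A).forgetRight (basisObj (k := k) deg)
  let B' := (diag B).forgetLeft
  -- the obstruction to extending `h` by zero, a closed map of degree `-1`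
  let w : cell A B deg →ₗ[k] N := g ∘ₗ cSh φ - h ∘ₗ lin φ
  have hw : ∀ t, w t = g (cSh φ t) - h (lin φ t) := fun _ => rfl
  have hwb : ∀ (b : B) t, w (op b • t) = op b • w t := fun b t => by
    rw [hw, hw, ← rsmul_cSh, hg, lin_map_rsmul, hh, smul_sub]
  have hwd : ∀ t, w ((cell A B deg).d t) = -N.d (w t) := fun t => by
    have h₁ := hgd (cSh φ t)
    have h₂ := hhd (lin φ t)
    rw [d_cSh, map_sub] at h₁
    rw [hw, hw, map_sub, ← h₁, ← h₂, lin_d]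
    abel
  have hwm : ∀ i, ∀ t ∈ (cell A B deg).grading i, w t ∈ N.grading (i - 1) := fun i t ht =>
    Submodule.sub_mem _ (hg' _ _ (cSh_mem φ ht (by ring))) (hh' _ _ (lin_mem φ ht))
  let v : Y →ₗ[k] N := s ∘ₗ w ∘ₗ (tm Y B').flip (1 : B)
  have hv : ∀ y, v y = s (w (tm Y B' y (1 : B))) := fun _ => rfl
  have bal : ∀ (c : ground k) (y : Y) (b : B'), (N.ract.flip ∘ₗ v) (op c • y) b =
      (N.ract.flip ∘ₗ v) y (c • b) := fun c y b => by
    change op (show B from b) • v (op c • y) = op ((show k from c) • (show B from b)) • v y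
    rw [ground_rsmul, map_smul, op_smul, smul_assoc, smul_comm]
  let h₁ : cell A B deg →ₗ[k] N := tdesc (M := Y) (N := B') (N.ract.flip ∘ₗ v) bal
  have hh₁ : ∀ (y : Y) (b : B), h₁ (tm Y B' y b) = op b • v y := fun _ _ => rfl
  have hone : ∀ (y : Y) (b : B), tm Y B' y b = op b • (tm Y B' y (1 : B) : cell A B deg) :=
    fun y b => congrArg (tm Y B' y) (one_mul b).symm
  have hm : ∀ i, ∀ y ∈ Y.grading i, v y ∈ N.grading (i - 2) := fun i y hy => by
    have := hs _ _ (hwm _ _ (tm_mem hy (n := (1 : B)) (N := B') B.one_mem))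
    rwa [show i + 0 - 1 - 1 = i - 2 by ring] at this
  have hh₁b : ∀ (b : B) t, h₁ (op b • t) = op b • h₁ t := fun b t =>
    LinearMap.congr_fun (f := h₁ ∘ₗ (cell A B deg).ract b) (g := N.ract b ∘ₗ h₁)
      (tm_ext fun y b' => mul_smul (op b) (op (show B from b')) (v y)) t
  have hh₁m : ∀ i, ∀ t ∈ (cell A B deg).grading i, h₁ t ∈ N.grading (i - 2) := fun i t ht =>
    tgrading_map (f := h₁) (fun p q hpq y hy b hb => by
      have := N.rsmul_mem (hm p y hy) (b := b) hb
      rwa [show p - 2 + q = i - 2 by omega] at this) ht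
  have hh₁d : ∀ t, N.d (h₁ t) - h₁ ((cell A B deg).d t) = w t := fun t =>
    LinearMap.congr_fun (f := N.d ∘ₗ h₁ - h₁ ∘ₗ (cell A B deg).d) (g := w)
      (tm_gext fun p y hy q b hb => by
        have e₁ : (cell A B deg).d (tm Y B' y b) =
            tm Y B' (Y.d y) b + ksign k p • tm Y B' y (B.d b) := d_tm hy b
        have e₃ : N.d (v y) = w (tm Y B' y (1 : B)) + v (Y.d y) := by
          have e₄ : (cell A B deg).d (tm Y B' y (1 : B)) = tm Y B' (Y.d y) (1 : B) := by
            refine (d_tm hy _).trans ?_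
            rw [show B'.d (1 : B) = 0 from B.d_one, map_zero, smul_zero, add_zero]
          have e₅ : v (Y.d y) = -s (N.d (w (tm Y B' y (1 : B)))) :=
            (congrArg s ((congrArg w e₄).symm.trans (hwd _))).trans (map_neg s _)
          rw [e₅, hv]
          exact eq_add_neg_of_add_eq (hsd _)
        have e₆ : h₁ ((cell A B deg).d (tm Y B' y b)) =
            op (show B from b) • v (Y.d y) + ksign k p • (op (B.d b) • v y) :=
          (congrArg h₁ e₁).trans ((map_add h₁ _ _).trans (congrArg _ (map_smul h₁ _ _)))
        have e₇ : w (tm Y B' y b) = op (show B from b) • w (tm Y B' y (1 : B)) :=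
          (congrArg w (hone y b)).trans (hwb b _)
        have e₈ : ksign k (p - 2) = ksign k p := by
          rw [show p - 2 = p - 1 - 1 by ring, ksign_sub_one, ksign_sub_one, neg_neg]
        change N.d (op (show B from b) • v y) - h₁ ((cell A B deg).d (tm Y B' y b)) =
          w (tm Y B' y b)
        rw [e₆, e₇, N.d_rsmul (hm p y hy), e₃, smul_add, e₈]
        abel) t
  refine ⟨coneDesc φ h h₁, ⟨fun b x => ?_, fun i x hx => ?_, fun x => ?_⟩, fun m =>
    coneDesc_cIn φ h h₁ m⟩
  · obtain ⟨p, t, rfl⟩ := exists_eq_cIn_add_cSh φ x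
    rw [smul_add, rsmul_cIn, rsmul_cSh, map_add, map_add, coneDesc_cIn, coneDesc_cIn,
      coneDesc_cSh, coneDesc_cSh, hh, hh₁b, smul_add]
  · obtain ⟨p, t, rfl⟩ := exists_eq_cIn_add_cSh φ x
    rw [add_mem_cone_grading] at hx
    rw [map_add, coneDesc_cIn, coneDesc_cSh]
    refine Submodule.add_mem _ (hh' i p hx.1) ?_
    have := hh₁m _ t hx.2
    rwa [show i + 1 - 2 = i - 1 by ring] at this
  · obtain ⟨p, t, rfl⟩ := exists_eq_cIn_add_cSh φ x
    rw [map_add, map_add, map_add, map_add, coneDesc_cIn, coneDesc_cSh, d_cIn, d_cSh, map_sub,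
      coneDesc_cIn, coneDesc_cIn, coneDesc_cSh, map_add, ← hhd, 
      show g (cSh φ t) = w t + h (lin φ t) from (sub_add_cancel _ _).symm, ← hh₁d]
    abel

/-- Semifree resolutions are homotopically projective as right dg modules. -/
lemma rightProjective_res (X : DGBimod A B) : RightProjective (res X) := by
  intro C N hN g hg hg' hgd
  let Good (n : ℕ) (h : (stage X n).obj →ₗ[k] N) : Prop :=
    (∀ (b : B) m, h (op b • m) = op b • h m) ∧
      (∀ i, ∀ m ∈ (stage X n).obj.grading i, h m ∈ N.grading (i - 1)) ∧
      ∀ m, N.d (h m) + h ((stage X n).obj.d m) = g (lin (resι X n) m)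
  have h₀ : Good 0 0 :=
    ⟨fun b m => by simp, fun i m _ => Submodule.zero_mem _, fun m => by
      rw [show m = 0 from Subsingleton.elim (α := zeroObj A B) _ _]
      simp⟩
  have hs : ∀ n h, Good n h → ∃ h', Good (n + 1) h' ∧ ∀ m, h' (lin (stageIn X n) m) = h m := by
    rintro n h ⟨h₁, h₂, h₃⟩
    exact exists_extend_homotopy (stepMap (stage X n).hom) hN (g ∘ₗ lin (resι X (n + 1)))
      (fun b m => (congrArg g (lin_map_rsmul (resι X (n + 1)) (op b) m)).trans (hg b _))
      (fun i m hm => hg' i _ (lin_mem (resι X (n + 1)) hm))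
      (fun m => (congrArg g (lin_d (resι X (n + 1)) m)).trans (hgd _)) h h₁ h₂
      (fun m => (h₃ m).trans (congrArg g (resι_succ X n m).symm))
  choose! next hnext hcompat using hs
  let H : ∀ n, {h // Good n h} := fun n => Nat.rec ⟨0, h₀⟩
    (fun n h => ⟨next n h.1, hnext n h.1 h.2⟩) n
  have hH : ∀ n m, (H (n + 1)).1 (lin (stageIn X n) m) = (H n).1 m := fun n =>
    hcompat n (H n).1 (H n).2
  refine ⟨resLin (fun n => (H n).1) hH, fun b m => ?_, fun i m hm => ?_, fun m => ?_⟩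
  · obtain ⟨n, m, rfl⟩ := exists_resι m
    rw [← lin_map_rsmul, resLin_resι, resLin_resι, (H n).2.1]
  · obtain ⟨n, m, rfl⟩ := exists_resι m
    rw [resLin_resι]
    exact (H n).2.2.1 i m (mem_of_lin_mem _ (resι_injective X n) hm)
  · obtain ⟨n, m, rfl⟩ := exists_resι m
    rw [← lin_d, resLin_resι, resLin_resι, (H n).2.2.2]

end Projective

end DGBimod

/-! ### Local finiteness of semifree resolutions -/

namespace DGBimod

open DGAlg

variable {k : Type u} [Field k] {A B : DGAlg k}

/-- Finite subsets of `M` are contained in finite cell submodules. -/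
def LocallyFinCell (M : DGBimod A B) : Prop :=
  ∀ s : Set M, s.Finite → ∃ (W : DGBimod A B) (j : W ⟶ M), FinCell W ∧
    Function.Injective (lin j) ∧ s ⊆ Set.range (lin j)

section

variable {I : Type u} (deg : I → ℤ)

/-- The inclusion of the free dg bimodule on finitely many of the generators. -/
def cellIncl (J : Finset I) : cell A B (fun j : J => deg j) ⟶ cell A B deg :=
  cellMap A B (fun j : J => (j : I)) fun _ => rfl

lemma lin_cellIncl_el (J : Finset I) (a : A) (j : J) (b : B) :
    lin (cellIncl deg J) (el A B _ j a b) = el A B deg j a b := lin_cellMap_el A B _ _ j a b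

lemma lin_cellIncl_injective (J : Finset I) :
    Function.Injective (lin (cellIncl (A := A) (B := B) deg J)) :=
  lin_cellMap_injective A B _ _ Subtype.val_injective

lemma range_cellIncl_mono {J J' : Finset I} (h : J ⊆ J') :
    LinearMap.range (lin (cellIncl (A := A) (B := B) deg J)) ≤
      LinearMap.range (lin (cellIncl deg J')) := by
  rintro _ ⟨t, rfl⟩
  refine ⟨lin (cellMap A B (deg := fun j : J => deg j) (deg' := fun j : J' => deg j)
    (fun j : J => ⟨j.1, h j.2⟩) fun _ => rfl) t, ?_⟩
  refine LinearMap.congr_fun (f := lin (cellIncl deg J') ∘ₗ lin (cellMap A B _ _))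
    (g := lin (cellIncl deg J)) (cell_ext _ fun a j b => ?_) t
  rw [LinearMap.comp_apply, lin_cellMap_el, lin_cellIncl_el, lin_cellIncl_el]

lemma el_mem_range_cellIncl (J : Finset I) (a : A) {i : I} (h : i ∈ J) (b : B) :
    el A B deg i a b ∈ LinearMap.range (lin (cellIncl deg J)) :=
  LinearMap.mem_range.2 ⟨el A B (fun j : J => deg j) ⟨i, h⟩ a b, lin_cellIncl_el deg J a _ b⟩

lemma exists_mem_range_cellIncl (t : cell A B deg) :
    ∃ J, t ∈ LinearMap.range (lin (cellIncl deg J)) := by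
  classical
  have hdir : Directed (· ≤ ·) fun J : Finset I =>
      LinearMap.range (lin (cellIncl (A := A) (B := B) deg J)) := fun J J' =>
    ⟨J ∪ J', range_cellIncl_mono deg Finset.subset_union_left,
      range_cellIncl_mono deg Finset.subset_union_right⟩
  let S : Submodule k (cell A B deg) :=
    ⨆ J : Finset I, LinearMap.range (lin (cellIncl (A := A) (B := B) deg J))
  have hle : ∀ J, LinearMap.range (lin (cellIncl (A := A) (B := B) deg J)) ≤ S :=
    fun J => le_iSup (fun J : Finset I =>
      LinearMap.range (lin (cellIncl (A := A) (B := B) deg J))) J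
  have hS : S.mkQ = 0 := cell_ext deg fun a i b =>
    (Submodule.Quotient.mk_eq_zero S).2
      (hle {i} (el_mem_range_cellIncl deg {i} a (Finset.mem_singleton_self i) b))
  have ht : t ∈ S := (Submodule.Quotient.mk_eq_zero S).1 (LinearMap.congr_fun hS t)
  exact (Submodule.mem_iSup_of_directed _ hdir).1 ht

end

lemma LocallyFinCell.cone_cell {I : Type u} {deg : I → ℤ} {M : DGBimod A B}
    (φ : cell A B deg ⟶ M) (hM : LocallyFinCell M) : LocallyFinCell (cone φ) := by
  classical
  intro s hs
  choose p t hpt using exists_eq_cIn_add_cSh φ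
  choose J hJ using fun x => exists_mem_range_cellIncl deg (t x)
  set J' : Finset I := hs.toFinset.biUnion J with hJ'
  -- the finite cell submodule has to contain the images of the generators to be attached
  obtain ⟨W, j, hW, hj, hsub⟩ := hM (p '' s ∪ Set.range fun i : J' => lin φ (el A B deg i 1 1))
    ((hs.image p).union (Set.finite_range _))
  have hgen : ∀ i : J', ∃ w, lin j w = lin φ (el A B deg i 1 1) := fun i =>
    hsub (Or.inr ⟨i, rfl⟩)
  choose w hw using hgen
  have hwm : ∀ i : J', w i ∈ W.grading (deg i) := fun i => mem_of_lin_mem j hj (by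
    rw [hw]
    exact lin_mem φ (DGBimod.el_one_mem deg (i : I)))
  have hwd : ∀ i : J', W.d (w i) = 0 := fun i => hj (by
    rw [lin_d, hw, ← lin_d, d_el_one, map_zero, map_zero])
  let f : cell A B (fun i : J' => deg i) ⟶ W := cellHom _ w hwm hwd
  have comm : f ≫ j = cellIncl deg J' ≫ φ := lin_injective (cell_ext _ fun a i b => by
    rw [lin_comp, lin_comp, lin_cellIncl_el, lin_cellHom_el, lin_map_rsmul, lin_map_smul, hw,
      ← lin_map_smul, ← lin_map_rsmul, smul_el, rsmul_el, mul_one, one_mul])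
  refine ⟨cone f, coneMap (cellIncl deg J') j comm, .attach _ W f hW, ?_, fun x hx => ?_⟩
  · rw [injective_iff_map_eq_zero]
    intro x hx
    obtain ⟨p, t, rfl⟩ := exists_eq_cIn_add_cSh f x
    rw [map_add, lin_coneMap_cIn, lin_coneMap_cSh] at hx
    have h₁ := congrArg (coneDesc φ LinearMap.id (0 : _ →ₗ[k] M)) hx
    have h₂ := congrArg (coneDesc φ (0 : M →ₗ[k] _) LinearMap.id) hx
    rw [map_add, coneDesc_cIn, coneDesc_cSh, map_zero] at h₁ h₂
    rw [LinearMap.zero_apply, add_zero, LinearMap.id_apply] at h₁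
    rw [LinearMap.zero_apply, zero_add, LinearMap.id_apply] at h₂
    rw [hj (h₁.trans (map_zero _).symm), map_zero, zero_add,
      lin_cellIncl_injective deg J' (h₂.trans (map_zero _).symm), map_zero]
  · obtain ⟨y, hy⟩ := hsub (Or.inl ⟨x, hx, rfl⟩)
    obtain ⟨z, hz⟩ := range_cellIncl_mono deg (Finset.subset_biUnion_of_mem J
      (hs.mem_toFinset.2 hx)) (hJ x)
    refine ⟨cIn f y + cSh f z, ?_⟩
    rw [map_add, lin_coneMap_cIn, lin_coneMap_cSh, hy, hz, ← hpt]

lemma locallyFinCell_stage (X : DGBimod A B) (n : ℕ) : LocallyFinCell (stage X n).obj := by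
  induction n with
  | zero =>
    have : Subsingleton (stage X 0).obj := inferInstanceAs (Subsingleton (zeroObj A B))
    exact fun s _ => ⟨(stage X 0).obj, 𝟙 _, .zero _, Function.injective_id, fun x _ => ⟨x, rfl⟩⟩
  | succ n ih => exact ih.cone_cell _

lemma locallyFinCell_res (X : DGBimod A B) : LocallyFinCell (res X) := by
  intro s hs
  have : ∃ n, s ⊆ Set.range (lin (resι X n)) := by
    induction s, hs using Set.Finite.induction_on with
    | empty => exact ⟨0, Set.empty_subset _⟩
    | @insert x s _ _ ih =>
      obtain ⟨n, hn⟩ := ih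
      obtain ⟨m, y, rfl⟩ := exists_resι x
      have mono : ∀ {i j : ℕ}, i ≤ j → Set.range (lin (resι X i)) ⊆ Set.range (lin (resι X j)) := by
        rintro i j h _ ⟨z, rfl⟩
        exact ⟨_, seqι_map (F := stageSeq X) h z⟩
      refine ⟨max m n, Set.insert_subset (mono (le_max_left m n) ⟨y, rfl⟩)
        (hn.trans (mono (le_max_right m n)))⟩
  obtain ⟨n, hn⟩ := this
  obtain ⟨W, j, hW, hj, hsub⟩ := locallyFinCell_stage X n (lin (resι X n) ⁻¹' s)
    (hs.preimage (resι_injective X n).injOn)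
  refine ⟨W, j ≫ resι X n, hW, (resι_injective X n).comp hj, fun x hx => ?_⟩
  obtain ⟨y, rfl⟩ := hn hx
  obtain ⟨w, rfl⟩ := hsub hx
  exact ⟨w, rfl⟩

end DGBimod

/-! ### Dg bimodules of right linear maps -/

namespace DGBimod

open DGAlg

variable {k : Type u} [Field k] {A B C : DGAlg k}

section HomDeg

variable (K : DGBimod A B) (N : DGBimod C B)

/-- The space of right linear maps `K → N` of degree `i`. -/
def homDeg (i : ℤ) : Submodule k (K →ₗ[k] N) where
  carrier := {f | (∀ (b : B) x, f (op b • x) = op b • f x) ∧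
    ∀ j, ∀ x ∈ K.grading j, f x ∈ N.grading (j + i)}
  add_mem' {f g} hf hg := ⟨fun b x => by
      rw [LinearMap.add_apply, LinearMap.add_apply, hf.1, hg.1, smul_add],
    fun j x hx => Submodule.add_mem _ (hf.2 j x hx) (hg.2 j x hx)⟩
  zero_mem' := ⟨fun b x => by rw [LinearMap.zero_apply, LinearMap.zero_apply, smul_zero],
    fun j x hx => Submodule.zero_mem _⟩
  smul_mem' c f hf := ⟨fun b x => by
      rw [LinearMap.smul_apply, LinearMap.smul_apply, hf.1, smul_comm],
    fun j x hx => Submodule.smul_mem _ _ (hf.2 j x hx)⟩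

/-- The space of right linear maps `K → N` which are sums of homogeneous ones. -/
def homSub : Submodule k (K →ₗ[k] N) := ⨆ i, homDeg K N i

variable {K N}

lemma homDeg_le (i : ℤ) : homDeg K N i ≤ homSub K N := le_iSup (homDeg K N) i

lemma homSub_map {V : Type*} [AddCommGroup V] [Module k V] {S : Submodule k V}
    (T : (K →ₗ[k] N) →ₗ[k] V) (h : ∀ i, ∀ f ∈ homDeg K N i, T f ∈ S) {f : K →ₗ[k] N}
    (hf : f ∈ homSub K N) : T f ∈ S :=
  (iSup_le fun i f hf => h i f hf : homSub K N ≤ S.comap T) hf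

lemma homSub_rsmul {f : K →ₗ[k] N} (hf : f ∈ homSub K N) (b : B) (x : K) :
    f (op b • x) = op b • f x := by
  let T : (K →ₗ[k] N) →ₗ[k] N := LinearMap.applyₗ (op b • x) - N.ract b ∘ₗ LinearMap.applyₗ x
  have : T f ∈ (⊥ : Submodule k N) := homSub_map T (fun i f hf => by
    rw [Submodule.mem_bot]
    exact sub_eq_zero.2 (hf.1 b x)) hf
  exact sub_eq_zero.1 ((Submodule.mem_bot k).1 this)

variable (K N)

/-- The component of degree `i` of a linear map. -/
def homProj (i : ℤ) : (K →ₗ[k] N) →ₗ[k] K →ₗ[k] N where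
  toFun f := gmap K.grading fun j => gproj N.grading (j + i) ∘ₗ f
  map_add' f g := gext K.grading fun j x hx => by
    rw [LinearMap.add_apply, gmap_of_mem _ _ hx, gmap_of_mem _ _ hx, gmap_of_mem _ _ hx]
    exact (gproj N.grading (j + i)).map_add _ _
  map_smul' c f := gext K.grading fun j x hx => by
    rw [RingHom.id_apply, LinearMap.smul_apply, gmap_of_mem _ _ hx, gmap_of_mem _ _ hx]
    exact (gproj N.grading (j + i)).map_smul _ _

lemma homProj_of_mem (i : ℤ) (f : K →ₗ[k] N) {j : ℤ} {x : K} (hx : x ∈ K.grading j) :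
    homProj K N i f x = gproj N.grading (j + i) (f x) := gmap_of_mem K.grading _ hx

lemma homProj_same {i : ℤ} {f : K →ₗ[k] N} (hf : f ∈ homDeg K N i) : homProj K N i f = f :=
  gext K.grading fun j x hx => by rw [homProj_of_mem K N i f hx, gproj_same _ (hf.2 j x hx)]

lemma homProj_other {i l : ℤ} (h : i ≠ l) {f : K →ₗ[k] N} (hf : f ∈ homDeg K N i) :
    homProj K N l f = 0 :=
  gext K.grading fun j x hx => by
    rw [homProj_of_mem K N l f hx, gproj_other _ (show j + i ≠ j + l by omega) (hf.2 j x hx),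
      LinearMap.zero_apply]

/-- The differential `f ↦ d f - (-1)^{|f|} f d`. -/
def homD : (K →ₗ[k] N) →ₗ[k] K →ₗ[k] N where
  toFun f := N.d ∘ₗ f - twist N.grading 1 ∘ₗ f ∘ₗ twist K.grading 1 ∘ₗ K.d
  map_add' f g := by
    ext x
    simp only [LinearMap.sub_apply, LinearMap.comp_apply, LinearMap.add_apply, map_add]
    abel
  map_smul' c f := by
    ext x
    simp only [LinearMap.sub_apply, LinearMap.comp_apply, LinearMap.smul_apply, map_smul,
      RingHom.id_apply, smul_sub]

variable {K N}

lemma homD_of_mem {i : ℤ} {f : K →ₗ[k] N} (hf : f ∈ homDeg K N i) (x : K) :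
    homD K N f x = N.d (f x) - ksign k i • f (K.d x) :=
  LinearMap.congr_fun (f := homD K N f) (g := N.d ∘ₗ f - ksign k i • (f ∘ₗ K.d))
    (gext K.grading fun j x hx => by
      change N.d (f x) - twist N.grading 1 (f (twist K.grading 1 (K.d x))) =
        N.d (f x) - ksign k i • f (K.d x)
      rw [twist_of_mem _ _ (K.d_mem hx), map_smul, map_smul,
        twist_of_mem _ _ (hf.2 _ _ (K.d_mem hx)), smul_smul, one_mul, one_mul, ksign_add (j + 1) i,
        ← mul_assoc, ksign_mul_self, one_mul]) x

lemma homD_mem {i : ℤ} {f : K →ₗ[k] N} (hf : f ∈ homDeg K N i) :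
    homD K N f ∈ homDeg K N (i + 1) := by
  refine ⟨fun b x => ?_, fun j x hx => ?_⟩
  · refine LinearMap.congr_fun (f := homD K N f ∘ₗ K.ract b) (g := N.ract b ∘ₗ homD K N f)
      (gext K.grading fun j x hx => ?_) x
    rw [LinearMap.comp_apply, LinearMap.comp_apply, ract_apply, ract_apply, homD_of_mem hf,
      homD_of_mem hf, hf.1, N.d_rsmul (hf.2 j x hx), K.d_rsmul hx, map_add, f.map_smul, hf.1, hf.1,
      smul_sub, smul_add, smul_smul, ksign_add, mul_comm (ksign k i), smul_comm (op b)]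
    abel
  · rw [homD_of_mem hf]
    refine Submodule.sub_mem _ ?_ (Submodule.smul_mem _ _ ?_)
    · rw [← add_assoc]
      exact N.d_mem (hf.2 j x hx)
    · have := hf.2 _ _ (K.d_mem hx)
      rwa [add_right_comm, add_assoc] at this

lemma homD_homD {i : ℤ} {f : K →ₗ[k] N} (hf : f ∈ homDeg K N i) : homD K N (homD K N f) = 0 := by
  ext x
  rw [homD_of_mem (homD_mem hf), homD_of_mem hf, homD_of_mem hf, map_sub, map_smul, N.d_d, K.d_d,
    map_zero, smul_zero, ksign_add, ksign_one]
  simp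

lemma comp_lact_mem {i j : ℤ} {f : K →ₗ[k] N} (hf : f ∈ homDeg K N i) {a : A}
    (ha : a ∈ A.grading j) : f ∘ₗ K.lact a ∈ homDeg K N (i + j) :=
  ⟨fun b x => by
    rw [LinearMap.comp_apply, LinearMap.comp_apply, lact_apply, lact_apply, smul_comm, hf.1],
  fun l x hx => by
    have := hf.2 _ _ (K.smul_mem ha hx)
    rwa [show j + l + i = l + (i + j) by ring] at this⟩

lemma lact_comp_mem {i j : ℤ} {f : K →ₗ[k] N} (hf : f ∈ homDeg K N i) {c : C}
    (hc : c ∈ C.grading j) : N.lact c ∘ₗ f ∈ homDeg K N (j + i) :=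
  ⟨fun b x => by
    rw [LinearMap.comp_apply, LinearMap.comp_apply, lact_apply, lact_apply, hf.1, smul_comm],
  fun l x hx => by
    have := N.smul_mem hc (hf.2 _ _ hx)
    rwa [show j + (l + i) = l + (j + i) by ring] at this⟩

lemma comp_lact_mem_homSub {f : K →ₗ[k] N} (hf : f ∈ homSub K N) (a : A) :
    f ∘ₗ K.lact a ∈ homSub K N := by
  induction a using DirectSum.Decomposition.inductionOn A.grading with
  | zero => rw [map_zero, LinearMap.comp_zero]; exact Submodule.zero_mem _
  | add a b ha hb => rw [map_add, LinearMap.comp_add]; exact Submodule.add_mem _ ha hb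
  | homogeneous a =>
    exact homSub_map (LinearMap.lcomp k N (K.lact a)) (fun i f hf =>
      homDeg_le _ (comp_lact_mem hf a.2)) hf

lemma lact_comp_mem_homSub {f : K →ₗ[k] N} (hf : f ∈ homSub K N) (c : C) :
    N.lact c ∘ₗ f ∈ homSub K N := by
  induction c using DirectSum.Decomposition.inductionOn C.grading with
  | zero => rw [map_zero, LinearMap.zero_comp]; exact Submodule.zero_mem _
  | add a b ha hb => rw [map_add, LinearMap.add_comp]; exact Submodule.add_mem _ ha hb
  | homogeneous c =>
    exact homSub_map ((N.lact c).compRight k) (fun i f hf =>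
      homDeg_le _ (lact_comp_mem hf c.2)) hf

variable (K N)

/-- The underlying space of `Hom_B(K, N)`. -/
def HomCarrier : Type u := homSub K N

instance : AddCommGroup (HomCarrier K N) := inferInstanceAs (AddCommGroup (homSub K N))

instance : Module k (HomCarrier K N) := inferInstanceAs (Module k (homSub K N))

/-- The underlying linear map of an element of `Hom_B(K, N)`. -/
def hval : HomCarrier K N →ₗ[k] K →ₗ[k] N := (homSub K N).subtype

variable {K N}

/-- A right linear map as an element of `Hom_B(K, N)`. -/
def hmk (f : K →ₗ[k] N) (hf : f ∈ homSub K N) : HomCarrier K N := ⟨f, hf⟩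

lemma hval_mem (f : HomCarrier K N) : hval K N f ∈ homSub K N := f.2

lemma hval_injective : Function.Injective (hval K N) := Subtype.val_injective

lemma hval_ext {f g : HomCarrier K N} (h : ∀ x, hval K N f x = hval K N g x) : f = g :=
  hval_injective (LinearMap.ext h)

/-- The restriction to `Hom_B(K, N)` of an operator on linear maps. -/
def homRestrict {K' : DGBimod A B} {N' : DGBimod C B} (T : (K →ₗ[k] N) →ₗ[k] K' →ₗ[k] N')
    (h : ∀ f ∈ homSub K N, T f ∈ homSub K' N') : HomCarrier K N →ₗ[k] HomCarrier K' N' :=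
  (T ∘ₗ hval K N).codRestrict (homSub K' N') fun f => h _ (hval_mem f)

instance : SMul C (HomCarrier K N) :=
  ⟨fun c f => hmk (N.lact c ∘ₗ hval K N f) (lact_comp_mem_homSub (hval_mem f) c)⟩

instance : SMul Aᵐᵒᵖ (HomCarrier K N) :=
  ⟨fun a f => hmk (hval K N f ∘ₗ K.lact (unop a)) (comp_lact_mem_homSub (hval_mem f) (unop a))⟩

lemma hval_smul (c : C) (f : HomCarrier K N) (x : K) :
    hval K N (c • f) x = c • hval K N f x := rfl

lemma hval_rsmul (a : Aᵐᵒᵖ) (f : HomCarrier K N) (x : K) :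
    hval K N (a • f) x = hval K N f (unop a • x) := rfl

lemma hval_add (f g : HomCarrier K N) (x : K) :
    hval K N (f + g) x = hval K N f x + hval K N g x := rfl

lemma hval_zero (x : K) : hval K N (0 : HomCarrier K N) x = 0 := rfl

lemma hval_ksmul (c : k) (f : HomCarrier K N) (x : K) :
    hval K N (c • f) x = c • hval K N f x := rfl

instance : Module C (HomCarrier K N) where
  one_smul f := hval_ext fun x => by rw [hval_smul, one_smul]
  mul_smul c c' f := hval_ext fun x => by rw [hval_smul, hval_smul, hval_smul, mul_smul]
  smul_zero c := hval_ext fun x => by rw [hval_smul, hval_zero, smul_zero]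
  smul_add c f g := hval_ext fun x => by
    rw [hval_smul, hval_add, hval_add, hval_smul, hval_smul, smul_add]
  add_smul c c' f := hval_ext fun x => by
    rw [hval_smul, hval_add, hval_smul, hval_smul, add_smul]
  zero_smul f := hval_ext fun x => by rw [hval_smul, hval_zero, zero_smul]

instance : Module Aᵐᵒᵖ (HomCarrier K N) where
  one_smul f := hval_ext fun x => by rw [hval_rsmul, unop_one, one_smul]
  mul_smul c c' f := hval_ext fun x => by
    rw [hval_rsmul, hval_rsmul, hval_rsmul, unop_mul, mul_smul]
  smul_zero c := hval_ext fun x => by rw [hval_rsmul, hval_zero, hval_zero]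
  smul_add c f g := hval_ext fun x => by
    rw [hval_rsmul, hval_add, hval_add, hval_rsmul, hval_rsmul]
  add_smul c c' f := hval_ext fun x => by
    rw [hval_rsmul, hval_add, hval_rsmul, hval_rsmul, MulOpposite.unop_add, add_smul, map_add]
  zero_smul f := hval_ext fun x => by
    rw [hval_rsmul, hval_zero, MulOpposite.unop_zero, zero_smul, map_zero]

instance : IsScalarTower k C (HomCarrier K N) := ⟨fun c a f => hval_ext fun x => by
  rw [hval_smul, hval_ksmul, hval_smul, smul_assoc]⟩

instance : IsScalarTower k Aᵐᵒᵖ (HomCarrier K N) := ⟨fun c a f => hval_ext fun x => by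
  rw [hval_rsmul, hval_ksmul, hval_rsmul, unop_smul, smul_assoc, map_smul]⟩

instance : SMulCommClass C Aᵐᵒᵖ (HomCarrier K N) := ⟨fun _ _ _ => rfl⟩

end HomDeg

variable (K : DGBimod A B) (N : DGBimod C B)

/-- The dg bimodule `Hom_B(K, N)` of right linear maps, with `(c f a)(x) = c f(a x)` and
`(d f)(x) = d (f x) - (-1)^{|f|} f (d x)`. -/
def homObj : DGBimod C A where
  carrier := HomCarrier K N
  grading := fun i => (homDeg K N i).comap (hval K N)
  isInternal := isInternal_of_proj _
    (fun i => homRestrict (homProj K N i) fun f hf => homSub_map _ (fun j f hf => by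
      by_cases h : j = i
      · subst h
        rw [homProj_same K N hf]
        exact homDeg_le _ hf
      · rw [homProj_other K N h hf]
        exact Submodule.zero_mem _) hf)
    (fun i f hf => hval_injective (homProj_same K N hf))
    (fun i j h f hf => hval_injective (homProj_other K N h hf))
    (by
      refine eq_top_iff.2 fun f _ => ?_
      have : (⨆ i, (homDeg K N i).comap (hval K N)).map (hval K N) = homSub K N := by
        rw [Submodule.map_iSup]
        refine iSup_congr fun i => Submodule.map_comap_eq_self fun f hf => ?_
        exact ⟨hmk f (homDeg_le i hf), rfl⟩
      obtain ⟨g, hg, h⟩ := this.ge (hval_mem f)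
      rwa [← hval_injective h])
  smul_mem := fun hc hf => lact_comp_mem hf hc
  rsmul_mem := fun hf ha => comp_lact_mem hf ha
  d := homRestrict (homD K N) fun f hf =>
    homSub_map _ (fun i f hf => homDeg_le _ (homD_mem hf)) hf
  d_mem := fun hf => homD_mem hf
  d_d := fun f => hval_injective (by
    have : homD K N (homD K N (hval K N f)) ∈ (⊥ : Submodule k _) :=
      homSub_map (homD K N ∘ₗ homD K N) (fun i f hf => (Submodule.mem_bot k).2 (homD_homD hf))
        (hval_mem f)
    exact (Submodule.mem_bot k).1 this)
  d_smul := by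
    intro i c hc f
    refine hval_injective ?_
    let T : (K →ₗ[k] N) →ₗ[k] K →ₗ[k] N := homD K N ∘ₗ (N.lact c).compRight k -
      (N.lact (C.d c)).compRight k - ksign k i • ((N.lact c).compRight k ∘ₗ homD K N)
    have : T (hval K N f) ∈ (⊥ : Submodule k _) := homSub_map T (fun j f hf => by
      rw [Submodule.mem_bot]
      ext x
      change homD K N (N.lact c ∘ₗ f) x - C.d c • f x - ksign k i • (c • homD K N f x) = 0
      rw [homD_of_mem (lact_comp_mem hf hc), homD_of_mem hf, LinearMap.comp_apply,
        LinearMap.comp_apply, lact_apply, lact_apply, N.d_smul hc, ksign_add, smul_sub, smul_sub,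
        smul_comm c (ksign k j), smul_smul]
      abel) (hval_mem f)
    have h := (Submodule.mem_bot k).1 this
    exact sub_eq_iff_eq_add'.1 (sub_eq_zero.1 h)
  d_rsmul := by
    intro i f hf a
    refine hval_injective (LinearMap.ext fun x => ?_)
    have hf' : hval K N f ∈ homDeg K N i := hf
    change homD K N (hval K N f ∘ₗ K.lact a) x =
      homD K N (hval K N f) (a • x) + ksign k i • hval K N f (A.d a • x)
    let T : A →ₗ[k] K →ₗ[k] N := homD K N ∘ₗ LinearMap.llcomp k K K N (hval K N f) ∘ₗ K.lact -
      (LinearMap.llcomp k K K N (homD K N (hval K N f)) ∘ₗ K.lact +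
        ksign k i • (LinearMap.llcomp k K K N (hval K N f) ∘ₗ K.lact ∘ₗ A.d))
    have : T = 0 := gext A.grading fun j a ha => LinearMap.ext fun x => by
      change homD K N (hval K N f ∘ₗ K.lact a) x -
        (homD K N (hval K N f) (a • x) + ksign k i • hval K N f (A.d a • x)) = 0
      rw [homD_of_mem (comp_lact_mem hf' ha), homD_of_mem hf', LinearMap.comp_apply,
        LinearMap.comp_apply, lact_apply, lact_apply, K.d_smul ha, map_add,
        (hval K N f).map_smul, ksign_add, smul_add,
        smul_smul]
      abel
    exact sub_eq_zero.1 (LinearMap.congr_fun (LinearMap.congr_fun this a) x)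

variable {K N}

/-- Evaluation of elements of `Hom_B(K, N)`. -/
def hev : homObj K N →ₗ[k] K →ₗ[k] N := hval K N

lemma hev_ext {f g : homObj K N} (h : ∀ x, hev f x = hev g x) : f = g := hval_ext h

lemma hev_map_rsmul (f : homObj K N) (b : B) (x : K) : hev f (op b • x) = op b • hev f x :=
  homSub_rsmul (hval_mem f) b x

lemma hev_mem {i j : ℤ} {f : homObj K N} (hf : f ∈ (homObj K N).grading i) {x : K}
    (hx : x ∈ K.grading j) : hev f x ∈ N.grading (j + i) := hf.2 j x hx

lemma hev_d {i : ℤ} {f : homObj K N} (hf : f ∈ (homObj K N).grading i) (x : K) :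
    hev ((homObj K N).d f) x = N.d (hev f x) - ksign k i • hev f (K.d x) := homD_of_mem hf x

/-- The element of `Hom_B(K, N)` given by a homogeneous right linear map. -/
def homEl {i : ℤ} (f : K →ₗ[k] N) (hf : f ∈ homDeg K N i) : homObj K N := hmk f (homDeg_le i hf)

lemma homEl_mem {i : ℤ} (f : K →ₗ[k] N) (hf : f ∈ homDeg K N i) :
    homEl f hf ∈ (homObj K N).grading i := hf

end DGBimod

/-! ### The adjunction between tensor products and right linear maps -/

namespace DGBimod

open DGAlg

variable {k : Type u} [Field k] {A B C : DGAlg k}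

section Adjunction

variable (K : DGBimod A B)

/-- Composition with a morphism. -/
def homMap {N N' : DGBimod C B} (φ : N ⟶ N') : homObj K N ⟶ homObj K N' :=
  have h : ∀ i, ∀ f ∈ homDeg K N i, (lin φ).compRight k f ∈ homDeg K N' i := fun i f hf =>
    ⟨fun b x => (congrArg (lin φ) (hf.1 b x)).trans (lin_map_rsmul φ (op b) (f x)),
      fun j x hx => lin_mem φ (hf.2 j x hx)⟩
  Hom.mk (homRestrict ((lin φ).compRight k) fun f hf =>
      homSub_map _ (fun i f hf => homDeg_le i (h i f hf)) hf)
    (fun c f => hval_ext fun x => lin_map_smul φ c _)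
    (fun a f => rfl)
    (fun {i f} hf => h i _ hf)
    (fun f => hval_ext fun x => by
      let T : (K →ₗ[k] N) →ₗ[k] K →ₗ[k] N' := (lin φ).compRight k ∘ₗ homD K N -
        homD K N' ∘ₗ (lin φ).compRight k
      have : T (hval K N f) ∈ (⊥ : Submodule k _) := homSub_map T (fun i f hf => by
        rw [Submodule.mem_bot]
        ext x
        change lin φ (homD K N f x) - homD K N' ((lin φ).compRight k f) x = 0
        rw [homD_of_mem hf, homD_of_mem (h i f hf), map_sub, (lin φ).map_smul, lin_d]
        exact sub_self _) (hval_mem f)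
      exact sub_eq_zero.1 (LinearMap.congr_fun ((Submodule.mem_bot k).1 this) x))

lemma hev_homMap {N N' : DGBimod C B} (φ : N ⟶ N') (f : homObj K N) (x : K) :
    hev (lin (homMap K φ) f) x = lin φ (hev f x) := rfl

/-- The functor `Hom_B(K, -)`. -/
def homFun : DGBimod C B ⥤ DGBimod C A where
  obj N := homObj K N
  map φ := homMap K φ
  map_id _ := rfl
  map_comp _ _ := rfl

variable (M : DGBimod C A) (N : DGBimod C B)

lemma tm_mem_homDeg {i : ℤ} {m : M} (hm : m ∈ M.grading i) :
    tm M K m ∈ homDeg K (tensorObj M K) i :=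
  ⟨fun b x => (rsmul_tm (op b) m x).symm, fun j x hx => by
    rw [add_comm]
    exact tm_mem hm hx⟩

lemma tm_mem_homSub (m : M) : tm M K m ∈ homSub K (tensorObj M K) := by
  induction m using DirectSum.Decomposition.inductionOn M.grading with
  | zero => rw [map_zero]; exact Submodule.zero_mem _
  | add m m' h h' => rw [map_add]; exact Submodule.add_mem _ h h'
  | homogeneous m => exact homDeg_le _ (tm_mem_homDeg K M m.2)

/-- The linear map underlying the unit of the adjunction. -/
def homUnitLin : M →ₗ[k] homObj K (tensorObj M K) :=
  LinearMap.codRestrict (homSub K (tensorObj M K)) (tm M K) (tm_mem_homSub K M)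

lemma hev_homUnitLin (m : M) (x : K) : hev (homUnitLin K M m) x = tm M K m x := rfl

/-- The unit `M → Hom_B(K, M ⊗_A K)` of the adjunction. -/
def homUnit : M ⟶ homObj K (tensorObj M K) :=
  Hom.mk (homUnitLin K M) (fun c m => hev_ext fun x => rfl)
    (fun a m => hev_ext fun x => tm_balanced a m x) (fun hm => tm_mem_homDeg K M hm)
    (fun m => LinearMap.congr_fun (f := homUnitLin K M ∘ₗ M.d)
      (g := (homObj K (tensorObj M K)).d ∘ₗ homUnitLin K M)
      (gext M.grading fun i m hm => hev_ext fun x => by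
        rw [LinearMap.comp_apply, LinearMap.comp_apply,
          hev_d (f := homUnitLin K M m) (tm_mem_homDeg K M hm), hev_homUnitLin, hev_homUnitLin,
          hev_homUnitLin, d_tm hm, add_sub_cancel_right]) m)

/-- The counit `Hom_B(K, N) ⊗_A K → N` of the adjunction, given by evaluation. -/
def homCounit : tensorObj (homObj K N) K ⟶ N :=
  tHom hev (fun a f x => rfl) (fun c f x => rfl) (fun b f x => hev_map_rsmul f b x)
    (fun i f hf j x hx => by rw [add_comm]; exact hev_mem hf hx)
    (fun i f hf j x hx => by rw [hev_d hf, sub_add_cancel])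

/-- The functor `Hom_B(K, -)` is right adjoint to `- ⊗_A K`. -/
def homAdj : (tensorFun K : DGBimod C A ⥤ DGBimod C B) ⊣ homFun K :=
  Adjunction.mkOfUnitCounit
    { unit :=
        { app := fun M => homUnit K M
          naturality := fun _ _ _ => hom_ext fun _ => hev_ext fun _ => rfl }
      counit :=
        { app := fun N => homCounit K N
          naturality := fun _ _ _ => tensorHom_ext fun _ _ => rfl }
      left_triangle := by
        ext1
        funext M
        exact tensorHom_ext fun _ _ => rfl
      right_triangle := by
        ext1
        funext N
        exact hom_ext fun _ => hev_ext fun _ => rfl }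

end Adjunction

section Projective

variable {K : DGBimod A B}

/-- Closed right linear maps of any degree to an acyclic dg bimodule are boundaries. -/
lemma RightProjective.exists_primitive (hK : RightProjective K) {N : DGBimod C B}
    (hN : Acyclic N) {i : ℤ}
    {f : K →ₗ[k] N} (hf : f ∈ homDeg K N i) (hd : homD K N f = 0) :
    ∃ h ∈ homDeg K N (i - 1), homD K N h = f := by
  -- `f` is a closed map of degree `0` to the shift `N[i]`
  obtain ⟨h, h₁, h₂, h₃⟩ := hK C (N.shiftObj i) (hN.shift i) ((N.toShift i).toLinearMap ∘ₗ f)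
    (fun b m => congrArg (N.toShift i) (hf.1 b m))
    (fun j m hm => (toShift_mem N i).2 (hf.2 j m hm))
    (fun m => by
      have h := LinearMap.congr_fun hd m
      rw [homD_of_mem hf, LinearMap.zero_apply, sub_eq_zero] at h
      rw [LinearMap.comp_apply, LinearMap.comp_apply, LinearEquiv.coe_coe, d_toShift, h, map_smul,
        smul_smul, ksign_mul_self, one_smul])
  let g : K →ₗ[k] N := (N.toShift i).symm.toLinearMap ∘ₗ h
  have hg : ∀ m, h m = N.toShift i (g m) := fun m => ((N.toShift i).apply_symm_apply _).symm
  have hgm : ksign k i • g ∈ homDeg K N (i - 1) := Submodule.smul_mem _ _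
    ⟨fun b m => (N.toShift i).injective (by rw [← hg, h₁, hg, rsmul_toShift]),
      fun j m hm => by
        have := h₂ j m hm
        rw [hg, toShift_mem] at this
        rwa [show j - 1 + i = j + (i - 1) by ring] at this⟩
  refine ⟨ksign k i • g, hgm, LinearMap.ext fun m => (N.toShift i).injective ?_⟩
  have := h₃ m
  rw [hg, hg, d_toShift] at this
  rw [homD_of_mem hgm, LinearMap.smul_apply, LinearMap.smul_apply, smul_smul, ksign_sub_one,
    neg_mul, ksign_mul_self, neg_one_smul, sub_neg_eq_add, map_add, N.d.map_smul,
    (N.toShift i).map_smul]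
  exact this

/-- Right linear maps out of a homotopically projective dg bimodule preserve
quasi-isomorphisms. -/
lemma RightProjective.quasiIso_homMap (hK : RightProjective K) {N N' : DGBimod C B}
    (φ : N ⟶ N') (hφ : quasiIso C B φ) :
    quasiIso C A (homMap K φ) := by
  rw [quasiIso_iff_acyclic_cone] at hφ ⊢
  refine acyclic_of_homogeneous fun i x hx hd => ?_
  obtain ⟨g, f, rfl⟩ := exists_eq_cIn_add_cSh (homMap K φ) x
  rw [add_mem_cone_grading] at hx
  obtain ⟨hg, hf⟩ := hx
  rw [map_add, d_cIn, d_cSh, ← add_sub_assoc, ← map_add] at hd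
  have hd₁ : (homObj K N').d g + lin (homMap K φ) f = 0 := by
    simpa using congrArg (coneDesc (homMap K φ) LinearMap.id (0 : _ →ₗ[k] homObj K N')) hd
  have hd₂ : (homObj K N).d f = 0 := by
    simpa using congrArg (coneDesc (homMap K φ) (0 : _ →ₗ[k] homObj K N) LinearMap.id) hd
  -- a cocycle of the cone of `Hom(K, φ)` is a closed map from `K` to the cone of `φ`
  let F : K →ₗ[k] cone φ := cIn φ ∘ₗ hev g + cSh φ ∘ₗ hev f
  have hF : ∀ y, F y = cIn φ (hev g y) + cSh φ (hev f y) := fun _ => rfl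
  have hFm : F ∈ homDeg K (cone φ) i :=
    ⟨fun b y => by
      rw [hF, hF, hev_map_rsmul, hev_map_rsmul, smul_add, rsmul_cIn, rsmul_cSh],
    fun j y hy => (add_mem_cone_grading φ).2 ⟨hev_mem hg hy, by
      have := hev_mem hf hy
      rwa [← add_assoc] at this⟩⟩
  have hFd : homD K (cone φ) F = 0 := LinearMap.ext fun y => by
    have e₁ := congrArg (fun z => hev z y) hd₁
    have e₂ := congrArg (fun z => hev z y) hd₂
    simp only [map_add, LinearMap.add_apply, map_zero, LinearMap.zero_apply] at e₁ e₂
    rw [hev_d hg, hev_homMap] at e₁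
    rw [hev_d hf, ksign_add, ksign_one, mul_neg_one, neg_smul, sub_neg_eq_add] at e₂
    have e₃ : N'.d (hev g y) + lin φ (hev f y) = ksign k i • hev g (K.d y) := by
      rw [← sub_eq_zero, ← e₁]
      abel
    rw [homD_of_mem hFm, hF, hF, map_add, d_cIn, d_cSh, LinearMap.zero_apply, smul_add,
      eq_neg_of_add_eq_zero_left e₂, map_neg, ← add_sub_assoc, ← map_add, e₃, (cIn φ).map_smul,
      (cSh φ).map_smul]
    abel
  obtain ⟨h, hh, hhd⟩ := hK.exists_primitive hφ hFm hFd
  let p₁ : cone φ →ₗ[k] N' := coneDesc φ LinearMap.id 0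
  let p₂ : cone φ →ₗ[k] N := coneDesc φ 0 LinearMap.id
  have hp : ∀ y, h y = cIn φ (p₁ (h y)) + cSh φ (p₂ (h y)) := fun y => by
    obtain ⟨a, b, e⟩ := exists_eq_cIn_add_cSh φ (h y)
    rw [e]
    simp [p₁, p₂]
  have hm : ∀ j, ∀ y ∈ K.grading j, p₁ (h y) ∈ N'.grading (j + (i - 1)) ∧
      p₂ (h y) ∈ N.grading (j + i) := fun j y hy => by
    have := hh.2 j y hy
    rw [hp, add_mem_cone_grading] at this
    rwa [show j + (i - 1) + 1 = j + i by ring] at this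
  have hr : ∀ (b : B) y, p₁ (h (op b • y)) = op b • p₁ (h y) ∧
      p₂ (h (op b • y)) = op b • p₂ (h y) := fun b y => by
    rw [hh.1, hp y, smul_add, rsmul_cIn, rsmul_cSh]
    simp [p₁, p₂]
  have hm₁ : p₁ ∘ₗ h ∈ homDeg K N' (i - 1) :=
    ⟨fun b y => (hr b y).1, fun j y hy => (hm j y hy).1⟩
  have hm₂ : p₂ ∘ₗ h ∈ homDeg K N i := ⟨fun b y => (hr b y).2, fun j y hy => (hm j y hy).2⟩
  refine ⟨cIn _ (homEl _ hm₁) + cSh _ (homEl _ hm₂), ?_⟩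
  have key : ∀ y, N'.d (p₁ (h y)) + lin φ (p₂ (h y)) - ksign k (i - 1) • p₁ (h (K.d y)) =
      hev g y ∧ -N.d (p₂ (h y)) - ksign k (i - 1) • p₂ (h (K.d y)) = hev f y := fun y => by
    have := LinearMap.congr_fun hhd y
    rw [homD_of_mem hh, hp y, hp (K.d y), map_add, d_cIn, d_cSh, hF] at this
    have e₁ := congrArg p₁ this
    have e₂ := congrArg p₂ this
    simp only [p₁, p₂, map_add, map_sub, map_smul, coneDesc_cIn, coneDesc_cSh,
      LinearMap.zero_apply, LinearMap.id_apply, add_zero, zero_add, sub_zero, zero_sub] at e₁ e₂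
    exact ⟨e₁, e₂⟩
  rw [map_add, d_cIn, d_cSh, ← add_sub_assoc, ← map_add, sub_eq_add_neg, ← map_neg]
  congr 2
  · refine hev_ext fun y => ?_
    rw [map_add, LinearMap.add_apply, hev_d (homEl_mem _ hm₁), hev_homMap, ← (key y).1]
    change N'.d (p₁ (h y)) - ksign k (i - 1) • p₁ (h (K.d y)) + lin φ (p₂ (h y)) = _
    abel
  · refine hev_ext fun y => ?_
    rw [map_neg, LinearMap.neg_apply, hev_d (homEl_mem _ hm₂), ← (key y).2, ksign_sub_one]
    change -(N.d (p₂ (h y)) - ksign k i • p₂ (h (K.d y))) = _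
    rw [neg_smul, sub_neg_eq_add]
    abel

end Projective

end DGBimod

/-! ### Derived functors by resolutions -/

/-- A functor on a localization is a left derived functor of `F` if the comparison map is an
isomorphism on resolutions, along which all morphisms can be lifted. -/
lemma isLeftDerivedFunctor_of_resolutions {C D H : Type*} [Category* C] [Category* D] [Category* H]
    (W : MorphismProperty C) (L : C ⥤ D) [L.IsLocalization W] {F : C ⥤ H} (LF : D ⥤ H)
    (α : L ⋙ LF ⟶ F) (R : C → C) (p : ∀ X, R X ⟶ X) (hp : ∀ X, W (p X))
    (lift : ∀ {X Y : C} (f : X ⟶ Y), ∃ g : R X ⟶ R Y, g ≫ p Y = p X ≫ f)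
    (hα : ∀ X, IsIso (α.app (R X))) : LF.IsLeftDerivedFunctor α W := by
  have hLp : ∀ X, IsIso (L.map (p X)) := fun X => Localization.inverts L W _ (hp X)
  have nat : ∀ X, LF.map (L.map (p X)) ≫ α.app X = α.app (R X) ≫ F.map (p X) :=
    fun X => α.naturality (p X)
  let τ (G : D ⥤ H) (β : L ⋙ G ⟶ F) : L ⋙ G ⟶ L ⋙ LF :=
    { app := fun X => inv (G.map (L.map (p X))) ≫ β.app (R X) ≫ inv (α.app (R X)) ≫
        LF.map (L.map (p X))
      naturality := fun X Y f => by
        obtain ⟨g, hg⟩ := lift f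
        have h₁ : G.map (L.map g) ≫ G.map (L.map (p Y)) =
            G.map (L.map (p X)) ≫ G.map (L.map f) := by
          rw [← G.map_comp, ← G.map_comp, ← L.map_comp, ← L.map_comp, hg]
        have h₂ : LF.map (L.map g) ≫ LF.map (L.map (p Y)) =
            LF.map (L.map (p X)) ≫ LF.map (L.map f) := by
          rw [← LF.map_comp, ← LF.map_comp, ← L.map_comp, ← L.map_comp, hg]
        have h₃ : G.map (L.map g) ≫ β.app (R Y) = β.app (R X) ≫ F.map g := β.naturality g
        have h₄ : LF.map (L.map g) ≫ α.app (R Y) = α.app (R X) ≫ F.map g := α.naturality g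
        have h₅ : F.map g ≫ inv (α.app (R Y)) = inv (α.app (R X)) ≫ LF.map (L.map g) := by
          rw [IsIso.eq_inv_comp, ← Category.assoc, ← h₄, Category.assoc, IsIso.hom_inv_id,
            Category.comp_id]
        change G.map (L.map f) ≫ _ = _ ≫ LF.map (L.map f)
        have h₆ : G.map (L.map f) ≫ inv (G.map (L.map (p Y))) =
            inv (G.map (L.map (p X))) ≫ G.map (L.map g) := by
          rw [IsIso.eq_inv_comp, ← Category.assoc, ← h₁, Category.assoc, IsIso.hom_inv_id,
            Category.comp_id]
        simp only [Category.assoc]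
        rw [← Category.assoc, h₆, Category.assoc, ← Category.assoc (G.map (L.map g)), h₃,
          Category.assoc, ← Category.assoc (F.map g), h₅, Category.assoc, h₂] }
  rw [Functor.isLeftDerivedFunctor_iff_isRightKanExtension]
  refine ⟨⟨IsTerminal.ofUniqueHom (fun X => CostructuredArrow.homMk
    (Localization.liftNatTrans L W (L ⋙ X.left) (L ⋙ LF) X.left LF (τ X.left X.hom)) ?_) ?_⟩⟩
  · ext Y
    have e : (Localization.liftNatTrans L W (L ⋙ X.left) (L ⋙ LF) X.left LF
        (τ X.left X.hom)).app (L.obj Y) = (τ X.left X.hom).app Y := by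
      rw [Localization.liftNatTrans_app]
      exact (Category.id_comp _).trans (Category.comp_id _)
    change (Localization.liftNatTrans L W (L ⋙ X.left) (L ⋙ LF) X.left LF
        (τ X.left X.hom)).app (L.obj Y) ≫ α.app Y = X.hom.app Y
    rw [e]
    change (inv (X.left.map (L.map (p Y))) ≫ X.hom.app (R Y) ≫ inv (α.app (R Y)) ≫
      LF.map (L.map (p Y))) ≫ α.app Y = X.hom.app Y
    simp only [Category.assoc]
    rw [nat, IsIso.inv_hom_id_assoc, IsIso.inv_comp_eq]
    exact (X.hom.naturality (p Y)).symm
  · intro X m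
    refine CostructuredArrow.hom_ext _ _ ?_
    refine Localization.natTrans_ext L W fun Y => ?_
    have e : (Localization.liftNatTrans L W (L ⋙ X.left) (L ⋙ LF) X.left LF
        (τ X.left X.hom)).app (L.obj Y) = (τ X.left X.hom).app Y := by
      rw [Localization.liftNatTrans_app]
      exact (Category.id_comp _).trans (Category.comp_id _)
    refine Eq.trans ?_ e.symm
    let μ : X.left ⟶ LF := m.left
    have w : μ.app (L.obj (R Y)) ≫ α.app (R Y) = X.hom.app (R Y) :=
      NatTrans.congr_app (CostructuredArrow.w m) (R Y)
    have e' : μ.app (L.obj Y) = inv (X.left.map (L.map (p Y))) ≫ X.hom.app (R Y) ≫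
        inv (α.app (R Y)) ≫ LF.map (L.map (p Y)) := by
      rw [IsIso.eq_inv_comp, ← w, Category.assoc, IsIso.hom_inv_id_assoc]
      exact μ.naturality (L.map (p Y))
    exact e'

namespace DGBimod

open DGAlg DCat

variable {k : Type u} [Field k] {A B C : DGAlg k}

/-- The comparison of tensor products induced by a morphism of dg bimodules. -/
def tensorFunMap {K K' : DGBimod A B} (g : K ⟶ K') :
    (tensorFun K : DGBimod C A ⥤ DGBimod C B) ⟶ tensorFun K' where
  app M := tensorMapRight M g
  naturality _ _ f := tensorMap_comp_tensorMapRight f g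

/-- The derived tensor product can be computed by a semifree resolution of the bimodule. -/
lemma isDerivedTensor_res (K : DGBimod A B) : IsDerivedTensor K
    (leftFlat_res K).isExact.derived
    ((leftFlat_res K).isExact.derivedIso.hom ≫
      Functor.whiskerRight (tensorFunMap (resπ K)) (Q (ground k) B)) := by
  refine isLeftDerivedFunctor_of_resolutions _ _ _ _ (fun M => res M) (fun M => resπ M)
    (fun M => quasiIso_resπ M) (fun f => ⟨resMap f, resMap_resπ f⟩) fun M => ?_
  have h := isIso_Q_map _ ((rightFlat_res M).quasiIso_tensorMapRight (resπ K) (quasiIso_resπ K))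
  have h' : IsIso ((leftFlat_res K).isExact.derivedIso.hom.app (res M)) := inferInstance
  rw [NatTrans.comp_app]
  exact @IsIso.comp_isIso _ _ _ _ _ _ _ h' h

/-- If the derived tensor product with `K` is an equivalence, then it is induced by the tensor
product with the semifree resolution of `K`. -/
lemma isEquivalence_derived_res {K : DGBimod A B} {Φ : A.D ⥤ B.D}
    {α : Q (ground k) A ⋙ Φ ⟶ (tensorFun K : A.RMod ⥤ B.RMod) ⋙ Q (ground k) B}
    (h : IsDerivedTensor K Φ α) (hΦ : Φ.IsEquivalence) :
    ((leftFlat_res K).isExact (A := ground k)).derived.IsEquivalence := by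
  have h₁ : Φ.IsLeftDerivedFunctor α (quasiIso (ground k) A) := h
  let β := ((leftFlat_res K).isExact (A := ground k)).derivedIso.hom ≫
    Functor.whiskerRight (tensorFunMap (resπ K)) (Q (ground k) B)
  have h₂ : (leftFlat_res K).isExact.derived.IsLeftDerivedFunctor β (quasiIso (ground k) A) :=
    isDerivedTensor_res K
  exact Functor.isEquivalence_of_iso (Functor.leftDerivedUnique
    (leftFlat_res K).isExact.derived Φ α β (quasiIso (ground k) A))

section Equivalence

variable {K : DGBimod A B}

/-- If the derived tensor product with `K` is an equivalence, then the unit and the counit of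
the adjunction between right dg modules are quasi-isomorphisms. -/
lemma quasiIso_unit_counit_aux (hK : LeftFlat K) (hK' : RightProjective K)
    (h : (hK.isExact (A := ground k)).derived.IsEquivalence) :
    (∀ M : A.RMod, quasiIso _ _ (homUnit K M)) ∧ ∀ N : B.RMod, quasiIso _ _ (homCounit K N) := by
  let L := (hK.isExact (A := ground k)).derived
  have hR : (quasiIso (ground k) B).IsInvertedBy (homFun K ⋙ Q (ground k) A) :=
    fun _ _ f hf => isIso_Q_map _ (hK'.quasiIso_homMap f hf)
  let R : B.D ⥤ A.D := Localization.lift (homFun K ⋙ Q (ground k) A) hR (Q (ground k) B)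
  let _ : CatCommSq (tensorFun K) (Q (ground k) A) (Q (ground k) B) L :=
    ⟨(hK.isExact (A := ground k)).derivedIso.symm⟩
  let _ : CatCommSq (homFun K) (Q (ground k) B) (Q (ground k) A) R :=
    ⟨(Localization.fac (homFun K ⋙ Q (ground k) A) hR (Q (ground k) B)).symm⟩
  let adj : L ⊣ R := (homAdj K).localization (Q (ground k) A) (quasiIso (ground k) A)
    (Q (ground k) B) (quasiIso (ground k) B) L R
  let eL := CatCommSq.iso (tensorFun K) (Q (ground k) A) (Q (ground k) B) L
  let eR := CatCommSq.iso (homFun K) (Q (ground k) B) (Q (ground k) A) R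
  have hL : L.IsEquivalence := h
  have hR' : R.IsEquivalence := adj.isEquivalence_right_of_isEquivalence_left
  constructor
  · intro M
    refine quasiIso_of_isIso_Q_map _ ?_
    have h₁ : IsIso (adj.unit.app ((Q (ground k) A).obj M)) := inferInstance
    rw [Adjunction.localization_unit_app] at h₁
    have h₂ : IsIso (eR.hom.app (tensorObj M K)) := NatIso.hom_app_isIso eR _
    have h₃ : IsIso (eL.hom.app M) := NatIso.hom_app_isIso eL _
    have h₄ : IsIso (R.map (eL.hom.app M)) := Functor.map_isIso R _
    have h₅ := @IsIso.comp_isIso _ _ _ _ _ _ _ h₂ h₄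
    exact (@isIso_comp_right_iff _ _ _ _ _ _ _ h₅).1 h₁
  · intro N
    refine quasiIso_of_isIso_Q_map _ ?_
    have h₁ : IsIso (adj.counit.app ((Q (ground k) B).obj N)) := inferInstance
    rw [Adjunction.localization_counit_app, ← Category.assoc] at h₁
    have h₂ : IsIso (eR.inv.app N) := NatIso.inv_app_isIso eR _
    have h₃ : IsIso (eL.inv.app (homObj K N)) := NatIso.inv_app_isIso eL _
    have h₄ : IsIso (L.map (eR.inv.app N)) := Functor.map_isIso L _
    have h₅ := @IsIso.comp_isIso _ _ _ _ _ _ _ h₄ h₃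
    exact (@isIso_comp_left_iff _ _ _ _ _ _ _ h₅).1 h₁

/-- Forgetting the left action commutes with `Hom_B(K, -)`. -/
def forgetLeftHom (K : DGBimod A B) (N : DGBimod C B) :
    (homObj K N).forgetLeft ≅ homObj K N.forgetLeft :=
  mkIso (M := (homObj K N).forgetLeft) (N := homObj K N.forgetLeft)
    (LinearEquiv.refl k (HomCarrier K N)) (fun _ _ => rfl) (fun _ _ => rfl) (fun _ _ => Iff.rfl)
    (fun _ => rfl)

lemma quasiIso_homUnit (hK' : RightProjective K)
    (h : ∀ M : A.RMod, quasiIso _ _ (homUnit K M)) (M : DGBimod C A) :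
    quasiIso C A (homUnit K M) := by
  rw [← quasiIso_forgetLeftMap]
  have e : forgetLeftMap (homUnit K M) ≫ (forgetLeftHom K (tensorObj M K)).hom =
      homUnit K M.forgetLeft ≫ homMap K (forgetLeftTensor M K).hom := hom_ext fun _ => rfl
  refine (quasiIso (ground k) A).of_postcomp _ (forgetLeftHom K (tensorObj M K)).hom
    (quasiIso_of_isIso _) ?_
  rw [e]
  exact (quasiIso (ground k) A).comp_mem _ _ (h _)
    (hK'.quasiIso_homMap _ (quasiIso_of_isIso _))

lemma quasiIso_homCounit (h : ∀ N : B.RMod, quasiIso _ _ (homCounit K N)) (N : DGBimod C B) :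
    quasiIso C B (homCounit K N) := by
  rw [← quasiIso_forgetLeftMap]
  have e : (tensorMap K (forgetLeftHom K N).inv ≫ (forgetLeftTensor (homObj K N) K).hom) ≫
      forgetLeftMap (homCounit K N) = homCounit K N.forgetLeft :=
    tensorHom_ext fun _ _ => rfl
  have : IsIso (tensorMap K (forgetLeftHom K N).inv) :=
    inferInstanceAs (IsIso ((tensorFun K).map (forgetLeftHom K N).inv))
  refine (quasiIso (ground k) B).of_precomp
    (tensorMap K (forgetLeftHom K N).inv ≫ (forgetLeftTensor (homObj K N) K).hom) _
    (quasiIso_of_isIso _) ?_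
  rw [e]
  exact h _

end Equivalence

/-! ### Mutually inverse dg bimodules -/

/-- Dg bimodules `K` and `L`, flat on both sides, with `K ⊗_B L` and `L ⊗_A K` connected to the
diagonal bimodules by cospans of quasi-isomorphisms. -/
structure InvPair (K : DGBimod A B) (L : DGBimod B A) : Prop where
  leftFlat : LeftFlat K
  rightFlat : RightFlat K
  leftFlat' : LeftFlat L
  rightFlat' : RightFlat L
  cospan : ∃ (H : DGBimod A A) (f : diag A ⟶ H) (g : tensorObj K L ⟶ H),
    quasiIso A A f ∧ quasiIso A A g
  cospan' : ∃ (H : DGBimod B B) (f : diag B ⟶ H) (g : tensorObj L K ⟶ H),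
    quasiIso B B f ∧ quasiIso B B g

lemma InvPair.symm {K : DGBimod A B} {L : DGBimod B A} (h : InvPair K L) : InvPair L K :=
  ⟨h.leftFlat', h.rightFlat', h.leftFlat, h.rightFlat, h.cospan', h.cospan⟩

/-- The morphism `K ⊗_B Hom_B(K, B) → Hom_B(K, K)` sending `x ⊗ f` to `y ↦ x f(y)`. -/
def coev (K : DGBimod A B) : tensorObj K (homObj K (diag B)) ⟶ homObj K K :=
  homUnit K (tensorObj K (homObj K (diag B))) ≫ homMap K ((assoc K (homObj K (diag B)) K).hom ≫
    tensorMapRight K (homCounit K (diag B)) ≫ (rightUnit K).hom)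

/-- A Morita equivalence is induced by a dg bimodule `K`, the inverse of which is a resolution of
`Hom_B(K, B)`. -/
lemma exists_invPair (h : A.MoritaEquivalent B) :
    ∃ (K : DGBimod A B) (L : DGBimod B A), InvPair K L := by
  obtain ⟨K₀, Φ, α, hΦ, hΦ'⟩ := h
  let K := res K₀
  have hK : RightProjective K := rightProjective_res K₀
  have hl : LeftFlat K := leftFlat_res K₀
  have hr : RightFlat K := rightFlat_res K₀
  obtain ⟨hu, hc⟩ := quasiIso_unit_counit_aux hl hK (isEquivalence_derived_res hΦ hΦ')
  let L₀ := homObj K (diag B)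
  have hc' : quasiIso B B (homCounit K (diag B)) := quasiIso_homCounit hc _
  refine ⟨K, res L₀, hl, hr, leftFlat_res L₀, rightFlat_res L₀,
    ⟨homObj K K, homUnit K (diag A) ≫ homMap K (leftUnit K).hom,
      tensorMapRight K (resπ L₀) ≫ coev K, ?_, ?_⟩,
    ⟨diag B, 𝟙 _, tensorMap K (resπ L₀) ≫ homCounit K (diag B), quasiIso_of_isIso _, ?_⟩⟩
  · exact (quasiIso A A).comp_mem _ _ (quasiIso_homUnit hK hu _)
      (hK.quasiIso_homMap _ (quasiIso_of_isIso _))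
  · exact (quasiIso A A).comp_mem _ _ (hr.quasiIso_tensorMapRight _ (quasiIso_resπ L₀))
      ((quasiIso A A).comp_mem _ _ (quasiIso_homUnit hK hu _) (hK.quasiIso_homMap _
        ((quasiIso A B).comp_mem _ _ (quasiIso_of_isIso _) ((quasiIso A B).comp_mem _ _
          (hr.quasiIso_tensorMapRight _ hc') (quasiIso_of_isIso _)))))
  · exact (quasiIso B B).comp_mem _ _ (hl.quasiIso_tensorMap _ (quasiIso_resπ L₀)) hc'

end DGBimod

/-! ### Perfectness of invertible dg bimodules -/

namespace DGBimod

open DGAlg DCat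

variable {k : Type u} [Field k] {A B C E : DGAlg k}

lemma lin_twist {M N : DGBimod A B} (f : M ⟶ N) (n : ℤ) (m : M) :
    lin f (twist M.grading n m) = twist N.grading n (lin f m) :=
  LinearMap.congr_fun (f := lin f ∘ₗ twist M.grading n) (g := twist N.grading n ∘ₗ lin f)
    (gext M.grading fun i m hm => by
      rw [LinearMap.comp_apply, LinearMap.comp_apply, twist_of_mem _ _ hm,
        twist_of_mem _ _ (lin_mem f hm), map_smul]) m

section Finite

variable (S : DGBimod C B) (T : DGBimod B E)

/-- The projection `S ⊗_k T → S ⊗_B T`. -/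
def tensorQuot : S ⊗[k] T →ₗ[k] tensorObj S T := (tensorRel S T).mkQ

lemma tensorQuot_surjective : Function.Surjective (tensorQuot S T) :=
  Submodule.mkQ_surjective (tensorRel S T)

variable {S T} in
lemma tensorQuot_eq_zero {x : S ⊗[k] T} : tensorQuot S T x = 0 ↔ x ∈ tensorRel S T :=
  Submodule.Quotient.mk_eq_zero (tensorRel S T)

/-- The differential of `S ⊗_k T`. -/
def preTensorD : S ⊗[k] T →ₗ[k] S ⊗[k] T :=
  TensorProduct.map S.d LinearMap.id + TensorProduct.map (twist S.grading 1) T.d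

lemma d_tensorQuot (x : S ⊗[k] T) :
    (tensorObj S T).d (tensorQuot S T x) = tensorQuot S T (preTensorD S T x) :=
  LinearMap.congr_fun (f := (tensorObj S T).d ∘ₗ tensorQuot S T)
    (g := tensorQuot S T ∘ₗ preTensorD S T) (TensorProduct.ext' fun _ _ => rfl) x

variable {S T} {W : DGBimod C B} {V : DGBimod B E} (j : W ⟶ S) (i : V ⟶ T)

lemma preTensorD_map (x : W ⊗[k] V) : preTensorD S T (TensorProduct.map (lin j) (lin i) x) =
    TensorProduct.map (lin j) (lin i) (preTensorD W V x) :=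
  LinearMap.congr_fun (f := preTensorD S T ∘ₗ TensorProduct.map (lin j) (lin i))
    (g := TensorProduct.map (lin j) (lin i) ∘ₗ preTensorD W V) (TensorProduct.ext' fun w v => by
      change S.d (lin j w) ⊗ₜ lin i v + twist S.grading 1 (lin j w) ⊗ₜ T.d (lin i v) =
        TensorProduct.map (lin j) (lin i) (W.d w ⊗ₜ v + twist W.grading 1 w ⊗ₜ V.d v)
      rw [map_add, TensorProduct.map_tmul, TensorProduct.map_tmul, lin_d, lin_d, lin_twist]) x

/-- The morphism `j ⊗ i`. -/
def tensorMap₂ : tensorObj W V ⟶ tensorObj S T := tensorMap V j ≫ tensorMapRight S i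

lemma lin_tensorMap₂_tensorQuot (x : W ⊗[k] V) : lin (tensorMap₂ j i) (tensorQuot W V x) =
    tensorQuot S T (TensorProduct.map (lin j) (lin i) x) :=
  LinearMap.congr_fun (f := lin (tensorMap₂ j i) ∘ₗ tensorQuot W V)
    (g := tensorQuot S T ∘ₗ TensorProduct.map (lin j) (lin i))
    (TensorProduct.ext' fun _ _ => rfl) x

/-- A property of pairs of submodules, seen as pairs of injective morphisms to `S` and `T`, which
holds for all pairs containing suitable finite subsets of `S` and `T`. -/
def EventuallyFinite (S : DGBimod C B) (T : DGBimod B E)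
    (P : ∀ (W : DGBimod C B) (V : DGBimod B E), (W ⟶ S) → (V ⟶ T) → Prop) : Prop :=
  ∃ (s : Set S) (t : Set T), s.Finite ∧ t.Finite ∧
    ∀ (W : DGBimod C B) (V : DGBimod B E) (j : W ⟶ S) (i : V ⟶ T),
      s ⊆ Set.range (lin j) → t ⊆ Set.range (lin i) → P W V j i

lemma EventuallyFinite.and_imp
    {P P' R : ∀ (W : DGBimod C B) (V : DGBimod B E), (W ⟶ S) → (V ⟶ T) → Prop}
    (h : EventuallyFinite S T P) (h' : EventuallyFinite S T P')
    (H : ∀ W V j i, P W V j i → P' W V j i → R W V j i) : EventuallyFinite S T R := by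
  obtain ⟨s, t, hs, ht, h⟩ := h
  obtain ⟨s', t', hs', ht', h'⟩ := h'
  exact ⟨s ∪ s', t ∪ t', hs.union hs', ht.union ht', fun W V j i hj hi => H W V j i
    (h W V j i (Set.subset_union_left.trans hj) (Set.subset_union_left.trans hi))
    (h' W V j i (Set.subset_union_right.trans hj) (Set.subset_union_right.trans hi))⟩

lemma eventuallyFinite_mem_range (x : S ⊗[k] T) : EventuallyFinite S T fun _ _ j i =>
    ∃ y, TensorProduct.map (lin j) (lin i) y = x := by
  induction x using TensorProduct.induction_on with
  | zero => exact ⟨∅, ∅, Set.finite_empty, Set.finite_empty, fun _ _ _ _ _ _ => ⟨0, map_zero _⟩⟩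
  | tmul s t =>
    refine ⟨{s}, {t}, Set.finite_singleton s, Set.finite_singleton t, fun W V j i hj hi => ?_⟩
    obtain ⟨w, hw⟩ := hj rfl
    obtain ⟨v, hv⟩ := hi rfl
    exact ⟨w ⊗ₜ v, by rw [TensorProduct.map_tmul, hw, hv]⟩
  | add x x' h h' =>
    exact h.and_imp h' fun W V j i ⟨y, hy⟩ ⟨y', hy'⟩ => ⟨y + y', by rw [map_add, hy, hy']⟩

lemma eventuallyFinite_mem_tensorRel {x : S ⊗[k] T} (hx : x ∈ tensorRel S T) :
    EventuallyFinite S T fun W V j i =>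
      ∃ y ∈ tensorRel W V, TensorProduct.map (lin j) (lin i) y = x := by
  induction hx using Submodule.span_induction with
  | zero =>
    exact ⟨∅, ∅, Set.finite_empty, Set.finite_empty, fun _ _ _ _ _ _ =>
      ⟨0, Submodule.zero_mem _, map_zero _⟩⟩
  | mem x hx =>
    obtain ⟨b, s, t, rfl⟩ := hx
    refine ⟨{s}, {t}, Set.finite_singleton s, Set.finite_singleton t, fun W V j i hj hi => ?_⟩
    obtain ⟨w, hw⟩ := hj rfl
    obtain ⟨v, hv⟩ := hi rfl
    refine ⟨_, Submodule.subset_span ⟨b, w, v, rfl⟩, ?_⟩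
    rw [map_sub, TensorProduct.map_tmul, TensorProduct.map_tmul, lin_map_rsmul, lin_map_smul,
      hw, hv]
  | add x x' _ _ h h' =>
    exact h.and_imp h' fun W V j i ⟨y, hy, e⟩ ⟨y', hy', e'⟩ =>
      ⟨y + y', Submodule.add_mem _ hy hy', by rw [map_add, e, e']⟩
  | smul c x _ h =>
    exact h.and_imp h fun W V j i ⟨y, hy, e⟩ _ =>
      ⟨c • y, Submodule.smul_mem _ c hy, by rw [map_smul, e]⟩

/-- A cocycle of a tensor product comes from a cocycle of the tensor product of submodules, as
soon as these contain certain finite subsets. -/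
lemma eventuallyFinite_cocycle {z : tensorObj S T} (hz : (tensorObj S T).d z = 0) {l : ℤ}
    (hl : z ∈ (tensorObj S T).grading l) : EventuallyFinite S T fun W V j i =>
      Function.Injective (lin j) → Function.Injective (lin i) →
        ∃ w ∈ (tensorObj W V).grading l, (tensorObj W V).d w = 0 ∧ lin (tensorMap₂ j i) w = z := by
  obtain ⟨x, rfl⟩ := tensorQuot_surjective S T z
  have hx : preTensorD S T x ∈ tensorRel S T := by
    rw [← tensorQuot_eq_zero, ← d_tensorQuot, hz]
  refine (eventuallyFinite_mem_range x).and_imp (eventuallyFinite_mem_tensorRel hx) ?_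
  rintro W V j i ⟨y, rfl⟩ ⟨r, hr, e⟩ hj hi
  -- over a field, tensor products of injective maps are injective
  have hinj : Function.Injective (TensorProduct.map (lin j) (lin i)) :=
    TensorProduct.map_injective_of_flat_flat _ _ hj hi
  rw [preTensorD_map] at e
  have hw : (tensorObj W V).d (tensorQuot W V y) = 0 := by
    rw [d_tensorQuot, tensorQuot_eq_zero, ← hinj e]
    exact hr
  refine ⟨gproj _ l (tensorQuot W V y), gproj_mem _ _ _, by rw [d_gproj, hw, map_zero], ?_⟩
  rw [lin_gproj, lin_tensorMap₂_tensorQuot, gproj_same _ hl]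

end Finite

/-- Homotopic morphisms induce the same map on cohomology. -/
lemma quasiIso_of_homotopy {M N : DGBimod A B} {f g : M ⟶ N} (h : M →ₗ[k] N)
    (hh : ∀ m, lin g m = lin f m + (N.d (h m) + h (M.d m))) (hf : quasiIso A B f) :
    quasiIso A B g := by
  have : cohomologyMap g = cohomologyMap f := by
    refine Submodule.linearMap_qext _ (LinearMap.ext fun m => ?_)
    refine (Submodule.Quotient.eq _).2 ⟨h m, ?_⟩
    have h₁ := hh m
    rw [show M.d m = 0 from m.2, map_zero, add_zero] at h₁
    exact (sub_eq_of_eq_add' h₁).symm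
  rw [quasiIso, this]
  exact hf

section Point

/-- The morphism `A → M` of right dg modules given by a cocycle of degree `0`. -/
def pointRight {M : A.RMod} (x : M) (hx : x ∈ M.grading 0) (hd : M.d x = 0) :
    (diag A).forgetLeft ⟶ M :=
  Hom.mk (M := (diag A).forgetLeft) (M.ract.flip x : A →ₗ[k] M)
    (fun c a => (M.ract.flip x).map_smul (show k from c) (show A from a) |>.trans
      (ground_smul M c _).symm)
    (fun b (a : A) => mul_smul (op b) (op a) x)
    (fun {i a} ha => by
      have := M.rsmul_mem hx (b := a) ha
      rwa [zero_add] at this)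
    (fun (a : A) => by
      have := M.d_rsmul hx a
      rw [hd, smul_zero, zero_add, ksign_zero, one_smul] at this
      exact this.symm)

/-- The morphism `A → M` of left dg modules given by a cocycle of degree `0`. -/
def pointLeft {M : A.LMod} (x : M) (hx : x ∈ M.grading 0) (hd : M.d x = 0) :
    (diag A).forgetRight ⟶ M :=
  Hom.mk (M := (diag A).forgetRight) (M.lact.flip x : A →ₗ[k] M)
    (fun b (a : A) => mul_smul b a x)
    (fun c a => (M.lact.flip x).map_smul (show k from c) (show A from a) |>.trans
      (ground_rsmul M c _).symm)
    (fun {i a} ha => by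
      have := M.smul_mem (a := a) ha hx
      rwa [add_zero] at this)
    (fun (a : A) => LinearMap.congr_fun (f := M.lact.flip x ∘ₗ A.d) (g := M.d ∘ₗ M.lact.flip x)
      (gext A.grading fun i a ha => by
        have := M.d_smul ha x
        rw [hd, smul_zero, smul_zero, add_zero] at this
        exact this.symm) a)

end Point

end DGBimod

namespace DGBimod

open DGAlg DCat

variable {k : Type u} [Field k] {A B C E : DGAlg k}

lemma FinCell.rightFlat {M : DGBimod A B} (hM : FinCell M) : RightFlat M := by
  induction hM with
  | zero M =>
    intro _ N _ x _
    refine ⟨0, (map_zero _).trans (LinearMap.congr_fun (f := (0 : tensorObj M N →ₗ[k] _))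
      (g := LinearMap.id) (tm_ext fun m n => ?_) x)⟩
    rw [Subsingleton.elim m 0, map_zero]
    simp
  | attach deg M f _ ih => exact (rightFlat_cell deg).cone f ih

lemma FinCell.leftFlat {M : DGBimod A B} (hM : FinCell M) : LeftFlat M := by
  induction hM with
  | zero M =>
    intro _ N _ x _
    refine ⟨0, (map_zero _).trans (LinearMap.congr_fun (f := (0 : tensorObj N M →ₗ[k] _))
      (g := LinearMap.id) (tm_ext fun m n => ?_) x)⟩
    rw [Subsingleton.elim n 0, map_zero]
    simp
  | attach deg M f _ ih => exact (leftFlat_cell deg).cone f ih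

lemma exists_homogeneous_cocycle {M N : DGBimod A B} {q : M ⟶ N} (hq : quasiIso A B q) {i : ℤ}
    {y : N} (hy : y ∈ N.grading i) (hd : N.d y = 0) :
    ∃ z ∈ M.grading i, M.d z = 0 ∧ ∃ n ∈ N.grading (i - 1), lin q z = y + N.d n := by
  obtain ⟨z, n, hz, h⟩ := ((quasiIso_iff q).1 hq).2 y hd
  refine ⟨gproj _ i z, gproj_mem _ _ _, by rw [d_gproj, hz, map_zero], gproj _ (i - 1) n,
    gproj_mem _ _ _, ?_⟩
  rw [lin_gproj, d_gproj, h, map_add, gproj_same _ hy, sub_add_cancel]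

variable {A' B' : DGAlg k}

lemma mem_of_quasiIso {P : ObjectProperty (DCat A B)} (hP : IsThick P) {M N : DGBimod A B}
    (f : M ⟶ N) (hf : quasiIso A B f) : P ((Q A B).obj M) ↔ P ((Q A B).obj N) :=
  have := isIso_Q_map f hf
  ⟨hP.iso (asIso ((Q A B).map f)), hP.iso (asIso ((Q A B).map f)).symm⟩

/-- If a quasi-isomorphism factors through `Y`, then its source is a direct summand of `Y` in the
derived category. -/
lemma mem_of_quasiIso_comp {P : ObjectProperty (DCat A' B')} (hP : IsThick P)
    {F : DGBimod A B ⥤ DGBimod A' B'} (hF : IsExact F) {X Y Z : DGBimod A B} (f : X ⟶ Y)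
    (g : Y ⟶ Z) (h : quasiIso A B (f ≫ g)) (hY : P ((Q A' B').obj (F.obj Y))) :
    P ((Q A' B').obj (F.obj X)) := by
  have := isIso_Q_map _ (hF.quasiIso_map _ h)
  refine hP.summand (Y := (Q A' B').obj (F.obj Y)) ⟨(Q A' B').map (F.map f),
    (Q A' B').map (F.map g) ≫ inv ((Q A' B').map (F.map (f ≫ g))), ?_⟩ hY
  rw [← Category.assoc, ← Functor.map_comp, ← F.map_comp, IsIso.hom_inv_id]

/-- If `K` is invertible, the finitely many elements needed to write `1` as an element of
`K ⊗_B L` lie in a finite cell module, of which `K` is a direct summand in the derived category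
of right dg modules. -/
lemma InvPair.perf {K : DGBimod A B} {L : DGBimod B A} (h : InvPair K L) :
    B.Perf ((Q _ _).obj K.forgetLeft) := by
  obtain ⟨H, f, g, hf, hg⟩ := h.cospan
  obtain ⟨H', f', g', hf', hg'⟩ := h.cospan'
  let S := res K.forgetLeft
  let q : tensorObj S L ⟶ H.forgetLeft := tensorMap L (resπ K.forgetLeft) ≫
    (forgetLeftTensor K L).hom ≫ forgetLeftMap g
  have hq : quasiIso _ _ q := (quasiIso _ _).comp_mem _ _
    (h.leftFlat'.quasiIso_tensorMap _ (quasiIso_resπ _)) ((quasiIso _ _).comp_mem _ _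
      (quasiIso_of_isIso _) (quasiIso_forgetLeftMap.2 hg))
  let y : H := lin f (1 : A)
  have hy : y ∈ H.grading 0 := lin_mem f A.one_mem
  have hyd : H.d y = 0 := (lin_d f (1 : A)).symm.trans
    ((congrArg (lin f) A.d_one).trans (map_zero _))
  obtain ⟨z, hz, hzd, (n : H), (hn : n ∈ H.grading (0 - 1)), hzn⟩ :=
    exists_homogeneous_cocycle (N := H.forgetLeft) hq (y := y) hy hyd
  obtain ⟨s, t, hs, -, hW⟩ := eventuallyFinite_cocycle hzd hz
  obtain ⟨W, j, hWf, hj, hsub⟩ := locallyFinCell_res K.forgetLeft s hs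
  obtain ⟨w, hw, hwd, hwz⟩ := hW W L j (𝟙 L) hsub (fun x _ => ⟨x, rfl⟩) hj Function.injective_id
  have hcomp : quasiIso _ _ (pointRight w hw hwd ≫ tensorMap₂ j (𝟙 L) ≫ q) := by
    refine quasiIso_of_homotopy (M := (diag A).forgetLeft) (N := H.forgetLeft)
      (H.ract.flip n : A →ₗ[k] H) (fun (a : A) => ?_) (quasiIso_forgetLeftMap.2 hf)
    have e₁ : lin (pointRight w hw hwd ≫ tensorMap₂ j (𝟙 L) ≫ q) a =
        op a • (show H from lin q (lin (tensorMap₂ j (𝟙 L)) w)) :=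
      (congrArg (lin q) (lin_map_rsmul (tensorMap₂ j (𝟙 L)) (op a) w)).trans
        (lin_map_rsmul q (op a) _)
    have e₄ : (show H from lin q (lin (tensorMap₂ j (𝟙 L)) w)) = y + H.d n :=
      (congrArg (lin q) hwz).trans hzn
    have e₂ : lin f a = op a • y :=
      (congrArg (lin f) (one_mul a).symm).trans (lin_map_rsmul f (op a) (1 : A))
    have e₃ := H.d_rsmul hn a
    rw [zero_sub, show (-1 : ℤ) = 0 - 1 from (zero_sub 1).symm, ksign_sub_one, ksign_zero,
      neg_one_smul] at e₃
    refine e₁.trans ((congrArg (op a • ·) e₄).trans ?_)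
    refine (smul_add (op a) y (H.d n)).trans ?_
    have e₅ : op a • y + op a • H.d n = lin f a + (H.d (op a • n) + op (A.d a) • n) := by
      rw [e₃, neg_add_cancel_right, ← e₂]
    exact e₅
  have hP : IsThick B.Perf := thick_isThick _
  have h₁ : B.Perf ((Q _ _).obj (tensorObj (tensorObj W L) K)) := by
    have hr := hWf.rightFlat
    rw [mem_of_quasiIso hP (assoc W L K).hom (quasiIso_of_isIso _),
      mem_of_quasiIso hP _ (hr.quasiIso_tensorMapRight g' hg'),
      ← mem_of_quasiIso hP _ (hr.quasiIso_tensorMapRight f' hf'),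
      mem_of_quasiIso hP (rightUnit W).hom (quasiIso_of_isIso _)]
    exact hWf.perf
  have h₂ := mem_of_quasiIso_comp hP (h.leftFlat.isExact (A := ground k)) _ _ hcomp h₁
  exact (mem_of_quasiIso hP (forgetLeftUnit K).hom (quasiIso_of_isIso _)).1 h₂

/-- The analogue of `InvPair.perf` for left dg modules. -/
lemma InvPair.perfOp {K : DGBimod A B} {L : DGBimod B A} (h : InvPair K L) :
    B.PerfOp ((Q _ _).obj L.forgetRight) := by
  obtain ⟨H, f, g, hf, hg⟩ := h.cospan
  obtain ⟨H', f', g', hf', hg'⟩ := h.cospan'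
  let S := res L.forgetRight
  let q : tensorObj K S ⟶ H.forgetRight := tensorMapRight K (resπ L.forgetRight) ≫
    (forgetRightTensor K L).hom ≫ forgetRightMap g
  have hq : quasiIso _ _ q := (quasiIso _ _).comp_mem _ _
    (h.rightFlat.quasiIso_tensorMapRight _ (quasiIso_resπ _)) ((quasiIso _ _).comp_mem _ _
      (quasiIso_of_isIso _) (quasiIso_forgetRightMap.2 hg))
  let y : H := lin f (1 : A)
  have hy : y ∈ H.grading 0 := lin_mem f A.one_mem
  have hyd : H.d y = 0 := (lin_d f (1 : A)).symm.trans
    ((congrArg (lin f) A.d_one).trans (map_zero _))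
  obtain ⟨z, hz, hzd, (n : H), (hn : n ∈ H.grading (0 - 1)), hzn⟩ :=
    exists_homogeneous_cocycle (N := H.forgetRight) hq (y := y) hy hyd
  obtain ⟨s, t, -, ht, hW⟩ := eventuallyFinite_cocycle hzd hz
  obtain ⟨W, j, hWf, hj, hsub⟩ := locallyFinCell_res L.forgetRight t ht
  obtain ⟨w, hw, hwd, hwz⟩ := hW K W (𝟙 K) j (fun x _ => ⟨x, rfl⟩) hsub Function.injective_id hj
  have hcomp : quasiIso _ _ (pointLeft w hw hwd ≫ tensorMap₂ (𝟙 K) j ≫ q) := by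
    refine quasiIso_of_homotopy (M := (diag A).forgetRight) (N := H.forgetRight)
      (H.lact.flip n ∘ₗ twist A.grading 1 : A →ₗ[k] H) (fun (a : A) => ?_)
      (quasiIso_forgetRightMap.2 hf)
    have e₁ : lin (pointLeft w hw hwd ≫ tensorMap₂ (𝟙 K) j ≫ q) a =
        a • (show H from lin q (lin (tensorMap₂ (𝟙 K) j) w)) :=
      (congrArg (lin q) (lin_map_smul (tensorMap₂ (𝟙 K) j) a w)).trans (lin_map_smul q a _)
    have e₄ : (show H from lin q (lin (tensorMap₂ (𝟙 K) j) w)) = y + H.d n :=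
      (congrArg (lin q) hwz).trans hzn
    have e₂ : lin f a = a • y :=
      (congrArg (lin f) (mul_one a).symm).trans (lin_map_smul f a (1 : A))
    have e₃ : H.lact.flip (H.d n) = H.d ∘ₗ H.lact.flip n ∘ₗ twist A.grading 1 +
        H.lact.flip n ∘ₗ twist A.grading 1 ∘ₗ A.d := gext A.grading fun i a ha => by
      change a • H.d n = H.d (twist A.grading 1 a • n) + twist A.grading 1 (A.d a) • n
      rw [twist_of_mem _ _ ha, twist_of_mem _ _ (A.d_mem ha), smul_assoc, smul_assoc,
        H.d.map_smul, H.d_smul ha, one_mul, one_mul, ksign_add, ksign_one, smul_add, smul_smul,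
        ksign_mul_self, one_smul, mul_neg_one, neg_smul]
      abel
    refine e₁.trans ((congrArg (a • ·) e₄).trans ?_)
    refine (smul_add a y (H.d n)).trans ?_
    have e₅ : a • y + a • H.d n = lin f a + (H.d (twist A.grading 1 a • n) +
        twist A.grading 1 (A.d a) • n) := by
      rw [← e₂]
      exact congrArg _ (LinearMap.congr_fun e₃ a)
    exact e₅
  have hP : IsThick B.PerfOp := thick_isThick _
  have h₁ : B.PerfOp ((Q _ _).obj (tensorObj L (tensorObj K W))) := by
    have hr := hWf.leftFlat
    rw [← mem_of_quasiIso hP (assoc L K W).hom (quasiIso_of_isIso _),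
      mem_of_quasiIso hP _ (hr.quasiIso_tensorMap g' hg'),
      ← mem_of_quasiIso hP _ (hr.quasiIso_tensorMap f' hf'),
      mem_of_quasiIso hP (leftUnit W).hom (quasiIso_of_isIso _)]
    exact hWf.perfOp
  have h₂ := mem_of_quasiIso_comp hP (h.rightFlat'.isExact (C := ground k)) _ _ hcomp h₁
  exact (mem_of_quasiIso hP (forgetRightUnit L).hom (quasiIso_of_isIso _)).1 h₂

/-! ### Comparison of diagonal dimensions -/

/-- The exact functor `M ↦ L ⊗_A M ⊗_A K` sends the diagonal bimodule of `A` to that of `B`, and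
`F ⊠ G` to `(L ⊗_A F) ⊠ (G ⊗_A K)`. -/
lemma InvPair.ddim_le {K : DGBimod A B} {L : DGBimod B A} (h : InvPair K L) :
    B.Ddim ≤ A.Ddim := by
  refine le_iInf fun ⟨n, F, G, hF, hG, hgen⟩ => ?_
  have hF' : B.PerfOp ((Q _ _).obj (tensorObj L F)) :=
    (h.rightFlat'.isExact (C := ground k)).thick_map (thick_isThick _)
      ((mem_of_quasiIso (thick_isThick _) (forgetRightUnit L).hom (quasiIso_of_isIso _)).2
        h.perfOp) hF
  have hG' : B.Perf ((Q _ _).obj (tensorObj G K)) :=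
    (h.leftFlat.isExact (A := ground k)).thick_map (thick_isThick _)
      ((mem_of_quasiIso (thick_isThick _) (forgetLeftUnit K).hom (quasiIso_of_isIso _)).2
        h.perf) hG
  have h₁ := h.rightFlat'.isExact.gen_map (h.leftFlat.isExact.gen_map hgen)
  obtain ⟨H', f', g', hf', hg'⟩ := h.cospan'
  have := isIso_Q_map f' hf'
  have := isIso_Q_map g' hg'
  have e₁ : (tensorLeftFun L).obj ((tensorFun K).obj (boxtimes F G)) ≅
      boxtimes (tensorObj L F) (tensorObj G K) :=
    (tensorLeftFun L).mapIso (assoc F G K) ≪≫ (assoc L F (tensorObj G K)).symm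
  let e₃ : (Q B B).obj (tensorObj L K) ≅ (Q B B).obj (diag B) :=
    asIso ((Q B B).map g') ≪≫ (asIso ((Q B B).map f')).symm
  have e₂ : (Q B B).obj ((tensorLeftFun L).obj ((tensorFun K).obj (diag A))) ≅
      (Q B B).obj (diag B) :=
    (Q B B).mapIso ((tensorLeftFun L).mapIso (leftUnit K)) ≪≫ e₃
  exact iInf_le_of_le ⟨n, tensorObj L F, tensorObj G K, hF', hG',
    gen_of_iso e₂ (gen_le_of_iso ((Q B B).mapIso e₁) n _ h₁)⟩ le_rfl

end DGBimod

theorem mainTheorem7 {k : Type u} [Field k] (A B : DGAlg.{u} k) (h : A.MoritaEquivalent B) :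
    A.Ddim = B.Ddim := by
  obtain ⟨K, L, hKL⟩ := DGBimod.exists_invPair h
  exact le_antisymm hKL.symm.ddim_le hKL.ddim_le



end
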